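/- All graphs are finite, simple and undirected. For a graph $G$, $\mathrm{tw}(G)$ denotes its treewidth. A *modulator* of $G$ is a set $S\subseteq V(G)$ with $\mathrm{tw}(G-S)\le 2$. For $t\in\mathbb N$, a *solution* for an instance $(G,t)$ (of Treewidth-2 Vertex Deletion) is a modulator $S$ of $G$ with $|S|\le t$, and two instances are *equivalent* if both or neither have a solution. For $U\subseteq V(G)$, $N_G(U)$ and $N_G[U]=N_G(U)\cup U$ are the open and closed neighbourhoods of $U$, and for a subgraph $H$ these are taken of $V(H)$. $\mathcal C(G)$ is the set of connected components of $G$. * $(G,t)$ is *non-trivial* if $|V(G)|>4$, $\mathrm{tw}(G)>2$, $t>0$, and there is no non-empty connected subgraph $H$ of $G$ such that the graph $G[N_G[H]]$, with all edges between distinct vertices of $N_G(H)$ added, has treewidth at most $2$. * A *tidy modulator* of $G$ is a modulator $X$ such that $X\setminus\{x\}$ is a modulator for every $x\in X$. It is *linked* for $(G,t)$ if any two distinct non-adjacent vertices of $X$ are joined by at most $t+2$ pairwise internally vertex-disjoint paths in $G$. * $Z\subseteq V(G)$ is a *limit-1 subset* for $(G,t)$ if $|Z\setminus S|\le 1$ for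 every solution $S$ for $(G,t)$. * $Y\subseteq V(G)\setminus X$ is a *component separator* for $(G,t,X)$ if for every component $C\in\mathcal C(G-(X\cup Y))$ the set $N_G(C)\cap X$ is a limit-1 subset for $(G-C,t)$. Put $\mathsf C(t,x)=\binom{x}{3}(t+1)+\binom{x}{2}(2t+3)$ and $\mathsf Y(t,x)=6\binom{x}{2}\bigl(3t+3+\mathsf C(t,\,x+3t+3)\bigr)$. **Theorem.** There is an algorithm which, given a non-trivial instance $(G,t)$ and a linked tidy modulator $X$ for $(G,t)$, takes time polynomial in the size of $G$ (number of steps of a random access machine with unit-cost addition and truncated subtraction) and returns one of the following, together with an indication of which: 1. an instance $(G',t)$ that is equivalent to $(G,t)$ and has $|V(G')|<|V(G)|$; or 2. a component separator $Y$ for $(G,t,X)$ with $|Y|\le \mathsf Y(t,|X|)$, such that $|\mathcal C(G-(X\cup Y))|\le \mathsf C(t,|X|+|Y|)$ and every $C\in\mathcal C(G-(X\cup Y))$ has $|N_G(C)\cap Y|\le 4$. -/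

import Mathlib

namespace TW2D

/-! ## Tree decompositions, modulators, solutions -/

section Graphs

variable {V : Type*}

/-- A tree decomposition of `G`; the decomposition tree is a finite tree on `Fin size`. -/
structure TreeDecomposition (G : SimpleGraph V) where
  size : ℕ
  tree : SimpleGraph (Fin size)
  isTree : tree.IsTree
  bag : Fin size → Finset V
  exists_mem_bag : ∀ v : V, ∃ i, v ∈ bag i
  exists_edge_bag : ∀ u v : V, G.Adj u v → ∃ i, u ∈ bag i ∧ v ∈ bag i
  connected_nodes : ∀ v : V, (tree.induce {i | v ∈ bag i}).Connected

/-- `G` has treewidth at most `k`: some tree decomposition of `G` has width at most `k`,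
that is, all its bags have at most `k + 1` vertices. -/
def TreewidthAtMost (G : SimpleGraph V) (k : ℕ) : Prop :=
  ∃ D : TreeDecomposition G, ∀ i, (D.bag i).card ≤ k + 1

/-- `G - S`, the subgraph induced by the vertices outside `S`. -/
abbrev del (G : SimpleGraph V) (S : Set V) : SimpleGraph ↥(Sᶜ) :=
  G.induce Sᶜ

/-- `S` is a (treewidth-2) modulator of `G`: the graph `G - S` has treewidth at most 2. -/
def IsModulator (G : SimpleGraph V) (S : Set V) : Prop :=
  TreewidthAtMost (del G S) 2

/-- `S` is a solution for the instance `(G, t)`. -/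
def IsSolution (G : SimpleGraph V) (t : ℕ) (S : Set V) : Prop :=
  IsModulator G S ∧ S.ncard ≤ t

/-- `(G, t)` is a yes-instance of Treewidth-2 Vertex Deletion; equivalently, a minimum
modulator of `G` has size at most `t`. -/
def IsYesInstance (G : SimpleGraph V) (t : ℕ) : Prop :=
  ∃ S : Set V, IsSolution G t S

/-- The open neighbourhood `N_G(U)` of a vertex set. -/
def openNbhd (G : SimpleGraph V) (U : Set V) : Set V :=
  {v | v ∉ U ∧ ∃ u ∈ U, G.Adj u v}

/-- The closed neighbourhood `N_G[U]` of a vertex set. -/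
def closedNbhd (G : SimpleGraph V) (U : Set V) : Set V :=
  openNbhd G U ∪ U

/-- `G ∪ (A choose 2)`: the graph `G` with all edges between distinct vertices of `A` added. -/
def addClique (G : SimpleGraph V) (A : Set V) : SimpleGraph V :=
  G ⊔ SimpleGraph.fromRel (fun u v => u ∈ A ∧ v ∈ A)

/-- The vertex sets of the connected components of `G - Z`. -/
def components (G : SimpleGraph V) (Z : Set V) : Set (Set V) :=
  Set.range fun c : (del G Z).ConnectedComponent => Subtype.val '' c.supp

/-! ## Non-trivial instances -/

/-- The contraction rule applies to `G`: there is a (non-empty) connected subgraph `H`, with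
vertex set `U`, such that `G[N[H]]`, with the neighbours of `H` made into a clique, has
treewidth at most 2. -/
def ContractionApplicable (G : SimpleGraph V) : Prop :=
  ∃ U : Set V, (G.induce U).Connected ∧
    TreewidthAtMost ((addClique G (openNbhd G U)).induce (closedNbhd G U)) 2

/-- `(G, t)` is a trivial instance. -/
def IsTrivialInstance (G : SimpleGraph V) (t : ℕ) : Prop :=
  Nat.card V ≤ 4 ∨ TreewidthAtMost G 2 ∨ t = 0 ∨ ContractionApplicable G

/-! ## Linked tidy modulators -/

/-- Every `X \ {x}` with `x ∈ X` is a modulator, and so is `X` itself. -/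
def IsTidyModulator (G : SimpleGraph V) (X : Set V) : Prop :=
  IsModulator G X ∧ ∀ x ∈ X, IsModulator G (X \ {x})

/-- Two paths between `x` and `y` share no vertex other than `x` and `y`. -/
def InternallyDisjoint {G : SimpleGraph V} {x y : V} (p q : G.Path x y) : Prop :=
  ∀ v, v ∈ p.1.support → v ∈ q.1.support → v = x ∨ v = y

/-- `X` is linked for `(G, t)`: any two distinct non-adjacent vertices of `X` are joined by at
most `t + 2` pairwise internally vertex-disjoint paths of `G`. -/
def IsLinked (G : SimpleGraph V) (t : ℕ) (X : Set V) : Prop :=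
  ∀ x ∈ X, ∀ y ∈ X, x ≠ y → ¬ G.Adj x y →
    ∀ P : Finset (G.Path x y), (P : Set (G.Path x y)).Pairwise InternallyDisjoint →
      P.card ≤ t + 2

/-- `X` is a linked tidy modulator for `(G, t)`. -/
def IsLinkedTidyModulator (G : SimpleGraph V) (t : ℕ) (X : Set V) : Prop :=
  IsLinked G t X ∧ IsTidyModulator G X

/-! ## Component separators -/

/-- `X` is a limit-`m` subset for `(G, t)`. -/
def IsLimitSubset (m : ℕ) (G : SimpleGraph V) (t : ℕ) (X : Set V) : Prop :=
  ∀ S : Set V, IsSolution G t S → (X \ S).ncard ≤ m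

/-- `Y` is a component separator for `(G, t, X)`: it is disjoint from `X`, and for each component
`C` of `G - (X ∪ Y)` the set `N_G(C) ∩ X`, as a vertex set of `G - C`, is a limit-1 subset
for `(G - C, t)`. -/
def IsComponentSeparator (G : SimpleGraph V) (t : ℕ) (X Y : Set V) : Prop :=
  Disjoint Y X ∧ ∀ C ∈ components G (X ∪ Y),
    IsLimitSubset 1 (del G C) t (Subtype.val ⁻¹' (openNbhd G C ∩ X))

end Graphs

/-- The bound `C(t, x)` on the number of components. -/
def boundC (t x : ℕ) : ℕ :=
  x.choose 3 * (t + 1) + x.choose 2 * (2 * t + 3)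

/-- The bound `Y(t, x)` on the size of the component separator. -/
def boundY (t x : ℕ) : ℕ :=
  6 * x.choose 2 * (3 * t + 3 + boundC t (x + 3 * t + 3))

/-! ## A random access machine with a step count

Programs are while-programs over scalar variables and arrays that hold natural numbers. The
arithmetic operations are addition and truncated subtraction only, so the bit length of
the numbers grows by a constant per step and unit-cost running times on this machine are polynomially
related to those of Turing machines. -/

namespace RAM

/-- Memory: scalar variables `var x`, and arrays with cells `arr a i`. -/
structure State where
  var : ℕ → ℕ
  arr : ℕ → ℕ → ℕ

/-- Arithmetic expressions. In `get a e`, the name `a` of the array is fixed by the program, and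
the index is computed. -/
inductive Term where
  | const (c : ℕ)
  | var (x : ℕ)
  | get (a : ℕ) (e : Term)
  | add (e₁ e₂ : Term)
  | sub (e₁ e₂ : Term)

/-- The value of an expression. -/
def Term.eval (s : State) : Term → ℕ
  | .const c => c
  | .var x => s.var x
  | .get a e => s.arr a (e.eval s)
  | .add e₁ e₂ => e₁.eval s + e₂.eval s
  | .sub e₁ e₂ => e₁.eval s - e₂.eval s

/-- The number of elementary operations needed to evaluate an expression. -/
def Term.cost : Term → ℕ
  | .const _ => 1
  | .var _ => 1
  | .get _ e => e.cost + 1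
  | .add e₁ e₂ => e₁.cost + e₂.cost + 1
  | .sub e₁ e₂ => e₁.cost + e₂.cost + 1

/-- Programs: no operation, `x := e`, `a[e₁] := e₂`, sequencing, branching on `e ≠ 0`, and
looping while `e ≠ 0`. -/
inductive Prog where
  | nop
  | assign (x : ℕ) (e : Term)
  | put (a : ℕ) (e₁ e₂ : Term)
  | seq (p q : Prog)
  | branch (e : Term) (p q : Prog)
  | loop (e : Term) (p : Prog)

/-- The state after `x := c`. -/
def State.setVar (s : State) (x c : ℕ) : State :=
  { s with var := Function.update s.var x c }

/-- The state after `a[i] := c`. -/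
def State.setArr (s : State) (a i c : ℕ) : State :=
  { s with arr := Function.update s.arr a (Function.update (s.arr a) i c) }

/-- `Run p s k s'`: started in state `s`, the program `p` halts after exactly `k` steps, in
state `s'`. -/
inductive Run : Prog → State → ℕ → State → Prop
  | nop (s : State) : Run .nop s 1 s
  | assign (x : ℕ) (e : Term) (s : State) :
      Run (.assign x e) s (e.cost + 1) (s.setVar x (e.eval s))
  | put (a : ℕ) (e₁ e₂ : Term) (s : State) :
      Run (.put a e₁ e₂) s (e₁.cost + e₂.cost + 1) (s.setArr a (e₁.eval s) (e₂.eval s))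
  | seq {p q : Prog} {s s' s'' : State} {k l : ℕ} :
      Run p s k s' → Run q s' l s'' → Run (.seq p q) s (k + l) s''
  | branch_true {e : Term} {p q : Prog} {s s' : State} {k : ℕ} :
      e.eval s ≠ 0 → Run p s k s' → Run (.branch e p q) s (e.cost + 1 + k) s'
  | branch_false {e : Term} {p q : Prog} {s s' : State} {k : ℕ} :
      e.eval s = 0 → Run q s k s' → Run (.branch e p q) s (e.cost + 1 + k) s'
  | loop_true {e : Term} {p : Prog} {s s' s'' : State} {k l : ℕ} :
      e.eval s ≠ 0 → Run p s k s' → Run (.loop e p) s' l s'' →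
        Run (.loop e p) s (e.cost + 1 + k + l) s''
  | loop_false {e : Term} {p : Prog} {s : State} :
      e.eval s = 0 → Run (.loop e p) s (e.cost + 1) s

end RAM

/-! ## Input and output conventions -/

open Classical in
/-- The initial memory for the input `(G, t, X)`, where `G` has the vertices `0, …, n - 1`: variable
0 holds `n`, variable 1 holds `t`, array 0 holds the adjacency matrix of `G` row by row,
array 1 holds the characteristic vector of `X`, and all other cells are `0`. -/
noncomputable def inputState {n : ℕ} (G : SimpleGraph (Fin n)) (t : ℕ) (X : Set (Fin n)) :
    RAM.State where
  var x := if x = 0 then n else if x = 1 then t else 0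
  arr a k :=
    if a = 0 then (if ∃ i j : Fin n, k = i * n + j ∧ G.Adj i j then 1 else 0)
    else if a = 1 then (if ∃ i : Fin n, k = i ∧ i ∈ X then 1 else 0)
    else 0

open Classical in
/-- The memory holds the instance `(G, t)`, with the same conventions as for the input. -/
def HoldsInstance (s : RAM.State) {m : ℕ} (G : SimpleGraph (Fin m)) (t : ℕ) : Prop :=
  s.var 0 = m ∧ s.var 1 = t ∧
    ∀ i j : Fin m, s.arr 0 (i * m + j) = if G.Adj i j then 1 else 0

open Classical in
/-- Array 2 holds the characteristic vector of the vertex set `Y`. -/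
def HoldsSet (s : RAM.State) {n : ℕ} (Y : Set (Fin n)) : Prop :=
  ∀ i : Fin n, s.arr 2 i = if i ∈ Y then 1 else 0

/-- First outcome, announced by the value `1` of variable 2: the memory holds an equivalent
instance `(G', t)` with fewer vertices. -/
def ReducedOutcome {n : ℕ} (G : SimpleGraph (Fin n)) (t : ℕ) (s : RAM.State) : Prop :=
  s.var 2 = 1 ∧ ∃ (m : ℕ) (G' : SimpleGraph (Fin m)),
    HoldsInstance s G' t ∧ m < n ∧ (IsYesInstance G t ↔ IsYesInstance G' t)

/-- Second outcome, announced by the value `2` of variable 2: the memory holds a component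
separator `Y` for `(G, t, X)` with the three size bounds. -/
def SeparatorOutcome {n : ℕ} (G : SimpleGraph (Fin n)) (t : ℕ) (X : Set (Fin n))
    (s : RAM.State) : Prop :=
  s.var 2 = 2 ∧ ∃ Y : Set (Fin n),
    HoldsSet s Y ∧
    IsComponentSeparator G t X Y ∧
    Y.ncard ≤ boundY t X.ncard ∧
    (components G (X ∪ Y)).ncard ≤ boundC t (X.ncard + Y.ncard) ∧
    ∀ C ∈ components G (X ∪ Y), (openNbhd G C ∩ Y).ncard ≤ 4

end TW2D

/-! Treewidth at most two is handled through elimination orders. Order the vertices of `A` and let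
`Tr v` be the component of `v` among the vertices no later than `v`; the order is good if each `Tr
v` has at most two neighbours in `A`. The sets `Tr v` form a laminar family, an elimination tree
with bags `{v} ∪ N(Tr v)` of size at most three. Excluding `K₄` minors, adding an edge between two
vertices with three disjoint connectors, and gluing along small cliques become short arguments about
how connected sets leave some `Tr v`. A good order exists exactly if greedy elimination succeeds
(`TW.exists_canEliminate`), which makes treewidth two decidable in polynomial time.

Reduction. Fix `Z ⊇ X`. Suppose that any three neighbours of a component `C` of `G - Z` are also
seen by `t + 1` other components, and any two by `t + 3` others that are at least as obstructive as
`C`. A set `S` of at most `t` vertices leaves enough of these components intact to force what `C`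
itself would force, so one vertex of `C` may be deleted (`Reducible.tw`). If no component is of this
kind, then counting over triples and pairs of `Z` gives at most `C(t, |Z|)` components
(`ncard_components_le`).

Separator. Fix a good order of `G - X`. For each pair `x`, `y` of `X`, nodes of the elimination tree
are marked in increasing order, each time the lowest one whose remaining subtree is bad: it joins
`x` and `y` and, if these are adjacent, has treewidth more than two together with them. The bad sets
are disjoint. For non-adjacent `x`, `y` they carry internally disjoint paths, so linkedness bounds
their number by `t + 2`; for adjacent ones marking stops at `t + 2`. If an adjacent pair stays below
this limit, one more node is marked in each remaining component that still joins `x` and `y`. The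
separator `Y` consists of the bags of all marks and of the branching nodes between them. A component
`C` of `G - (X ∪ Y)` that sees `x` and `y` then leaves only one possibility: there are `t + 2` bad
sets, of which `C` meets at most one and a solution at most `t`, so the solution contains `x` or `y`
(`no_solution_avoids_pair`). Closing the marks under branching at most doubles their number and
leaves each `C` between two nodes of the tree, hence with at most 2 + 2 neighbours in `Y`
(`ncard_openNbhd_inter_le`).

Algorithm. If some vertex lies in a replaceable component for one of the sets `Z` used above, it is
deleted; otherwise all the bounds hold and `Y` is returned. Polynomial time is obtained from closure
properties: the numbers computable in polynomial time are closed under addition, truncated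
subtraction, summation over vertices and iteration of set operators, and every set above is defined
by these means. -/

namespace TW2D

/-! ## Reachability inside a vertex set -/

section Reachability

variable {V : Type*}

/-- There is a walk from `u` to `v` in `G` all of whose vertices after the first lie in `A`. -/
def Reach (G : SimpleGraph V) (A : Set V) (u v : V) : Prop :=
  Relation.ReflTransGen (fun a b => G.Adj a b ∧ b ∈ A) u v

/-- Any two vertices of `B` are joined by a walk of `G` inside `B`. -/
def ConnSet (G : SimpleGraph V) (B : Set V) : Prop :=
  ∀ u ∈ B, ∀ v ∈ B, Reach G B u v

variable {G H : SimpleGraph V} {A B : Set V} {u v w : V}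

theorem Reach.refl (G : SimpleGraph V) (A : Set V) (u : V) : Reach G A u u :=
  Relation.ReflTransGen.refl

theorem Reach.trans (h₁ : Reach G A u v) (h₂ : Reach G A v w) : Reach G A u w :=
  Relation.ReflTransGen.trans h₁ h₂

theorem Reach.step (h₁ : Reach G A u v) (h₂ : G.Adj v w) (h₃ : w ∈ A) : Reach G A u w :=
  Relation.ReflTransGen.tail h₁ ⟨h₂, h₃⟩

theorem Reach.mono (hG : G ≤ H) (hA : A ⊆ B) (h : Reach G A u v) : Reach H B u v :=
  Relation.ReflTransGen.mono (fun _ _ hab => ⟨hG hab.1, hA hab.2⟩) _ _ h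

theorem Reach.mono_set (hA : A ⊆ B) (h : Reach G A u v) : Reach G B u v :=
  h.mono le_rfl hA

theorem Reach.eq_or_mem (h : Reach G A u v) : v = u ∨ v ∈ A := by
  rcases Relation.ReflTransGen.cases_tail h with h | ⟨_, _, h⟩
  · exact Or.inl h
  · exact Or.inr h.2

theorem Reach.mem (h : Reach G A u v) (hu : u ∈ A) : v ∈ A := by
  rcases h.eq_or_mem with rfl | h
  exacts [hu, h]

theorem Reach.symm (h : Reach G A u v) (hu : u ∈ A) : Reach G A v u := by
  induction h with
  | refl => exact Reach.refl _ _ _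
  | tail hab hbc ih =>
    have hb := Reach.mem hab hu
    exact Relation.ReflTransGen.head ⟨hbc.1.symm, hb⟩ ih

/-- A walk into `A` can be confined to the set of vertices it reaches. -/
theorem Reach.confine (h : Reach G A u v) : Reach G {w | Reach G A u w} u v := by
  induction h with
  | refl => exact Reach.refl _ _ _
  | tail hab hbc ih => exact ih.step hbc.1 (Reach.step hab hbc.1 hbc.2)

theorem connSet_reach (G : SimpleGraph V) (A : Set V) (u : V) :
    ConnSet G {w | Reach G A u w} := by
  intro a ha b hb
  exact ((Reach.confine ha).symm (Reach.refl _ _ _)).trans (Reach.confine hb)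

theorem Reach.subset (hu : u ∈ A) : {w | Reach G A u w} ⊆ A := fun _ h => Reach.mem h hu

theorem reach_set_eq (hu : u ∈ A) (h : Reach G A u v) :
    {w | Reach G A u w} = {w | Reach G A v w} := by
  ext w
  exact ⟨fun h' => (h.symm hu).trans h', fun h' => h.trans h'⟩

theorem ConnSet.subset_reach (hB : ConnSet G B) (hBA : B ⊆ A) (hu : u ∈ B) :
    B ⊆ {w | Reach G A u w} := fun v hv => (hB u hu v hv).mono_set hBA

theorem ConnSet.mono (hB : ConnSet G B) (h : G ≤ H) : ConnSet H B :=
  fun u hu v hv => (hB u hu v hv).mono h subset_rfl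

theorem connSet_singleton (G : SimpleGraph V) (v : V) : ConnSet G {v} := by
  rintro a rfl b rfl
  exact Reach.refl _ _ _

/-- A walk leaving `T` passes through the neighbourhood of `T`. -/
theorem Reach.exits {T : Set V} (h : Reach G A u v) (hu : u ∈ T) (hv : v ∉ T) :
    ∃ w ∈ A, w ∈ openNbhd G T := by
  induction h with
  | refl => exact absurd hu hv
  | @tail b c hab hbc ih =>
    by_cases hb : b ∈ T
    · exact ⟨c, hbc.2, hv, b, hb, hbc.1⟩
    · exact ih hb

/-- A connected set that touches `T` lies in `T` or meets the neighbourhood of `T`. -/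
theorem ConnSet.meets_openNbhd {T : Set V} (hB : ConnSet G B) (hu : u ∈ B) (hT : u ∈ T)
    (hv : v ∈ B) (hvT : v ∉ T) : ∃ w ∈ B, w ∈ openNbhd G T :=
  (hB u hu v hv).exits hT hvT

theorem ConnSet.meets_openNbhd_of_adj {T : Set V} (hB : ConnSet G B) {z : V} (hz : z ∈ T)
    (hu : u ∈ B) (hzu : G.Adj z u) (hv : v ∈ B) (hvT : v ∉ T) :
    ∃ w ∈ B, w ∈ openNbhd G T := by
  by_cases h : u ∈ T
  · exact hB.meets_openNbhd hu h hv hvT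
  · exact ⟨u, hu, h, z, hz, hzu⟩

theorem ConnSet.subset_of_disjoint_openNbhd {T : Set V} (hB : ConnSet G B)
    (hd : Disjoint B (openNbhd G T)) (hu : u ∈ B) (hT : u ∈ T) : B ⊆ T := by
  intro v hv
  by_contra hvT
  obtain ⟨w, hw, hw'⟩ := hB.meets_openNbhd hu hT hv hvT
  exact Set.disjoint_left.1 hd hw hw'

theorem connSet_iff_induce_preconnected : ConnSet G B ↔ (G.induce B).Preconnected := by
  constructor
  · rintro h ⟨a, ha⟩ ⟨b, hb⟩
    have key : ∀ c, Reach G B a c → ∃ hc : c ∈ B, (G.induce B).Reachable ⟨a, ha⟩ ⟨c, hc⟩ := by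
      intro c hc
      induction hc with
      | refl => exact ⟨ha, SimpleGraph.Reachable.refl _⟩
      | tail hab hbc ih =>
        obtain ⟨hb, ih⟩ := ih
        refine ⟨hbc.2, ih.trans (SimpleGraph.Adj.reachable ?_)⟩
        exact hbc.1
    exact (key b (h a ha b hb)).2
  · intro h a ha b hb
    obtain ⟨p⟩ := h ⟨a, ha⟩ ⟨b, hb⟩
    have key : ∀ (x y : ↥B) (p : (G.induce B).Walk x y), Reach G B x y := by
      intro x y p
      induction p with
      | nil => exact Reach.refl _ _ _
      | cons hadj _ ih => exact Relation.ReflTransGen.head ⟨hadj, Subtype.coe_prop _⟩ ih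
    exact key _ _ p

/-- The components of `G - Z` are the sets reached outside `Z`. -/
theorem mem_components_iff {Z C : Set V} :
    C ∈ components G Z ↔ ∃ v ∉ Z, C = {w | Reach G Zᶜ v w} := by
  have key : ∀ (x : ↥Zᶜ), Subtype.val '' ((del G Z).connectedComponentMk x).supp
      = {w | Reach G Zᶜ x w} := by
    intro x
    ext w
    simp only [Set.mem_image, SimpleGraph.ConnectedComponent.mem_supp_iff,
      SimpleGraph.ConnectedComponent.eq, Set.mem_ofPred_eq, Subtype.exists, exists_and_right,
      exists_eq_right]
    constructor
    · rintro ⟨hw, ⟨p⟩⟩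
      have aux : ∀ (a b : ↥Zᶜ) (p : (del G Z).Walk a b), Reach G Zᶜ a b := by
        intro a b p
        induction p with
        | nil => exact Reach.refl _ _ _
        | cons hadj _ ih => exact Relation.ReflTransGen.head ⟨hadj, Subtype.coe_prop _⟩ ih
      exact (aux _ _ p).symm hw
    · intro h
      induction h with
      | refl => exact ⟨x.2, SimpleGraph.Reachable.refl _⟩
      | tail hab hbc ih =>
        obtain ⟨hb, ih⟩ := ih
        refine ⟨hbc.2, SimpleGraph.Reachable.trans (SimpleGraph.Adj.reachable ?_) ih⟩
        exact hbc.1.symm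
  constructor
  · rintro ⟨c, rfl⟩
    obtain ⟨x, rfl⟩ := c.exists_rep
    exact ⟨x, x.2, key x⟩
  · rintro ⟨v, hv, rfl⟩
    exact ⟨(del G Z).connectedComponentMk ⟨v, hv⟩, key ⟨v, hv⟩⟩

theorem openNbhd_reach_subset {Z : Set V} :
    openNbhd G {w | Reach G Zᶜ v w} ⊆ Z := by
  rintro u ⟨hu, z, hz, hzu⟩
  by_contra h
  exact hu (Reach.step hz hzu h)

end Reachability

/-! ## Elimination orders -/

section Orders

variable {V : Type*}

/-- The vertices of `A` that come no later than `v`. -/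
def Dn (r : V → ℕ) (A : Set V) (v : V) : Set V :=
  {w | w ∈ A ∧ r w ≤ r v}

/-- The component of `v` among the vertices of `A` that come no later than `v`. -/
def Tr (G : SimpleGraph V) (r : V → ℕ) (A : Set V) (v : V) : Set V :=
  {w | Reach G (Dn r A v) v w}

/-- `r` orders `A` such that every `Tr G r A v` has at most two neighbours in `A`. -/
def GoodOrder (G : SimpleGraph V) (A : Set V) (r : V → ℕ) : Prop :=
  Set.InjOn r A ∧ ∀ v ∈ A, (openNbhd G (Tr G r A v) ∩ A).ncard ≤ 2

/-- `G[A]` has an elimination order of width at most two. -/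
def TW (G : SimpleGraph V) (A : Set V) : Prop :=
  ∃ r : V → ℕ, GoodOrder G A r

variable {G H : SimpleGraph V} {A B : Set V} {r : V → ℕ} {u v w : V}

theorem mem_Tr_self (G : SimpleGraph V) (r : V → ℕ) (A : Set V) (v : V) : v ∈ Tr G r A v :=
  Reach.refl _ _ _

theorem self_mem_Dn (hv : v ∈ A) : v ∈ Dn r A v := ⟨hv, le_rfl⟩

theorem Tr_subset_Dn (hv : v ∈ A) : Tr G r A v ⊆ Dn r A v :=
  Reach.subset (self_mem_Dn hv)

theorem connSet_Tr : ConnSet G (Tr G r A v) := connSet_reach _ _ _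

/-- An earlier neighbour would have been absorbed by the component. -/
theorem lt_of_mem_openNbhd_Tr (hu : u ∈ openNbhd G (Tr G r A v)) (huA : u ∈ A) :
    r v < r u := by
  obtain ⟨h1, z, hz, hzu⟩ := hu
  by_contra h
  exact h1 (Reach.step hz hzu ⟨huA, not_lt.1 h⟩)

theorem Tr_subset_Tr (hv : v ∈ A) (hw : w ∈ Tr G r A v) : Tr G r A w ⊆ Tr G r A v := by
  intro z hz
  have h := (Tr_subset_Dn hv hw).2
  exact Reach.trans hw (Reach.mono_set (fun a ha => ⟨ha.1, ha.2.trans h⟩) hz)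

/-- Laminarity: with `Tr_subset_Tr`, two of these sets that meet are nested, the one of the earlier
vertex inside. -/
theorem mem_Tr_of_inter (hw : w ∈ A) (hz : u ∈ Tr G r A v)
    (hz' : u ∈ Tr G r A w) (h : r w ≤ r v) : w ∈ Tr G r A v :=
  Reach.trans hz (Reach.mono_set (fun _ ha => ⟨ha.1, ha.2.trans h⟩)
    (Reach.symm hz' (self_mem_Dn hw)))

theorem ConnSet.subset_Tr (hB : ConnSet G B) (hBA : B ⊆ A) (hv : v ∈ B)
    (hm : ∀ w ∈ B, r w ≤ r v) : B ⊆ Tr G r A v :=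
  hB.subset_reach (fun w hw => ⟨hBA hw, hm w hw⟩) hv

theorem Set.exists_max_rank [Finite V] (r : V → ℕ) (hB : B.Nonempty) :
    ∃ v ∈ B, ∀ w ∈ B, r w ≤ r v :=
  Set.exists_max_image B r (Set.toFinite B) hB

theorem le_two_not_three [Finite V] {N : Set V} (hN : N.ncard ≤ 2) {a b c : V} (ha : a ∈ N)
    (hb : b ∈ N) (hc : c ∈ N) (hab : a ≠ b) (hac : a ≠ c) (hbc : b ≠ c) : False := by
  have : 2 < N.ncard := (Set.two_lt_ncard_iff (Set.toFinite N)).2 ⟨a, b, c, ha, hb, hc, hab, hac, hbc⟩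
  omega

theorem le_two_of_not_three [Finite V] {N : Set V}
    (h : ∀ a ∈ N, ∀ b ∈ N, ∀ c ∈ N, a ≠ b → a ≠ c → b ≠ c → False) : N.ncard ≤ 2 := by
  by_contra hN
  obtain ⟨a, b, c, ha, hb, hc, hab, hac, hbc⟩ :=
    (Set.two_lt_ncard_iff (Set.toFinite N)).1 (not_le.1 hN)
  exact h a ha b hb c hc hab hac hbc

/-- The same order works. The components shrink, and a neighbour of the smaller component comes
later than `v`, so it cannot have been inside the larger one and is a neighbour of that as well. -/
theorem TW.mono [Finite V] (h : TW H A) (hG : G ≤ H) (hB : B ⊆ A) : TW G B := by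
  obtain ⟨r, hr, h⟩ := h
  refine ⟨r, hr.mono hB, fun v hv => le_trans (Set.ncard_le_ncard ?_ (Set.toFinite _)) (h v (hB hv))⟩
  rintro u ⟨hu, huB⟩
  have hlt := lt_of_mem_openNbhd_Tr hu huB
  obtain ⟨-, z, hz, hzu⟩ := hu
  refine ⟨⟨fun h' => ?_, z, ?_, hG hzu⟩, hB huB⟩
  · exact absurd (Tr_subset_Dn (hB hv) h').2 (not_le.2 hlt)
  · exact Reach.mono hG (fun a ha => ⟨hB ha.1, ha.2⟩) hz

theorem TW.mono_set [Finite V] (h : TW G A) (hB : B ⊆ A) : TW G B := h.mono le_rfl hB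

/-! ### Excluding `K₄` minors -/

/-- Two sets are joined by an edge. -/
def SetAdj (G : SimpleGraph V) (B C : Set V) : Prop :=
  ∃ b ∈ B, ∃ c ∈ C, G.Adj b c

theorem SetAdj.symm {B C : Set V} (h : SetAdj G B C) : SetAdj G C B := by
  obtain ⟨b, hb, c, hc, h⟩ := h
  exact ⟨c, hc, b, hb, h.symm⟩

/-- If `B` comes last in four connected, pairwise touching sets, a contradiction arises. -/
theorem no_K4_aux [Finite V] (hr : GoodOrder G A r) {B₁ B₂ B₃ B₄ : Set V} (hA₁ : B₁ ⊆ A)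
    (hA₂ : B₂ ⊆ A) (hA₃ : B₃ ⊆ A) (hA₄ : B₄ ⊆ A)
    (hc₁ : ConnSet G B₁) (hc₂ : ConnSet G B₂) (hc₃ : ConnSet G B₃) (hc₄ : ConnSet G B₄)
    (h23 : Disjoint B₂ B₃) (h24 : Disjoint B₂ B₄) (h34 : Disjoint B₃ B₄)
    (h12 : SetAdj G B₁ B₂) (h13 : SetAdj G B₁ B₃) (h14 : SetAdj G B₁ B₄) {m m₂ m₃ m₄ : V}
    (hm : m ∈ B₁) (hmax : ∀ w ∈ B₁, r w ≤ r m) (hm₂ : m₂ ∈ B₂) (hm₃ : m₃ ∈ B₃) (hm₄ : m₄ ∈ B₄)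
    (hl₂ : r m < r m₂) (hl₃ : r m < r m₃) (hl₄ : r m < r m₄) : False := by
  -- Each of the other three sets touches `Tr m` and has a vertex later than `m`, hence outside;
  -- being connected, it contains a neighbour of `Tr m`. Disjointness makes these three different.
  have hT : B₁ ⊆ Tr G r A m := hc₁.subset_Tr hA₁ hm hmax
  have key : ∀ B : Set V, ConnSet G B → B ⊆ A → SetAdj G B₁ B → (∃ m' ∈ B, r m < r m') →
      ∃ w ∈ B, w ∈ openNbhd G (Tr G r A m) ∩ A := by
    rintro B hc hBA ⟨b, hb, c, hcB, hbc⟩ ⟨m', hm', hlt⟩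
    obtain ⟨w, hw, hw'⟩ := hc.meets_openNbhd_of_adj (hT hb) hcB hbc hm'
      (fun h => absurd (Tr_subset_Dn (hA₁ hm) h).2 (not_le.2 hlt))
    exact ⟨w, hw, hw', hBA hw⟩
  obtain ⟨a, ha, ha'⟩ := key B₂ hc₂ hA₂ h12 ⟨m₂, hm₂, hl₂⟩
  obtain ⟨b, hb, hb'⟩ := key B₃ hc₃ hA₃ h13 ⟨m₃, hm₃, hl₃⟩
  obtain ⟨c, hc, hc'⟩ := key B₄ hc₄ hA₄ h14 ⟨m₄, hm₄, hl₄⟩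
  exact le_two_not_three (hr.2 m (hA₁ hm)) ha' hb' hc'
    (fun h => Set.disjoint_left.1 h23 ha (h ▸ hb)) (fun h => Set.disjoint_left.1 h24 ha (h ▸ hc))
    (fun h => Set.disjoint_left.1 h34 hb (h ▸ hc))

/-- A graph of treewidth at most two has no `K₄` minor. -/
theorem TW.no_K4 [Finite V] (h : TW G A) {B : Fin 4 → Set V} (hA : ∀ i, B i ⊆ A)
    (hn : ∀ i, (B i).Nonempty) (hc : ∀ i, ConnSet G (B i))
    (hd : ∀ i j, i ≠ j → Disjoint (B i) (B j)) (ha : ∀ i j, i < j → SetAdj G (B i) (B j)) :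
    False := by
  obtain ⟨r, hr⟩ := h
  choose m hm hmax using fun i => Set.exists_max_rank r (hn i)
  -- The branch set whose last vertex is earliest takes the role of `B₁`.
  obtain ⟨i, -, hi⟩ := Finset.exists_min_image (Finset.univ : Finset (Fin 4)) (fun i => r (m i))
    ⟨0, Finset.mem_univ _⟩
  have ha' : ∀ j, i ≠ j → SetAdj G (B i) (B j) := by
    intro j hij
    rcases lt_or_gt_of_ne hij with h | h
    exacts [ha _ _ h, (ha _ _ h).symm]
  have hlt : ∀ j, i ≠ j → r (m i) < r (m j) := by
    intro j hij
    refine lt_of_le_of_ne (hi j (Finset.mem_univ _)) fun h => ?_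
    have := hr.1 (hA i (hm i)) (hA j (hm j)) h
    exact Set.disjoint_left.1 (hd i j hij) (hm i) (this ▸ hm j)
  obtain ⟨j, k, l, hj, hk, hl, hjk, hjl, hkl⟩ : ∃ j k l : Fin 4, i ≠ j ∧ i ≠ k ∧ i ≠ l ∧ j ≠ k ∧
      j ≠ l ∧ k ≠ l := by
    clear hi ha' hlt
    revert i; decide
  exact no_K4_aux hr (hA i) (hA j) (hA k) (hA l) (hc i) (hc j) (hc k) (hc l) (hd _ _ hjk)
    (hd _ _ hjl) (hd _ _ hkl) (ha' j hj) (ha' k hk) (ha' l hl) (hm i) (hmax i) (hm j) (hm k)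
    (hm l) (hlt j hj) (hlt k hk) (hlt l hl)

theorem TW.no_K4' [Finite V] (h : TW G A) {B₁ B₂ B₃ B₄ : Set V} (hA₁ : B₁ ⊆ A)
    (hA₂ : B₂ ⊆ A) (hA₃ : B₃ ⊆ A) (hA₄ : B₄ ⊆ A)
    (hc₁ : ConnSet G B₁) (hc₂ : ConnSet G B₂) (hc₃ : ConnSet G B₃) (hc₄ : ConnSet G B₄)
    (h12 : Disjoint B₁ B₂) (h13 : Disjoint B₁ B₃) (h14 : Disjoint B₁ B₄)
    (h23 : Disjoint B₂ B₃) (h24 : Disjoint B₂ B₄) (h34 : Disjoint B₃ B₄)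
    (a12 : SetAdj G B₁ B₂) (a13 : SetAdj G B₁ B₃) (a14 : SetAdj G B₁ B₄)
    (a23 : SetAdj G B₂ B₃) (a24 : SetAdj G B₂ B₄) (a34 : SetAdj G B₃ B₄) : False := by
  have n1 : B₁.Nonempty := let ⟨b, hb, _⟩ := a12; ⟨b, hb⟩
  have n2 : B₂.Nonempty := let ⟨b, hb, _⟩ := a23; ⟨b, hb⟩
  have n3 : B₃.Nonempty := let ⟨b, hb, _⟩ := a34; ⟨b, hb⟩
  have n4 : B₄.Nonempty := let ⟨_, _, b, hb, _⟩ := a34; ⟨b, hb⟩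
  refine h.no_K4 (B := ![B₁, B₂, B₃, B₄]) ?_ ?_ ?_ ?_ ?_
  · intro i; fin_cases i <;> assumption
  · intro i; fin_cases i <;> assumption
  · intro i; fin_cases i <;> assumption
  · intro i j hij
    fin_cases i <;> fin_cases j <;> first | exact absurd rfl hij | assumption | (apply Disjoint.symm; assumption)
  · intro i j hij
    fin_cases i <;> fin_cases j <;> first | assumption | exact absurd hij (by decide)

/-! ### Adding an edge between well-connected vertices -/

/-- The graph `G` with the edge `ab` added. -/
def addEdge (G : SimpleGraph V) (a b : V) : SimpleGraph V :=
  G ⊔ SimpleGraph.fromRel (fun u v => u = a ∧ v = b)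

theorem addEdge_adj {a b : V} : (addEdge G a b).Adj u v ↔
    G.Adj u v ∨ (u ≠ v ∧ ((u = a ∧ v = b) ∨ (v = a ∧ u = b))) := by
  simp [addEdge, SimpleGraph.sup_adj, SimpleGraph.fromRel_adj]

theorem le_addEdge (G : SimpleGraph V) (a b : V) : G ≤ addEdge G a b := le_sup_left

/-- `K` has a neighbour of `x`. -/
def Sees (G : SimpleGraph V) (K : Set V) (x : V) : Prop :=
  ∃ z ∈ K, G.Adj z x

theorem Sees.mono {K K' : Set V} {x : V} (h : Sees G K x) (hK : K ⊆ K') : Sees G K' x :=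
  let ⟨z, hz, h⟩ := h; ⟨z, hK hz, h⟩

theorem Sees.mono_graph {K : Set V} {x : V} (h : Sees G K x) (hG : G ≤ H) : Sees H K x :=
  let ⟨z, hz, h⟩ := h; ⟨z, hz, hG h⟩

/-- If `Tr v` contained `a` while `b` were neither in it nor next to it, each connector would have
to leave `Tr v` and so contain one of its neighbours: three neighbours in all. -/
theorem three_connectors_aux [Finite V] (hr : GoodOrder G A r) {a b : V} (hb : b ∈ A)
    {D : Fin 3 → Set V} (hDA : ∀ i, D i ⊆ A)
    (hD : ∀ i, ConnSet G (D i)) (hd : ∀ i j, i ≠ j → Disjoint (D i) (D j))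
    (hDa : ∀ i, Sees G (D i) a) (hDb : ∀ i, Sees G (D i) b) {v : V} (hv : v ∈ A)
    (hav : a ∈ Tr G r A v) : b ∈ Tr G r A v ∨ b ∈ openNbhd G (Tr G r A v) ∩ A := by
  by_contra hcon
  push Not at hcon
  have key : ∀ i, ∃ w ∈ D i, w ∈ openNbhd G (Tr G r A v) ∩ A := by
    intro i
    obtain ⟨z, hz, hza⟩ := hDa i
    obtain ⟨z', hz', hzb⟩ := hDb i
    obtain ⟨w, hw, hw'⟩ := (hD i).meets_openNbhd_of_adj hav hz hza.symm hz'
      (fun h => hcon.2 ⟨⟨hcon.1, z', h, hzb⟩, hb⟩)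
    exact ⟨w, hw, hw', hDA i hw⟩
  choose w hw hw' using key
  have hne : ∀ i j, i ≠ j → w i ≠ w j := fun i j hij h =>
    Set.disjoint_left.1 (hd i j hij) (hw i) (h ▸ hw j)
  exact le_two_not_three (hr.2 v hv) (hw' 0) (hw' 1) (hw' 2) (hne _ _ (by decide))
    (hne _ _ (by decide)) (hne _ _ (by decide))

/-- If three disjoint connected sets join `a` and `b`, the edge `ab` may be added. -/
theorem TW.addEdge_of_three [Finite V] (h : TW G A) {a b : V} (ha : a ∈ A) (hb : b ∈ A)
    {D : Fin 3 → Set V} (hDA : ∀ i, D i ⊆ A) (hD : ∀ i, ConnSet G (D i))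
    (hd : ∀ i j, i ≠ j → Disjoint (D i) (D j))
    (hDa : ∀ i, Sees G (D i) a) (hDb : ∀ i, Sees G (D i) b) : TW (addEdge G a b) A := by
  obtain ⟨r, hr⟩ := h
  refine ⟨r, hr.1, fun v hv => le_trans (Set.ncard_le_ncard ?_ (Set.toFinite _)) (hr.2 v hv)⟩
  have hab := fun h => three_connectors_aux hr hb hDA hD hd hDa hDb hv (a := a) h
  have hba := fun h => three_connectors_aux hr ha hDA hD hd hDb hDa hv (a := b) h
  have step : ∀ z ∈ Tr G r A v, ∀ u ∈ A, (addEdge G a b).Adj z u →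
      u ∈ Tr G r A v ∨ u ∈ openNbhd G (Tr G r A v) ∩ A := by
    intro z hz u hu hzu
    rcases addEdge_adj.1 hzu with h | ⟨-, ⟨rfl, rfl⟩ | ⟨rfl, rfl⟩⟩
    · by_cases hu' : u ∈ Tr G r A v
      · exact Or.inl hu'
      · exact Or.inr ⟨⟨hu', z, hz, h⟩, hu⟩
    · exact hab hz
    · exact hba hz
  -- The old order remains good: by `step` the new edge only leads to vertices that are already in
  -- `Tr v` or next to it, and those next to it come too late to be absorbed.
  have hT : Tr (addEdge G a b) r A v ⊆ Tr G r A v := by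
    intro w hw
    induction hw with
    | refl => exact mem_Tr_self _ _ _ _
    | tail _ hbc ih =>
      rcases step _ ih _ hbc.2.1 hbc.1 with h | h
      · exact h
      · exact absurd hbc.2.2 (not_le.2 (lt_of_mem_openNbhd_Tr h.1 h.2))
  rintro u ⟨hu, huA⟩
  have hlt := lt_of_mem_openNbhd_Tr hu huA
  obtain ⟨-, z, hz, hzu⟩ := hu
  rcases step z (hT hz) u huA hzu with h | h
  · exact absurd (Tr_subset_Dn hv h).2 (not_le.2 hlt)
  · exact h

/-! ### Gluing along a clique -/

/-- Gluing along a clique `K` that comes last in an order of `P ∪ K`. -/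
theorem TW.glue_of_last [Finite V] {P K Q : Set V} (hrP : GoodOrder G (P ∪ K) r)
    (hlast : ∀ p ∈ P, ∀ k ∈ K, r p < r k) (hQ : TW G Q) (hKQ : K ⊆ Q) (hPQ : Disjoint P Q)
    (hK : ∀ a ∈ K, ∀ b ∈ K, a ≠ b → G.Adj a b)
    (hno : ∀ p ∈ P, ∀ q ∈ Q, G.Adj p q → q ∈ K) : TW G (P ∪ Q) := by
  classical
  obtain ⟨s, hs⟩ := hQ
  obtain ⟨N, hN⟩ : ∃ N, ∀ p ∈ P, r p < N := by
    obtain ⟨N, hN⟩ := (Set.toFinite (r '' P)).bddAbove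
    exact ⟨N + 1, fun p hp => Nat.lt_succ_of_le (hN ⟨p, hp, rfl⟩)⟩
  -- All of `P` is eliminated before `Q`.
  let q : V → ℕ := fun v => if v ∈ P then r v else N + s v
  have qP : ∀ v ∈ P, q v = r v := fun v hv => if_pos hv
  have qQ : ∀ v ∈ Q, q v = N + s v := fun v hv => if_neg (fun h => Set.disjoint_left.1 hPQ h hv)
  refine ⟨q, ?_, ?_⟩
  · rintro u (hu | hu) v (hv | hv) huv
    · rw [qP u hu, qP v hv] at huv
      exact hrP.1 (Or.inl hu) (Or.inl hv) huv
    · rw [qP u hu, qQ v hv] at huv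
      have := hN u hu; omega
    · rw [qQ u hu, qP v hv] at huv
      have := hN v hv; omega
    · rw [qQ u hu, qQ v hv] at huv
      exact hs.1 hu hv (by omega)
  rintro v (hv | hv)
  · refine le_trans (Set.ncard_le_ncard ?_ (Set.toFinite _)) (hrP.2 v (Or.inl hv))
    have hTP : Tr G q (P ∪ Q) v ⊆ P ∩ Tr G r (P ∪ K) v := by
      intro w hw
      induction hw with
      | refl => exact ⟨hv, mem_Tr_self _ _ _ _⟩
      | @tail b c _ hbc ih =>
        have hcP : c ∈ P := by
          rcases hbc.2.1 with h | h
          · exact h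
          · have h1 := hbc.2.2
            rw [qQ c h, qP v hv] at h1
            have := hN v hv; omega
        refine ⟨hcP, Reach.step ih.2 hbc.1 ⟨Or.inl hcP, ?_⟩⟩
        have h1 := hbc.2.2
        rwa [qP c hcP, qP v hv] at h1
    rintro u ⟨hu, huA⟩
    have hlt := lt_of_mem_openNbhd_Tr hu huA
    obtain ⟨-, z, hz, hzu⟩ := hu
    have hz := hTP hz
    have huPK : u ∈ P ∪ K := by
      rcases huA with h | h
      exacts [Or.inl h, Or.inr (hno z hz.1 u h hzu)]
    refine ⟨⟨fun h' => ?_, z, hz.2, hzu⟩, huPK⟩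
    have h2 := (Tr_subset_Dn (A := P ∪ K) (Or.inl hv) h').2
    rcases huPK with h | h
    · rw [qP u h, qP v hv] at hlt
      omega
    · have := hlast v hv u h
      omega
  · refine le_trans (Set.ncard_le_ncard ?_ (Set.toFinite _)) (hs.2 v hv)
    -- Excursions into `P` gain nothing: a walk enters and leaves `P` at vertices of `K`, which are
    -- equal or adjacent. The second clause records this in advance for every exit `k` that the
    -- current excursion can see.
    have hT : ∀ w, w ∈ Tr G q (P ∪ Q) v → (w ∈ Q → w ∈ Tr G s Q v) ∧
        (w ∈ P → ∀ k ∈ K, Sees G {x | Reach G P w x} k → k ∈ Tr G s Q v ∨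
          k ∈ openNbhd G (Tr G s Q v) ∩ Q) := by
      intro w hw
      induction hw with
      | refl => exact ⟨fun _ => mem_Tr_self _ _ _ _,
          fun h => absurd hv (Set.disjoint_left.1 hPQ h)⟩
      | @tail b c hab hbc ih =>
        have hb : b ∈ P ∪ Q := by
          rcases Reach.eq_or_mem hab with rfl | h
          exacts [Or.inr hv, h.1]
        have put : ∀ z ∈ Tr G s Q v, ∀ k ∈ Q, G.Adj z k → k ∈ Tr G s Q v ∨
            k ∈ openNbhd G (Tr G s Q v) ∩ Q := by
          intro z hz k hk hzk
          by_cases h : k ∈ Tr G s Q v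
          · exact Or.inl h
          · exact Or.inr ⟨⟨h, z, hz, hzk⟩, hk⟩
        rcases hb with hb | hb
        · refine ⟨fun hc => ?_, fun hc k hk hsee => ?_⟩
          · have hcK := hno b hb c hc hbc.1
            rcases ih.2 hb c hcK ⟨b, Reach.refl _ _ _, hbc.1⟩ with h | h
            · exact h
            · have h1 := hbc.2.2
              rw [qQ c hc, qQ v hv] at h1
              have := lt_of_mem_openNbhd_Tr h.1 h.2
              omega
          · obtain ⟨z, hz, hzk⟩ := hsee
            exact ih.2 hb k hk ⟨z, (Reach.step (Reach.refl _ _ _) hbc.1 hc).trans hz, hzk⟩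
        · have hbT := ih.1 hb
          refine ⟨fun hc => ?_, fun hc k hk hsee => ?_⟩
          · refine Reach.step hbT hbc.1 ⟨hc, ?_⟩
            have h1 := hbc.2.2
            rw [qQ c hc, qQ v hv] at h1
            omega
          · have hbK := hno c hc b hb hbc.1.symm
            by_cases hbk : b = k
            · exact Or.inl (hbk ▸ hbT)
            · exact put b hbT k (hKQ hk) (hK b hbK k hk hbk)
    rintro u ⟨hu, huA⟩
    have hlt := lt_of_mem_openNbhd_Tr hu huA
    obtain ⟨-, z, hz, hzu⟩ := hu
    have huQ : u ∈ Q := by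
      rcases huA with h | h
      · rw [qP u h, qQ v hv] at hlt
        have := hN u h; omega
      · exact h
    rw [qQ u huQ, qQ v hv] at hlt
    have hnot : u ∉ Tr G s Q v := fun h => by
      have := (Tr_subset_Dn hv h).2
      omega
    have hzPQ : z ∈ P ∪ Q := by
      rcases Reach.eq_or_mem hz with rfl | h
      exacts [Or.inr hv, h.1]
    rcases hzPQ with h | h
    · have huK := hno z h u huQ hzu
      exact ((hT z hz).2 h u huK ⟨z, Reach.refl _ _ _, hzu⟩).resolve_left hnot
    · exact ⟨⟨hnot, z, (hT z hz).1 h, hzu⟩, huQ⟩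

end Orders

/-! ## Tree decompositions and elimination orders -/

section Trees

variable {ι : Type*} {T : SimpleGraph ι}

/-- Depths and descendants in a rooted tree. -/
theorem exists_rooting (hT : T.IsTree) (ρ : ι) :
    ∃ (depth : ι → ℕ) (below : ι → Set ι), depth ρ = 0 ∧ (∀ z, z ∈ below z) ∧
      (∀ z, ∀ i ∈ below z, i ≠ z → depth z < depth i) ∧
      (∀ z, ∀ i ∈ below z, ∀ j ∉ below z, T.Adj i j → i = z ∧ depth j < depth z) ∧
      ∀ i, depth i = 0 → i = ρ := by
  classical
  choose p hp _ using fun i => hT.existsUnique_path ρ i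
  have uniq : ∀ i (q : T.Walk ρ i), q.IsPath → q = p i := fun i q hq =>
    (hT.existsUnique_path ρ i).unique hq (hp i)
  -- Depth is the length of the unique path from the root; a node is below `z` if `z` lies on this
  -- path.
  refine ⟨fun i => (p i).length, fun z => {i | z ∈ (p i).support}, ?_, ?_, ?_, ?_, ?_⟩
  · show (p ρ).length = 0
    rw [← uniq ρ SimpleGraph.Walk.nil SimpleGraph.Walk.IsPath.nil]
    rfl
  · exact fun z => (p z).end_mem_support
  · intro z i hi hiz
    have h := uniq z _ ((hp i).takeUntil hi)
    show (p z).length < (p i).length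
    rw [← h]
    exact SimpleGraph.Walk.length_takeUntil_lt_length hi (Ne.symm hiz)
  · intro z i hi j hj hij
    have hi : z ∈ (p i).support := hi
    have hj : z ∉ (p j).support := hj
    by_cases hji : j ∈ (p i).support
    · have h := hT.isAcyclic.path_concat (hp j) (hp i) hij.symm hji
      rw [h, SimpleGraph.Walk.support_concat, List.mem_append] at hi
      rcases hi with hi | hi
      · exact absurd hi hj
      · simp only [List.mem_singleton] at hi
        subst hi
        refine ⟨rfl, ?_⟩
        have := congrArg SimpleGraph.Walk.length h
        rw [SimpleGraph.Walk.length_concat] at this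
        show (p j).length < (p z).length
        omega
    · have h := uniq j _ ((hp i).concat hji hij)
      exfalso
      apply hj
      rw [← h, SimpleGraph.Walk.support_concat, List.mem_append]
      exact Or.inl hi
  · intro i hi
    exact (SimpleGraph.Walk.eq_of_length_eq_zero hi).symm

end Trees

section Decompositions

variable {W : Type*} {H : SimpleGraph W}

theorem TreeDecomposition.connSet (D : TreeDecomposition H) (v : W) :
    ConnSet D.tree {i | v ∈ D.bag i} :=
  connSet_iff_induce_preconnected.2 (D.connected_nodes v).preconnected

/-- A tree decomposition of width two, rooted at any of its nodes, yields an elimination order;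
any part of the bag of the root may come last. -/
theorem TreeDecomposition.exists_goodOrder [Finite W] (D : TreeDecomposition H)
    (hD : ∀ i, (D.bag i).card ≤ 2 + 1) (ρ : Fin D.size) {K : Set W} (hK : ∀ k ∈ K, k ∈ D.bag ρ) :
    ∃ r : W → ℕ, GoodOrder H Set.univ r ∧ ∀ p ∉ K, ∀ k ∈ K, r p < r k := by
  classical
  obtain ⟨depth, below, hρ, hself, hlt, hexit, hzero⟩ := exists_rooting D.isTree ρ
  have htop : ∀ v, ∃ i, v ∈ D.bag i ∧ ∀ j, v ∈ D.bag j → depth i ≤ depth j := by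
    intro v
    obtain ⟨i, hi, hi'⟩ := Set.exists_min_image {i | v ∈ D.bag i} depth (Set.toFinite _)
      (D.exists_mem_bag v)
    exact ⟨i, hi, hi'⟩
  choose top htop hmin using htop
  have hKtop : ∀ k ∈ K, top k = ρ := fun k hk => hzero _ (by
    have := hmin k ρ (hK k hk)
    omega)
  -- Vertices are eliminated by decreasing depth of their topmost bag. The shift by one keeps `K`
  -- strictly last even among the vertices of the root bag.
  let key : W → ℕ := fun v => if v ∈ K then 0 else depth (top v) + 1
  have hkey : ∀ u v, key u ≤ key v → depth (top u) ≤ depth (top v) := by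
    intro u v huv
    by_cases hu : u ∈ K
    · rw [hKtop u hu, hρ]; exact Nat.zero_le _
    · by_cases hv : v ∈ K
      · simp [key, hu, hv] at huv
      · simpa [key, hu, hv] using huv
  obtain ⟨N, hN⟩ : ∃ N, ∀ v, key v ≤ N := by
    obtain ⟨N, hN⟩ := (Set.toFinite (Set.range key)).bddAbove
    exact ⟨N, fun v => hN ⟨v, rfl⟩⟩
  obtain ⟨k, ⟨e⟩⟩ := Finite.exists_equiv_fin W
  -- A lexicographic rank, since `e v < k`; `e` breaks ties.
  let r : W → ℕ := fun v => (N - key v) * k + e v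
  have hr : ∀ u v, key u < key v → r v < r u := by
    intro u v huv
    have h1 : N - key v + 1 ≤ N - key u := by have := hN v; omega
    have h2 := Nat.mul_le_mul_right k h1
    have h3 := (e v).2
    simp only [r]
    rw [Nat.add_mul] at h2
    omega
  have hr' : ∀ u v, r v ≤ r u → depth (top u) ≤ depth (top v) := fun u v h =>
    hkey u v (not_lt.1 fun h' => absurd (hr v u h') (not_lt.2 h))
  -- The nodes of `u` are connected, so leaving the part below `top v` would put `u` into the bag of
  -- the parent of `top v`, above its own topmost bag.
  have hdown : ∀ v u i, i ∈ below (top v) → u ∈ D.bag i → depth (top v) ≤ depth (top u) →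
      ∀ j, u ∈ D.bag j → j ∈ below (top v) := by
    intro v u i hi hui hd j huj
    by_contra hj
    obtain ⟨w, hw, hw', x, hx, hxw⟩ := (D.connSet u).meets_openNbhd (T := below (top v)) hui hi huj hj
    have h1 := (hexit _ x hx w hw' hxw).2
    have h2 := hmin u w hw
    omega
  refine ⟨r, ⟨?_, ?_⟩, ?_⟩
  · rintro u - v - huv
    have h1 : key u = key v := by
      rcases lt_trichotomy (key u) (key v) with h | h | h
      · exact absurd (hr _ _ h) (by omega)
      · exact h
      · exact absurd (hr _ _ h) (by omega)
    simp only [r, h1] at huv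
    exact e.injective (Fin.ext (by omega))
  · rintro v -
    have hT : ∀ w ∈ Tr H r Set.univ v, ∀ j, w ∈ D.bag j → j ∈ below (top v) := by
      intro w hw
      induction hw with
      | refl => exact hdown v v (top v) (hself _) (htop v) le_rfl
      | @tail b c _ hbc ih =>
        obtain ⟨i, hbi, hci⟩ := D.exists_edge_bag b c hbc.1
        exact hdown v c i (ih i hbi) hci (hr' _ _ hbc.2.2)
    -- All bags of vertices of `Tr v` lie below `top v`. A later neighbour has a bag there; unless
    -- `top v` is its own topmost bag, it also has a bag outside, and the only way out passes
    -- through `top v`.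
    have hsub : openNbhd H (Tr H r Set.univ v) ∩ Set.univ ⊆ ((D.bag (top v)).erase v : Finset W) := by
      rintro u ⟨hu, -⟩
      have hlt' := lt_of_mem_openNbhd_Tr hu (Set.mem_univ _)
      obtain ⟨-, z, hz, hzu⟩ := hu
      obtain ⟨i, hzi, hui⟩ := D.exists_edge_bag z u hzu
      have hi := hT z hz i hzi
      have hne : u ≠ v := fun h => by subst h; omega
      rw [Finset.mem_coe, Finset.mem_erase]
      refine ⟨hne, ?_⟩
      by_contra hnot
      have htu : top u ∉ below (top v) := by
        intro h
        have h1 : top u ≠ top v := fun h' => hnot (h' ▸ htop u)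
        have h2 := hlt _ _ h h1
        have h3 := hr' u v hlt'.le
        omega
      obtain ⟨w, hw, hw', x, hx, hxw⟩ := (D.connSet u).meets_openNbhd (T := (below (top v))ᶜ)
        (htop u) htu hui (fun h => h hi)
      have h1 := (hexit _ w (not_not.1 hw') x hx hxw.symm).1
      exact hnot (h1 ▸ hw)
    refine (Set.ncard_le_ncard hsub (Set.toFinite _)).trans ?_
    rw [Set.ncard_coe_finset, Finset.card_erase_of_mem (htop v)]
    have := hD (top v)
    omega
  · intro p hp q hq
    exact hr q p (by simp [key, hp, hq])

/-- This frees the nodes of the decomposition tree from being `Fin size`; in the application they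
are the vertices themselves. -/
theorem treewidthAtMost_of_tree {ι : Type*} [Finite ι] {T : SimpleGraph ι} (hT : T.IsTree)
    (bag : ι → Finset W) {k : ℕ} (hk : ∀ i, (bag i).card ≤ k + 1) (h1 : ∀ v, ∃ i, v ∈ bag i)
    (h2 : ∀ u v, H.Adj u v → ∃ i, u ∈ bag i ∧ v ∈ bag i)
    (h3 : ∀ v, ConnSet T {i | v ∈ bag i}) : TreewidthAtMost H k := by
  obtain ⟨m, ⟨e⟩⟩ := Finite.exists_equiv_fin ι
  have iso : T.comap e.symm ≃g T := SimpleGraph.Iso.comap e.symm T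
  refine ⟨⟨m, T.comap e.symm, iso.isTree_iff.2 hT, fun i => bag (e.symm i), ?_, ?_, ?_⟩, ?_⟩
  · intro v
    obtain ⟨i, hi⟩ := h1 v
    exact ⟨e i, by simpa using hi⟩
  · intro u v huv
    obtain ⟨i, hi⟩ := h2 u v huv
    exact ⟨e i, by simpa using hi⟩
  · intro v
    obtain ⟨i, hi⟩ := h1 v
    have : Nonempty ↥{i | v ∈ bag (e.symm i)} := ⟨⟨e i, by simpa using hi⟩⟩
    refine ⟨connSet_iff_induce_preconnected.1 ?_⟩
    intro a ha b hb
    have h := h3 v (e.symm a) ha (e.symm b) hb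
    have key : ∀ x, Reach T {i | v ∈ bag i} (e.symm a) x →
        Reach (T.comap e.symm) {i | v ∈ bag (e.symm i)} a (e x) := by
      intro x hx
      induction hx with
      | refl => rw [Equiv.apply_symm_apply]; exact Reach.refl _ _ _
      | tail _ hbc ih =>
        refine Reach.step ih ?_ ?_
        · simpa using hbc.1
        · simpa using hbc.2
    simpa using key _ h
  · exact fun i => hk _

variable {r : W → ℕ}

/-- An elimination order yields a tree decomposition of width two. -/
theorem GoodOrder.treewidthAtMost [Finite W] (hr : GoodOrder H Set.univ r) :
    TreewidthAtMost H 2 := by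
  classical
  rcases isEmpty_or_nonempty W with hW | hW
  · exact treewidthAtMost_of_tree (ι := Unit) (T := ⊥) SimpleGraph.IsTree.of_subsingleton
      (fun _ => ∅) (by simp) (fun v => isEmptyElim v) (fun v => isEmptyElim v)
      (fun v => isEmptyElim v)
  obtain ⟨l, -, hl⟩ := Set.exists_max_rank r (Set.univ_nonempty (α := W))
  have hl : ∀ v, r v ≤ r l := fun v => hl v (Set.mem_univ _)
  have hinj : ∀ u v, r u = r v → u = v := fun u v h => hr.1 (Set.mem_univ u) (Set.mem_univ v) h
  have up : ∀ v u, u ∈ openNbhd H (Tr H r Set.univ v) → r v < r u := fun v u h =>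
    lt_of_mem_openNbhd_Tr h (Set.mem_univ u)
  -- The parent of `v` is the earliest neighbour of `Tr v`. If there is none, `v` is attached to the
  -- last vertex `l`, which keeps the tree connected when `H` is not.
  have hpar : ∀ v, ∃ p, (v ≠ l → r v < r p) ∧ ∀ u ∈ openNbhd H (Tr H r Set.univ v),
      p ∈ openNbhd H (Tr H r Set.univ v) ∧ r p ≤ r u := by
    intro v
    by_cases h : (openNbhd H (Tr H r Set.univ v)).Nonempty
    · obtain ⟨p, hp, hp'⟩ := Set.exists_min_image _ r (Set.toFinite _) h
      exact ⟨p, fun _ => up _ _ hp, fun u hu => ⟨hp, hp' u hu⟩⟩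
    · refine ⟨l, fun hv => lt_of_le_of_ne (hl v) fun h => hv (hinj _ _ h), fun u hu => ?_⟩
      exact absurd ⟨u, hu⟩ h
  choose par hpar hparmin using hpar
  let T : SimpleGraph W := SimpleGraph.fromRel fun v p => v ≠ l ∧ p = par v
  have hTadj : ∀ v, v ≠ l → T.Adj v (par v) := by
    intro v hv
    rw [SimpleGraph.fromRel_adj]
    exact ⟨fun h => by have := hpar v hv; rw [← h] at this; omega, Or.inl ⟨hv, rfl⟩⟩
  have hconn : T.Connected := by
    refine ⟨fun u v => ?_⟩
    have key : ∀ n v, r l - r v ≤ n → T.Reachable v l := by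
      intro n
      induction n with
      | zero =>
        intro v hv
        rw [hinj v l (le_antisymm (hl v) (by omega))]
      | succ n ih =>
        intro v hv
        by_cases hvl : v = l
        · rw [hvl]
        · have h1 := hpar v hvl
          exact (hTadj v hvl).reachable.trans (ih _ (by omega))
    exact (key _ u le_rfl).trans (key _ v le_rfl).symm
  have htree : T.IsTree := by
    rw [SimpleGraph.isTree_iff_connected_and_card]
    -- Every edge joins some `v ≠ l` to its parent, so there are at most `|W| - 1` edges.
    refine ⟨hconn, le_antisymm ?_ hconn.card_vert_le_card_edgeSet_add_one⟩
    have hsub : T.edgeSet ⊆ (fun v => s(v, par v)) '' {v | v ≠ l} := by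
      intro e
      induction e with
      | _ a b =>
        intro hab
        rw [SimpleGraph.mem_edgeSet, SimpleGraph.fromRel_adj] at hab
        rcases hab.2 with ⟨h1, rfl⟩ | ⟨h1, rfl⟩
        · exact ⟨a, h1, rfl⟩
        · exact ⟨b, h1, Sym2.eq_swap⟩
    have h1 := (Set.ncard_le_ncard hsub (Set.toFinite _)).trans (Set.ncard_image_le (Set.toFinite _))
    have h2 : ({v | v ≠ l} : Set W).ncard + 1 = Nat.card W := by
      have : {v | v ≠ l} = ({l} : Set W)ᶜ := by ext; simp
      rw [this, ← Set.ncard_add_ncard_compl ({l} : Set W), Set.ncard_singleton]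
      omega
    rw [Nat.card_coe_set_eq]
    omega
  let bag : W → Finset W := fun v => insert v (Set.toFinite (openNbhd H (Tr H r Set.univ v))).toFinset
  have hbag : ∀ u v, u ∈ bag v ↔ u = v ∨ u ∈ openNbhd H (Tr H r Set.univ v) := by
    intro u v; simp [bag]
  refine treewidthAtMost_of_tree htree bag ?_ (fun v => ⟨v, (hbag _ _).2 (Or.inl rfl)⟩) ?_ ?_
  · intro v
    refine (Finset.card_insert_le _ _).trans ?_
    have := hr.2 v (Set.mem_univ v)
    rw [Set.inter_univ, Set.ncard_eq_toFinset_card _ (Set.toFinite _)] at this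
    omega
  · have key : ∀ u v, H.Adj u v → r u < r v → v ∈ bag u := by
      intro u v huv hlt
      refine (hbag _ _).2 (Or.inr ⟨fun h => ?_, u, mem_Tr_self _ _ _ _, huv⟩)
      exact absurd (Tr_subset_Dn (Set.mem_univ u) h).2 (not_le.2 hlt)
    intro u v huv
    rcases lt_trichotomy (r u) (r v) with h | h | h
    · exact ⟨u, (hbag _ _).2 (Or.inl rfl), key u v huv h⟩
    · exact absurd (hinj _ _ h) huv.ne
    · exact ⟨v, key v u huv.symm h, (hbag _ _).2 (Or.inl rfl)⟩
  · intro u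
    -- Climbing from `v` towards `u` stays in bags with `u`: as long as the parent is earlier than
    -- `u`, its component contains `Tr v` and still has the neighbour `u`. Ranks increase, so the
    -- climb ends at `u`.
    have key : ∀ n v, r u - r v ≤ n → u ∈ bag v → Reach T {i | u ∈ bag i} v u := by
      intro n
      induction n with
      | zero =>
        intro v hn hv
        rcases (hbag _ _).1 hv with rfl | h
        · exact Reach.refl _ _ _
        · have := up _ _ h; omega
      | succ n ih =>
        intro v hn hv
        rcases (hbag _ _).1 hv with rfl | h
        · exact Reach.refl _ _ _
        have hvu := up _ _ h
        obtain ⟨⟨hp1, z, hz, hzp⟩, hple⟩ := hparmin v u h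
        have hvl : v ≠ l := fun h' => by have := hl u; subst h'; omega
        have hvp := hpar v hvl
        have hmem : u ∈ bag (par v) := by
          by_cases hpu : par v = u
          · exact (hbag _ _).2 (Or.inl hpu.symm)
          have hlt : r (par v) < r u := lt_of_le_of_ne hple fun h => hpu (hinj _ _ h)
          have hzT : z ∈ Tr H r Set.univ (par v) := by
            refine Reach.step (Reach.refl _ _ _) hzp.symm ⟨Set.mem_univ _, ?_⟩
            exact (Tr_subset_Dn (Set.mem_univ v) hz).2.trans hvp.le
          have hvT := mem_Tr_of_inter (Set.mem_univ v) hzT hz hvp.le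
          obtain ⟨-, y, hy, hyu⟩ := h
          refine (hbag _ _).2 (Or.inr ⟨fun h => ?_, y, Tr_subset_Tr (Set.mem_univ _) hvT hy, hyu⟩)
          exact absurd (Tr_subset_Dn (Set.mem_univ _) h).2 (not_le.2 hlt)
        refine (Reach.step (Reach.refl _ _ _) (hTadj v hvl) hmem).trans (ih _ (by omega) hmem)
    intro a ha b hb
    have hu : u ∈ {i | u ∈ bag i} := (hbag _ _).2 (Or.inl rfl)
    exact (key _ a le_rfl ha).trans ((key _ b le_rfl hb).symm hb)

theorem treewidthAtMost_iff [Finite W] : TreewidthAtMost H 2 ↔ TW H Set.univ := by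
  constructor
  · rintro ⟨D, hD⟩
    have := D.isTree.connected.nonempty
    obtain ⟨r, hr, -⟩ := D.exists_goodOrder hD (Classical.arbitrary _) (K := ∅) (by simp)
    exact ⟨r, hr⟩
  · rintro ⟨r, hr⟩
    exact hr.treewidthAtMost

/-! ### Transfer between induced subgraphs and vertex sets -/

variable {V : Type*} {G : SimpleGraph V}

theorem Reach.image {f : W ↪ V} {B : Set W} {u v : W} (h : Reach (G.comap f) B u v) :
    Reach G (f '' B) (f u) (f v) := by
  induction h with
  | refl => exact Reach.refl _ _ _
  | tail _ hbc ih => exact Reach.step ih hbc.1 ⟨_, hbc.2, rfl⟩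

theorem Reach.of_image {f : W ↪ V} {B : Set W} {u : W} {v : V} (h : Reach G (f '' B) (f u) v) :
    ∃ w, f w = v ∧ Reach (G.comap f) B u w := by
  induction h with
  | refl => exact ⟨u, rfl, Reach.refl _ _ _⟩
  | tail _ hbc ih =>
    obtain ⟨w, rfl, hw⟩ := ih
    obtain ⟨hadj, x, hx, rfl⟩ := hbc
    exact ⟨x, rfl, Reach.step hw hadj hx⟩

theorem goodOrder_comap_iff [Finite V] [Finite W] {f : W ↪ V} {B : Set W} {s : V → ℕ} :
    GoodOrder (G.comap f) B (s ∘ f) ↔ GoodOrder G (f '' B) s := by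
  have hDn : ∀ v, f '' Dn (s ∘ f) B v = Dn s (f '' B) (f v) := by
    intro v
    ext x
    constructor
    · rintro ⟨y, hy, rfl⟩
      exact ⟨⟨y, hy.1, rfl⟩, hy.2⟩
    · rintro ⟨⟨y, hy, rfl⟩, h⟩
      exact ⟨y, ⟨hy, h⟩, rfl⟩
  have hTr : ∀ v, f '' Tr (G.comap f) (s ∘ f) B v = Tr G s (f '' B) (f v) := by
    intro v
    ext x
    constructor
    · rintro ⟨y, hy, rfl⟩
      have := Reach.image hy
      rwa [hDn] at this
    · intro hx
      have hx : Reach G (Dn s (f '' B) (f v)) (f v) x := hx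
      rw [← hDn] at hx
      obtain ⟨w, rfl, hw⟩ := Reach.of_image hx
      exact ⟨w, hw, rfl⟩
  have hN : ∀ v, f '' (openNbhd (G.comap f) (Tr (G.comap f) (s ∘ f) B v) ∩ B)
      = openNbhd G (Tr G s (f '' B) (f v)) ∩ f '' B := by
    intro v
    rw [← hTr]
    ext x
    constructor
    · rintro ⟨y, ⟨⟨hy, z, hz, hzy⟩, hyB⟩, rfl⟩
      refine ⟨⟨?_, f z, ⟨z, hz, rfl⟩, hzy⟩, y, hyB, rfl⟩
      rintro ⟨y', hy', h⟩
      exact hy (f.injective h ▸ hy')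
    · rintro ⟨⟨hy, _, ⟨z, hz, rfl⟩, hzy⟩, y, hyB, rfl⟩
      exact ⟨y, ⟨⟨fun h => hy ⟨y, h, rfl⟩, z, hz, hzy⟩, hyB⟩, rfl⟩
  constructor
  · rintro ⟨h1, h2⟩
    refine ⟨?_, ?_⟩
    · rintro _ ⟨a, ha, rfl⟩ _ ⟨b, hb, rfl⟩ hab
      rw [h1 ha hb hab]
    · rintro _ ⟨a, ha, rfl⟩
      rw [← hN, Set.ncard_image_of_injective _ f.injective]
      exact h2 a ha
  · rintro ⟨h1, h2⟩
    refine ⟨?_, ?_⟩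
    · intro a ha b hb hab
      exact f.injective (h1 ⟨a, ha, rfl⟩ ⟨b, hb, rfl⟩ hab)
    · intro a ha
      have := h2 (f a) ⟨a, ha, rfl⟩
      rwa [← hN, Set.ncard_image_of_injective _ f.injective] at this

theorem exists_extend_rank (f : W ↪ V) (r : W → ℕ) : ∃ s : V → ℕ, s ∘ f = r :=
  ⟨Function.extend f r fun _ => 0, funext fun a => f.injective.extend_apply r _ a⟩

theorem tw_comap_iff [Finite V] [Finite W] {f : W ↪ V} {B : Set W} :
    TW (G.comap f) B ↔ TW G (f '' B) := by
  constructor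
  · rintro ⟨r, hr⟩
    obtain ⟨s, rfl⟩ := exists_extend_rank f r
    exact ⟨s, goodOrder_comap_iff.1 hr⟩
  · rintro ⟨s, hs⟩
    exact ⟨s ∘ f, goodOrder_comap_iff.2 hs⟩

theorem treewidthAtMost_induce_iff [Finite V] {A : Set V} :
    TreewidthAtMost (G.induce A) 2 ↔ TW G A := by
  rw [treewidthAtMost_iff]
  have := tw_comap_iff (G := G) (f := Function.Embedding.subtype (· ∈ A)) (B := Set.univ)
  rw [show G.induce A = G.comap (Function.Embedding.subtype (· ∈ A)) from rfl, this]
  simp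

/-- A clique on at most two vertices may come last in an elimination order. -/
theorem TW.exists_goodOrder_last [Finite V] {A K : Set V} (h : TW G A) (hKA : K ⊆ A)
    (hcard : K.ncard ≤ 2) (hK : ∀ a ∈ K, ∀ b ∈ K, a ≠ b → G.Adj a b) :
    ∃ r : V → ℕ, GoodOrder G A r ∧ ∀ p ∈ A \ K, ∀ k ∈ K, r p < r k := by
  obtain ⟨D, hD⟩ := treewidthAtMost_induce_iff.2 h
  -- A clique on at most two vertices lies in one bag, because decompositions cover vertices and
  -- edges. Rooting there lets `K` come last.
  have hbag : ∃ ρ, ∀ k : ↥A, (k : V) ∈ K → k ∈ D.bag ρ := by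
    have := D.isTree.connected.nonempty
    by_cases h0 : ∃ a, a ∈ K
    · obtain ⟨a, ha⟩ := h0
      by_cases h1 : ∃ b, b ∈ K ∧ a ≠ b
      · obtain ⟨b, hb, hab⟩ := h1
        obtain ⟨i, hi, hi'⟩ := D.exists_edge_bag ⟨a, hKA ha⟩ ⟨b, hKA hb⟩ (hK a ha b hb hab)
        refine ⟨i, fun k hk => ?_⟩
        by_cases hka : k = ⟨a, hKA ha⟩
        · exact hka ▸ hi
        by_cases hkb : k = ⟨b, hKA hb⟩
        · exact hkb ▸ hi'
        exact (le_two_not_three hcard ha hb hk hab (fun h => hka (Subtype.ext h.symm))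
          (fun h => hkb (Subtype.ext h.symm))).elim
      · obtain ⟨i, hi⟩ := D.exists_mem_bag ⟨a, hKA ha⟩
        refine ⟨i, fun k hk => ?_⟩
        have : k = ⟨a, hKA ha⟩ := Subtype.ext (by
          by_contra hne
          exact h1 ⟨k, hk, fun h => hne h.symm⟩)
        exact this ▸ hi
    · exact ⟨Classical.arbitrary _, fun k hk => absurd ⟨_, hk⟩ h0⟩
  obtain ⟨ρ, hρ⟩ := hbag
  obtain ⟨r, hr, hr'⟩ := D.exists_goodOrder hD ρ (K := {k : ↥A | (k : V) ∈ K}) (fun k hk => hρ k hk)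
  obtain ⟨s, rfl⟩ := exists_extend_rank (Function.Embedding.subtype (· ∈ A)) r
  refine ⟨s, ?_, ?_⟩
  · have := goodOrder_comap_iff.1 hr
    simpa using this
  · rintro p ⟨hp, hpK⟩ k hk
    exact hr' ⟨p, hp⟩ hpK ⟨k, hKA hk⟩ hk

/-- Two graphs of treewidth at most two may be glued along a clique of at most two vertices. -/
theorem TW.glue [Finite V] {P K Q : Set V} (hP : TW G (P ∪ K)) (hQ : TW G Q) (hKQ : K ⊆ Q)
    (hPQ : Disjoint P Q) (hcard : K.ncard ≤ 2)
    (hK : ∀ a ∈ K, ∀ b ∈ K, a ≠ b → G.Adj a b)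
    (hno : ∀ p ∈ P, ∀ q ∈ Q, G.Adj p q → q ∈ K) : TW G (P ∪ Q) := by
  obtain ⟨r, hr, hr'⟩ := hP.exists_goodOrder_last Set.subset_union_right hcard hK
  refine TW.glue_of_last hr (fun p hp k hk => hr' p ⟨Or.inl hp, fun h => ?_⟩ k hk) hQ hKQ hPQ hK hno
  exact Set.disjoint_left.1 hPQ hp (hKQ h)

end Decompositions

/-! ## Iteration of inflationary maps on vertex sets -/

section Iteration

variable {n : ℕ} {Φ : Set (Fin n) → Set (Fin n)}

/-- The `k`-th stage of the iteration of `Φ` from the empty set. -/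
def stage (Φ : Set (Fin n) → Set (Fin n)) (k : ℕ) : Set (Fin n) :=
  Φ^[k] ∅

theorem stage_succ (Φ : Set (Fin n) → Set (Fin n)) (k : ℕ) : stage Φ (k + 1) = Φ (stage Φ k) :=
  Function.iterate_succ_apply' _ _ _

theorem stage_mono (h : ∀ W, W ⊆ Φ W) {j k : ℕ} (hjk : j ≤ k) : stage Φ j ⊆ stage Φ k := by
  induction hjk with
  | refl => exact subset_rfl
  | step _ ih => exact ih.trans (by rw [Nat.succ_eq_add_one, stage_succ]; exact h _)

/-- Before the first repetition every step adds an element, and there are only `n` elements. -/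
theorem stage_fixed (h : ∀ W, W ⊆ Φ W) : Φ (stage Φ n) = stage Φ n := by
  by_contra hne
  have hk : ∀ k, k ≤ n → Φ (stage Φ k) ≠ stage Φ k := by
    intro k hk heq
    have : ∀ j, stage Φ (k + j) = stage Φ k := by
      intro j
      induction j with
      | zero => rfl
      | succ j ih => rw [← add_assoc, stage_succ, ih, heq]
    have h1 := this (n - k)
    rw [show k + (n - k) = n by omega] at h1
    exact hne (by rw [h1, heq])
  have hcard : ∀ k, k ≤ n + 1 → k ≤ (stage Φ k).ncard := by
    intro k
    induction k with
    | zero => exact fun _ => Nat.zero_le _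
    | succ k ih =>
      intro hkn
      have h1 := ih (by omega)
      have h2 : (stage Φ k).ncard < (stage Φ (k + 1)).ncard := by
        apply Set.ncard_lt_ncard _ (Set.toFinite _)
        rw [stage_succ]
        exact (h _).ssubset_of_ne (Ne.symm (hk k (by omega)))
      omega
  have h1 := hcard (n + 1) le_rfl
  have h2 := Set.ncard_le_ncard (Set.subset_univ (stage Φ (n + 1))) (Set.toFinite _)
  rw [Set.ncard_univ, Nat.card_eq_fintype_card, Fintype.card_fin] at h2
  omega

/-- On the machine the number of a stage is read off a vertex `k`; this expresses the final stage by
such stages. -/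
theorem mem_stage_iff (h : ∀ W, W ⊆ Φ W) {v : Fin n} :
    v ∈ stage Φ n ↔ ∃ k : Fin n, v ∈ stage Φ (k + 1) := by
  constructor
  · intro hv
    have hn : 0 < n := v.pos
    exact ⟨⟨n - 1, by omega⟩, by simpa [Nat.sub_add_cancel hn] using hv⟩
  · rintro ⟨k, hk⟩
    exact stage_mono h k.2 hk

/-- The number of stages that do not contain `v`. -/
noncomputable def stageRank (Φ : Set (Fin n) → Set (Fin n)) (v : Fin n) : ℕ :=
  {k : Fin n | v ∉ stage Φ (k + 1)}.ncard

theorem ncard_fin_lt {m : ℕ} (hm : m ≤ n) : {k : Fin n | (k : ℕ) < m}.ncard = m := by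
  have : {k : Fin n | (k : ℕ) < m} = Set.range (Fin.castLE hm) := by
    ext k
    constructor
    · intro hk
      exact ⟨⟨k, hk⟩, rfl⟩
    · rintro ⟨j, rfl⟩
      exact j.2
  rw [this, ← Set.image_univ, Set.ncard_image_of_injective _ (Fin.castLE_injective hm),
    Set.ncard_univ, Nat.card_eq_fintype_card, Fintype.card_fin]

/-- Stages increase, so those without `v` form an initial segment and their number tells when `v`
enters. A vertex that never enters has rank `n`. -/
theorem stageRank_lt_iff (h : ∀ W, W ⊆ Φ W) {v : Fin n} {m : ℕ} (hm : m ≤ n) :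
    stageRank Φ v < m ↔ v ∈ stage Φ m := by
  constructor
  · intro hlt
    by_contra hv
    have hsub : {k : Fin n | (k : ℕ) < m} ⊆ {k : Fin n | v ∉ stage Φ (k + 1)} := by
      intro k hk hv'
      exact hv (stage_mono h hk hv')
    have := Set.ncard_le_ncard hsub (Set.toFinite _)
    rw [ncard_fin_lt hm] at this
    unfold stageRank at hlt
    omega
  · intro hv
    have hm0 : 0 < m := by
      rcases Nat.eq_zero_or_pos m with rfl | h0
      · exact absurd hv (Set.notMem_empty v)
      · exact h0
    have hsub : {k : Fin n | v ∉ stage Φ (k + 1)} ⊆ {k : Fin n | (k : ℕ) < m - 1} := by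
      intro k hk
      by_contra hk'
      have hk' : m - 1 ≤ (k : ℕ) := not_lt.1 hk'
      exact hk (stage_mono h (by omega) hv)
    have := Set.ncard_le_ncard hsub (Set.toFinite _)
    rw [ncard_fin_lt (by omega)] at this
    unfold stageRank
    omega

end Iteration

/-! ## A greedy elimination order -/

section Greedy

variable {V : Type*} {G : SimpleGraph V} {A W : Set V} {v w : V}

theorem reach_insert_self {x : V} : Reach G (insert v W) v x ↔ Reach G W v x := by
  constructor
  · intro h
    induction h with
    | refl => exact Reach.refl _ _ _
    | tail _ hbc ih =>
      rcases hbc.2 with rfl | h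
      · exact Reach.refl _ _ _
      · exact Reach.step ih hbc.1 h
  · exact Reach.mono_set (Set.subset_insert _ _)

/-- A set all of whose components have at most two neighbours in `A`. -/
def EliminatedSet (G : SimpleGraph V) (A W : Set V) : Prop :=
  ∀ v ∈ W, (openNbhd G {w | Reach G W v w} ∩ A).ncard ≤ 2

/-- `v` may be eliminated next from `G[A]`, after `W`. -/
def CanEliminate (G : SimpleGraph V) (A W : Set V) (v : V) : Prop :=
  v ∈ A ∧ v ∉ W ∧ (openNbhd G {w | Reach G W v w} ∩ A).ncard ≤ 2

/-- Only the component of `v` is new; the components that do not reach `v` are unchanged. -/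
theorem EliminatedSet.insert (h : EliminatedSet G A W) (hv : CanEliminate G A W v) :
    EliminatedSet G A (insert v W) := by
  intro w hw
  by_cases hwv : Reach G (Insert.insert v W) w v
  · rw [reach_set_eq hw hwv]
    simp only [reach_insert_self]
    exact hv.2.2
  · have hwW : w ∈ W := by
      rcases hw with rfl | h
      · exact absurd (Reach.refl _ _ _) hwv
      · exact h
    have : {x | Reach G (Insert.insert v W) w x} = {x | Reach G W w x} := by
      ext x
      constructor
      · intro hx
        induction hx with
        | refl => exact Reach.refl _ _ _
        | tail hab hbc ih =>
          rcases hbc.2 with rfl | hc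
          · exact absurd (Reach.step hab hbc.1 (Or.inl rfl)) hwv
          · exact Reach.step ih hbc.1 hc
      · exact Reach.mono_set (Set.subset_insert _ _)
    rw [this]
    exact h w hwW

/-- Elimination does not get stuck. -/
theorem TW.exists_canEliminate [Finite V] (h : TW G A) (hWA : W ⊆ A) (hW : EliminatedSet G A W)
    (hne : W ≠ A) : ∃ v, CanEliminate G A W v := by
  classical
  obtain ⟨r, hr⟩ := h
  -- Each component of `G[W]` will be contracted into one chosen neighbour. The choice is a function
  -- of the component as a set, so that all its vertices go to the same place.
  have hf : ∀ K : Set V, ∃ u : V, (openNbhd G K ∩ A).Nonempty → u ∈ openNbhd G K ∩ A := by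
    intro K
    by_cases hK : (openNbhd G K ∩ A).Nonempty
    · obtain ⟨u, hu⟩ := hK
      exact ⟨u, fun _ => hu⟩
    · obtain ⟨a, -⟩ : A.Nonempty := by
        rw [Set.nonempty_iff_ne_empty]
        rintro rfl
        exact hne (Set.subset_empty_iff.1 hWA)
      exact ⟨a, fun h => absurd h hK⟩
  choose f hf using hf
  let comp : V → Set V := fun w => {x | Reach G W w x}
  -- The branch set of `v ∉ W`: the vertex itself and the components contracted into it.
  let B : V → Set V := fun v => {x | x = v ∨ (x ∈ W ∧ (openNbhd G (comp x) ∩ A).Nonempty ∧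
    f (comp x) = v)}
  have hcomp : ∀ x ∈ W, ∀ y ∈ comp x, comp y = comp x := fun x hx y hy => (reach_set_eq hx hy).symm
  have hcompW : ∀ x ∈ W, comp x ⊆ W := fun x hx => Reach.subset hx
  have hNW : ∀ x ∈ W, ∀ u ∈ openNbhd G (comp x), u ∉ W := by
    rintro x hx u ⟨hu, z, hz, hzu⟩ huW
    exact hu (Reach.step hz hzu huW)
  have hBA : ∀ v ∈ A, B v ⊆ A := by
    rintro v hv x (rfl | hx)
    exacts [hv, hWA hx.1]
  have hcompB : ∀ v, ∀ x ∈ W, x ∈ B v → v ∉ W → comp x ⊆ B v := by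
    rintro v x hx (rfl | ⟨-, h1, h2⟩) hv y hy
    · exact absurd hx hv
    · refine Or.inr ⟨hcompW x hx hy, ?_, ?_⟩
      · rwa [hcomp x hx y hy]
      · rwa [hcomp x hx y hy]
  have hBconn : ∀ v ∉ W, ConnSet G (B v) := by
    intro v hv
    have key : ∀ x ∈ B v, Reach G (B v) x v := by
      intro x hx
      rcases id hx with rfl | ⟨hxW, h1, h2⟩
      · exact Reach.refl _ _ _
      · obtain ⟨⟨hn, z, hz, hzv⟩, -⟩ := hf _ h1
        rw [h2] at hzv
        refine Reach.step (Reach.mono_set (hcompB v x hxW hx hv) (Reach.confine hz)) hzv (Or.inl rfl)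
    intro x hx y hy
    exact (key x hx).trans ((key y hy).symm hy)
  have hBdisj : ∀ u v, u ∉ W → v ∉ W → u ≠ v → Disjoint (B u) (B v) := by
    intro u v hu hv huv
    rw [Set.disjoint_left]
    rintro x (rfl | ⟨hx, -, h2⟩) (rfl | ⟨hx', -, h2'⟩)
    · exact huv rfl
    · exact hu hx'
    · exact hv hx
    · exact huv (h2.symm.trans h2')
  choose m hm hmax using fun v => Set.exists_max_rank r (B := B v) ⟨v, Or.inl rfl⟩
  -- The vertex to eliminate is the one whose branch set is completed first in the given order `r`.
  obtain ⟨v, ⟨hvA, hvW⟩, hmin⟩ := Set.exists_min_image (A \ W) (fun v => r (m v)) (Set.toFinite _) (by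
    by_contra hemp
    rw [Set.not_nonempty_iff_eq_empty, Set.sdiff_eq_empty] at hemp
    exact hne (hWA.antisymm hemp))
  refine ⟨v, hvA, hvW, ?_⟩
  have hT : B v ⊆ Tr G r A (m v) := (hBconn v hvW).subset_Tr (hBA v hvA) (hm v) (hmax v)
  have key : ∀ u ∈ openNbhd G {w | Reach G W v w} ∩ A, u ∉ W ∧ u ≠ v ∧
      ∃ x ∈ B u, x ∈ openNbhd G (Tr G r A (m v)) ∩ A := by
    rintro u ⟨⟨hu, z, hz, hzu⟩, huA⟩
    have huW : u ∉ W := fun h => hu (Reach.step hz hzu h)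
    have huv : u ≠ v := fun h => hu (h ▸ Reach.refl _ _ _)
    refine ⟨huW, huv, ?_⟩
    -- Either `u` is adjacent to `v`, or they are neighbours of one component of `G[W]`. That
    -- component has no third neighbour, so it was contracted into `v` or into `u`, and the branch
    -- sets touch.
    have hadj : SetAdj G (B v) (B u) := by
      rcases Reach.eq_or_mem hz with rfl | hzW
      · exact ⟨z, Or.inl rfl, u, Or.inl rfl, hzu⟩
      have hvN : ∃ y ∈ comp z, G.Adj y v := by
        have : ∀ y, Reach G W v y → y ∈ W → ∃ x ∈ W, G.Adj v x ∧ Reach G W x y := by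
          intro y hy
          induction hy with
          | refl => exact fun h => absurd h hvW
          | @tail b c hab hbc ih =>
            intro hc
            rcases Reach.eq_or_mem hab with rfl | hb
            · exact ⟨c, hc, hbc.1, Reach.refl _ _ _⟩
            · obtain ⟨x, hx, hvx, hxb⟩ := ih hb
              exact ⟨x, hx, hvx, Reach.step hxb hbc.1 hc⟩
        obtain ⟨x, hx, hvx, hxz⟩ := this z hz hzW
        exact ⟨x, hxz.symm hx, hvx.symm⟩
      obtain ⟨y, hy, hyv⟩ := hvN
      have hv1 : v ∈ openNbhd G (comp z) ∩ A := ⟨⟨fun h => hvW (hcompW z hzW h), y, hy, hyv⟩, hvA⟩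
      have hu1 : u ∈ openNbhd G (comp z) ∩ A :=
        ⟨⟨fun h => huW (hcompW z hzW h), z, Reach.refl _ _ _, hzu⟩, huA⟩
      have hfz := hf (comp z) ⟨v, hv1⟩
      by_cases h1 : f (comp z) = v
      · exact ⟨z, Or.inr ⟨hzW, ⟨v, hv1⟩, h1⟩, u, Or.inl rfl, hzu⟩
      by_cases h2 : f (comp z) = u
      · refine ⟨v, Or.inl rfl, y, Or.inr ⟨hcompW z hzW hy, ?_, ?_⟩, hyv.symm⟩
        · rw [hcomp z hzW y hy]; exact ⟨v, hv1⟩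
        · rw [hcomp z hzW y hy]; exact h2
      exact (le_two_not_three (hW z hzW) hfz hv1 hu1 h1 h2 huv.symm).elim
    obtain ⟨b, hb, c, hc, hbc⟩ := hadj
    have hlt : r (m v) < r (m u) := by
      refine lt_of_le_of_ne (hmin u ⟨huA, huW⟩) fun h => ?_
      have := hr.1 (hBA v hvA (hm v)) (hBA u huA (hm u)) h
      exact Set.disjoint_left.1 (hBdisj v u hvW huW huv.symm) (hm v) (this ▸ hm u)
    -- The branch set of `u` touches `Tr (m v)` and ends later, so it contains a neighbour of `Tr (m
    -- v)`; of these there are at most two.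
    obtain ⟨x, hx, hx'⟩ := (hBconn u huW).meets_openNbhd_of_adj (hT hb) hc hbc (hm u)
      (fun h => absurd (Tr_subset_Dn (hBA v hvA (hm v)) h).2 (not_le.2 hlt))
    exact ⟨x, hx, hx', hBA u huA hx⟩
  refine le_two_of_not_three fun a ha b hb c hc hab hac hbc => ?_
  obtain ⟨ha1, -, x, hx, hx'⟩ := key a ha
  obtain ⟨hb1, -, y, hy, hy'⟩ := key b hb
  obtain ⟨hc1, -, z, hz, hz'⟩ := key c hc
  exact le_two_not_three (hr.2 _ (hBA v hvA (hm v))) hx' hy' hz'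
    (fun h => Set.disjoint_left.1 (hBdisj a b ha1 hb1 hab) hx (h ▸ hy))
    (fun h => Set.disjoint_left.1 (hBdisj a c ha1 hc1 hac) hx (h ▸ hz))
    (fun h => Set.disjoint_left.1 (hBdisj b c hb1 hc1 hbc) hy (h ▸ hz))

end Greedy

section GreedyFin

variable {n : ℕ} {G : SimpleGraph (Fin n)} {A : Set (Fin n)}

/-- Eliminate the first vertex that can be eliminated. -/
def greedyStep (G : SimpleGraph (Fin n)) (A W : Set (Fin n)) : Set (Fin n) :=
  {v | v ∈ W ∨ (CanEliminate G A W v ∧ ∀ u, CanEliminate G A W u → v ≤ u)}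

/-- The greedy elimination order. -/
noncomputable def rk (G : SimpleGraph (Fin n)) (A : Set (Fin n)) (v : Fin n) : ℕ :=
  stageRank (greedyStep G A) v

theorem subset_greedyStep (W : Set (Fin n)) : W ⊆ greedyStep G A W := fun _ h => Or.inl h

theorem greedyStep_eq (G : SimpleGraph (Fin n)) (A W : Set (Fin n)) :
    greedyStep G A W = W ∨ ∃ v, CanEliminate G A W v ∧ greedyStep G A W = insert v W := by
  by_cases h : ∃ v, CanEliminate G A W v
  · obtain ⟨v, hv, hmin⟩ := Set.exists_min_image {v | CanEliminate G A W v} id (Set.toFinite _) h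
    refine Or.inr ⟨v, hv, ?_⟩
    ext x
    constructor
    · rintro (hx | ⟨hx, hx'⟩)
      · exact Or.inr hx
      · exact Or.inl (le_antisymm (hx' v hv) (hmin x hx))
    · rintro (rfl | hx)
      · exact Or.inr ⟨hv, hmin⟩
      · exact Or.inl hx
  · refine Or.inl (Set.Subset.antisymm ?_ (subset_greedyStep W))
    rintro x (hx | ⟨hx, -⟩)
    · exact hx
    · exact absurd ⟨x, hx⟩ h

theorem stage_greedyStep (k : ℕ) : stage (greedyStep G A) k ⊆ A ∧
    EliminatedSet G A (stage (greedyStep G A) k) := by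
  induction k with
  | zero => exact ⟨Set.empty_subset _, fun v hv => absurd hv (Set.notMem_empty v)⟩
  | succ k ih =>
    rw [stage_succ]
    rcases greedyStep_eq G A (stage (greedyStep G A) k) with h | ⟨v, hv, h⟩
    · rw [h]; exact ih
    · rw [h]; exact ⟨Set.insert_subset hv.1 ih.1, ih.2.insert hv⟩

theorem rk_lt_iff {v : Fin n} {m : ℕ} (hm : m ≤ n) :
    rk G A v < m ↔ v ∈ stage (greedyStep G A) m :=
  stageRank_lt_iff subset_greedyStep hm

/-- A step adds at most one vertex, so ranks are distinct; and the vertices no later than `v` are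
exactly the stage in which `v` enters, where every component has at most two neighbours. -/
theorem goodOrder_rk_of_lt (h : ∀ a ∈ A, rk G A a < n) : GoodOrder G A (rk G A) := by
  constructor
  · intro u hu v hv huv
    have hu' := (rk_lt_iff (Nat.succ_le_of_lt (h u hu))).1 (Nat.lt_succ_self _)
    have hu'' := mt (rk_lt_iff (h u hu).le).2 (lt_irrefl (rk G A u))
    have hv' := (rk_lt_iff (Nat.succ_le_of_lt (h v hv))).1 (Nat.lt_succ_self _)
    have hv'' := mt (rk_lt_iff (h v hv).le).2 (lt_irrefl (rk G A v))
    rw [← huv] at hv' hv''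
    rw [Nat.succ_eq_add_one, stage_succ] at hu' hv'
    rcases greedyStep_eq G A (stage (greedyStep G A) (rk G A u)) with h | ⟨w, hw, h⟩
    · rw [h] at hu'; exact absurd hu' hu''
    · rw [h] at hu' hv'
      rw [hu'.resolve_right hu'', hv'.resolve_right hv'']
  · intro v hv
    have hDn : Dn (rk G A) A v = stage (greedyStep G A) (rk G A v + 1) := by
      ext w
      rw [← rk_lt_iff (Nat.succ_le_of_lt (h v hv)), Nat.lt_succ_iff]
      exact ⟨fun hw => hw.2, fun hw => ⟨(stage_greedyStep n).1
        ((rk_lt_iff le_rfl).1 (hw.trans_lt (h v hv))), hw⟩⟩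
    rw [Tr, hDn]
    exact (stage_greedyStep _).2 v
      ((rk_lt_iff (Nat.succ_le_of_lt (h v hv))).1 (Nat.lt_succ_self _))

theorem TW.rk_lt (h : TW G A) : ∀ a ∈ A, rk G A a < n := by
  have hfix := stage_fixed (Φ := greedyStep G A) subset_greedyStep
  have heq : stage (greedyStep G A) n = A := by
    by_contra hne
    obtain ⟨v, hv⟩ := h.exists_canEliminate (stage_greedyStep n).1 (stage_greedyStep n).2 hne
    rcases greedyStep_eq G A (stage (greedyStep G A) n) with h' | ⟨w, hw, h'⟩
    · obtain ⟨u, hu, hmin⟩ := Set.exists_min_image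
        {v | CanEliminate G A (stage (greedyStep G A) n) v} id (Set.toFinite _) ⟨v, hv⟩
      have : u ∈ greedyStep G A (stage (greedyStep G A) n) := Or.inr ⟨hu, hmin⟩
      rw [h'] at this
      exact hu.2.1 this
    · rw [h'] at hfix
      exact hw.2.1 (hfix ▸ Set.mem_insert _ _)
  intro a ha
  rw [rk_lt_iff le_rfl, heq]
  exact ha

/-- This replaces the existential quantifier over all orders by one greedy computation. -/
theorem tw_iff_rk_lt : TW G A ↔ ∀ a ∈ A, rk G A a < n :=
  ⟨TW.rk_lt, fun h => ⟨_, goodOrder_rk_of_lt h⟩⟩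

theorem TW.goodOrder_rk (h : TW G A) : GoodOrder G A (rk G A) := goodOrder_rk_of_lt h.rk_lt

end GreedyFin

/-! ## Deleting a component that is replaceable by others -/

section Reduction

variable {n : ℕ} {G H : SimpleGraph (Fin n)} {t : ℕ} {X Z S : Set (Fin n)} {u v : Fin n}

/-- The component of `v` in `G - Z`. -/
def compOf (G : SimpleGraph (Fin n)) (Z : Set (Fin n)) (v : Fin n) : Set (Fin n) :=
  {w | Reach G Zᶜ v w}

/-- `u` is the first vertex of its component in `G - Z`. -/
def IsRep (G : SimpleGraph (Fin n)) (Z : Set (Fin n)) (u : Fin n) : Prop :=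
  u ∉ Z ∧ ∀ w ∈ compOf G Z u, u ≤ w

/-- `C` does not fit into a graph of treewidth two in which `a` and `b` are adjacent. -/
def Obstructs (G : SimpleGraph (Fin n)) (a b : Fin n) (C : Set (Fin n)) : Prop :=
  ¬ TW (addClique G {a, b}) (C ∪ {a, b})

/-- The component of `v` in `G - Z` is replaceable: any three of its neighbours have `t + 1` other
components in common, and any two have `t + 3` others that are at least as obstructive. -/
def Reducible (G : SimpleGraph (Fin n)) (t : ℕ) (Z : Set (Fin n)) (v : Fin n) : Prop :=
  v ∉ Z ∧
  (∀ a ∈ openNbhd G (compOf G Z v), ∀ b ∈ openNbhd G (compOf G Z v),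
    ∀ c ∈ openNbhd G (compOf G Z v), a ≠ b → a ≠ c → b ≠ c →
    t + 1 ≤ {u | IsRep G Z u ∧ u ∉ compOf G Z v ∧ a ∈ openNbhd G (compOf G Z u) ∧
      b ∈ openNbhd G (compOf G Z u) ∧ c ∈ openNbhd G (compOf G Z u)}.ncard) ∧
  (∀ a ∈ openNbhd G (compOf G Z v), ∀ b ∈ openNbhd G (compOf G Z v), a ≠ b →
    t + 3 ≤ {u | IsRep G Z u ∧ u ∉ compOf G Z v ∧ a ∈ openNbhd G (compOf G Z u) ∧
      b ∈ openNbhd G (compOf G Z u) ∧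
      (Obstructs G a b (compOf G Z v) → Obstructs G a b (compOf G Z u))}.ncard)

theorem addClique_adj {V : Type*} {G : SimpleGraph V} {A : Set V} {u v : V} :
    (addClique G A).Adj u v ↔ G.Adj u v ∨ (u ≠ v ∧ u ∈ A ∧ v ∈ A) := by
  simp only [addClique, SimpleGraph.sup_adj, SimpleGraph.fromRel_adj]
  tauto

theorem addClique_pair {V : Type*} (G : SimpleGraph V) (a b : V) :
    addClique G {a, b} = addEdge G a b := by
  ext u v
  rw [addClique_adj, addEdge_adj]
  simp only [Set.mem_insert_iff, Set.mem_singleton_iff]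
  constructor
  · rintro (h | ⟨h, rfl | rfl, rfl | rfl⟩)
    · exact Or.inl h
    · exact absurd rfl h
    · exact Or.inr ⟨h, Or.inl ⟨rfl, rfl⟩⟩
    · exact Or.inr ⟨h, Or.inr ⟨rfl, rfl⟩⟩
    · exact absurd rfl h
  · rintro (h | ⟨h, ⟨rfl, rfl⟩ | ⟨rfl, rfl⟩⟩)
    · exact Or.inl h
    · exact Or.inr ⟨h, Or.inl rfl, Or.inr rfl⟩
    · exact Or.inr ⟨h, Or.inr rfl, Or.inl rfl⟩

theorem mem_compOf_self (G : SimpleGraph (Fin n)) (Z : Set (Fin n)) (v : Fin n) :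
    v ∈ compOf G Z v := Reach.refl _ _ _

theorem connSet_compOf : ConnSet G (compOf G Z v) := connSet_reach _ _ _

theorem compOf_subset (hv : v ∉ Z) : compOf G Z v ⊆ Zᶜ := Reach.subset hv

theorem compOf_eq_or_disjoint (hu : u ∉ Z) (hv : v ∉ Z) :
    compOf G Z u = compOf G Z v ∨ Disjoint (compOf G Z u) (compOf G Z v) := by
  by_cases h : Disjoint (compOf G Z u) (compOf G Z v)
  · exact Or.inr h
  · rw [Set.not_disjoint_iff] at h
    obtain ⟨x, hx, hx'⟩ := h
    exact Or.inl ((reach_set_eq hu hx).trans (reach_set_eq hv hx').symm)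

theorem IsRep.eq_of_compOf_eq (hu : IsRep G Z u) (hv : IsRep G Z v)
    (h : compOf G Z u = compOf G Z v) : u = v :=
  le_antisymm (hu.2 v (h ▸ mem_compOf_self _ _ _)) (hv.2 u (h ▸ mem_compOf_self _ _ _))

theorem IsRep.disjoint (hu : IsRep G Z u) (hv : IsRep G Z v) (h : u ≠ v) :
    Disjoint (compOf G Z u) (compOf G Z v) :=
  (compOf_eq_or_disjoint hu.1 hv.1).resolve_left fun h' => h (hu.eq_of_compOf_eq hv h')

theorem exists_isRep (hv : v ∉ Z) : ∃ u, IsRep G Z u ∧ compOf G Z u = compOf G Z v := by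
  obtain ⟨u, hu, hmin⟩ := Set.exists_min_image (compOf G Z v) id (Set.toFinite _)
    ⟨v, mem_compOf_self _ _ _⟩
  have h : compOf G Z u = compOf G Z v := (reach_set_eq hv hu).symm
  refine ⟨u, ⟨compOf_subset hv hu, ?_⟩, h⟩
  rw [h]
  exact hmin

/-- At most `|S|` components meet `S`. -/
theorem ncard_le_untouched {R : Set (Fin n)} (hR : ∀ u ∈ R, IsRep G Z u) :
    R.ncard ≤ S.ncard + {u | u ∈ R ∧ Disjoint (compOf G Z u) S}.ncard := by
  have hsplit : R = {u | u ∈ R ∧ ¬ Disjoint (compOf G Z u) S} ∪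
      {u | u ∈ R ∧ Disjoint (compOf G Z u) S} := by
    ext u
    constructor
    · intro h
      by_cases h' : Disjoint (compOf G Z u) S
      · exact Or.inr ⟨h, h'⟩
      · exact Or.inl ⟨h, h'⟩
    · rintro (h | h) <;> exact h.1
  have hch : ∀ u, ∃ s, ¬ Disjoint (compOf G Z u) S → s ∈ compOf G Z u ∧ s ∈ S := by
    intro u
    by_cases h : Disjoint (compOf G Z u) S
    · exact ⟨u, fun h' => absurd h h'⟩
    · obtain ⟨s, hs⟩ := Set.not_disjoint_iff.1 h
      exact ⟨s, fun _ => hs⟩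
  choose s hs using hch
  -- Components of different representatives are disjoint, so choosing a vertex of `S` in each is
  -- injective.
  have h1 : {u | u ∈ R ∧ ¬ Disjoint (compOf G Z u) S}.ncard ≤ S.ncard := by
    refine Set.ncard_le_ncard_of_injOn s (fun u hu => (hs u hu.2).2) ?_ (Set.toFinite _)
    intro a ha b hb hab
    by_contra hne
    refine Set.disjoint_left.1 ((hR a ha.1).disjoint (hR b hb.1) hne) (hs a ha.2).1 ?_
    rw [hab]
    exact (hs b hb.2).1
  calc R.ncard = _ := congrArg Set.ncard hsplit
    _ ≤ _ := Set.ncard_union_le _ _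
    _ ≤ _ := Nat.add_le_add_right h1 _

/-- Deleting a vertex of a replaceable component is safe. -/
theorem Reducible.tw (hX : TW G Xᶜ) (hX' : ∀ x ∈ X, TW G (X \ {x})ᶜ) (hXZ : X ⊆ Z)
    (hv : Reducible G t Z v) (hS : S.ncard ≤ t) (hSv : TW G ({v}ᶜ \ S)) : TW G Sᶜ := by
  obtain ⟨hvZ, h3, h2⟩ := hv
  set C := compOf G Z v with hC
  have hCZ : C ⊆ Zᶜ := compOf_subset hvZ
  have hNZ : openNbhd G C ⊆ Z := openNbhd_reach_subset
  set Q := Cᶜ \ S with hQ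
  set K := openNbhd G C \ S with hK
  have hKQ : K ⊆ Q := fun k hk => ⟨hk.1.1, hk.2⟩
  have hCQ : Disjoint C Q := Set.disjoint_left.2 fun c hc hq => hq.1 hc
  have hTQ : TW G Q := hSv.mono_set fun q hq =>
    ⟨fun h => hq.1 (by rw [Set.mem_singleton_iff.1 h]; exact mem_compOf_self _ _ _), hq.2⟩
  have hfree : ∀ u, IsRep G Z u → u ∉ C → Disjoint (compOf G Z u) S → compOf G Z u ⊆ Q := by
    intro u hu huC hd w hw
    refine ⟨fun hwC => ?_, fun hwS => Set.disjoint_left.1 hd hw hwS⟩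
    rcases compOf_eq_or_disjoint (G := G) hu.1 hvZ with h | h
    · exact huC (hC ▸ h ▸ mem_compOf_self _ _ _)
    · exact Set.disjoint_left.1 h hw hwC
  have hsees : ∀ u a, a ∈ openNbhd G (compOf G Z u) → Sees G (compOf G Z u) a :=
    fun u a ha => ha.2
  -- Stated for supergraphs `H`, so that several edges can be added one after another.
  have hedge : ∀ H, G ≤ H → TW H Q → ∀ a ∈ K, ∀ b ∈ K, a ≠ b → TW (addEdge H a b) Q ∧
      (Obstructs G a b C → ∃ u, compOf G Z u ⊆ Q ∧ Obstructs G a b (compOf G Z u)) := by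
    intro H hGH hH a ha b hb hab
    have hcard := h2 a ha.1 b hb.1 hab
    have hun := ncard_le_untouched (S := S) (G := G) (Z := Z)
      (R := {u | IsRep G Z u ∧ u ∉ C ∧ a ∈ openNbhd G (compOf G Z u) ∧
      b ∈ openNbhd G (compOf G Z u) ∧ (Obstructs G a b C → Obstructs G a b (compOf G Z u))})
      (fun u hu => hu.1)
    -- Of `t + 3` components, `S` meets at most `t`. The remaining three are disjoint connectors of
    -- `a` and `b`.
    obtain ⟨x, y, z, hx, hy, hz, hxy, hxz, hyz⟩ := (Set.two_lt_ncard_iff (Set.toFinite _)).1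
      (lt_of_add_lt_add_left ((show S.ncard + 2 < t + 3 by omega).trans_le (hcard.trans hun)))
    refine ⟨?_, fun h => ⟨x, hfree x hx.1.1 hx.1.2.1 hx.2, hx.1.2.2.2.2 h⟩⟩
    refine hH.addEdge_of_three (hKQ ha) (hKQ hb)
      (D := ![compOf G Z x, compOf G Z y, compOf G Z z]) ?_ ?_ ?_ ?_ ?_
    · intro i
      fin_cases i
      exacts [hfree x hx.1.1 hx.1.2.1 hx.2, hfree y hy.1.1 hy.1.2.1 hy.2,
        hfree z hz.1.1 hz.1.2.1 hz.2]
    · intro i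
      fin_cases i <;> exact connSet_compOf.mono hGH
    · intro i j hij
      have d1 := hx.1.1.disjoint hy.1.1 hxy
      have d2 := hx.1.1.disjoint hz.1.1 hxz
      have d3 := hy.1.1.disjoint hz.1.1 hyz
      fin_cases i <;> fin_cases j <;>
        first | exact absurd rfl hij | assumption | (apply Disjoint.symm; assumption)
    · intro i
      fin_cases i
      exacts [(hsees _ _ hx.1.2.2.1).mono_graph hGH, (hsees _ _ hy.1.2.2.1).mono_graph hGH,
        (hsees _ _ hz.1.2.2.1).mono_graph hGH]
    · intro i
      fin_cases i
      exacts [(hsees _ _ hx.1.2.2.2.1).mono_graph hGH, (hsees _ _ hy.1.2.2.2.1).mono_graph hGH,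
        (hsees _ _ hz.1.2.2.2.1).mono_graph hGH]
  -- With three surviving neighbours, the three added edges and one untouched component that sees
  -- all of them would form a `K₄` minor.
  have hKcard : K.ncard ≤ 2 := by
    refine le_two_of_not_three fun a ha b hb c hc hab hac hbc => ?_
    have hcard := h3 a ha.1 b hb.1 c hc.1 hab hac hbc
    have hun := ncard_le_untouched (S := S) (G := G) (Z := Z)
      (R := {u | IsRep G Z u ∧ u ∉ C ∧ a ∈ openNbhd G (compOf G Z u) ∧
      b ∈ openNbhd G (compOf G Z u) ∧ c ∈ openNbhd G (compOf G Z u)}) (fun u hu => hu.1)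
    obtain ⟨x, hx⟩ := Set.nonempty_of_ncard_ne_zero (s := {u | u ∈ {u | IsRep G Z u ∧ u ∉ C ∧
      a ∈ openNbhd G (compOf G Z u) ∧ b ∈ openNbhd G (compOf G Z u) ∧
      c ∈ openNbhd G (compOf G Z u)} ∧ Disjoint (compOf G Z u) S}) (by omega)
    have t1 := (hedge G le_rfl hTQ a ha b hb hab).1
    have t2 := (hedge _ (le_addEdge _ _ _) t1 a ha c hc hac).1
    have t3 := (hedge _ ((le_addEdge _ _ _).trans (le_addEdge _ _ _)) t2 b hb c hc hbc).1
    have hle : G ≤ addEdge (addEdge (addEdge G a b) a c) b c :=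
      ((le_addEdge _ _ _).trans (le_addEdge _ _ _)).trans (le_addEdge _ _ _)
    have hxZ : ∀ k ∈ K, Disjoint {k} (compOf G Z x) := fun k hk =>
      Set.disjoint_singleton_left.2 fun h => compOf_subset hx.1.1.1 h (hNZ hk.1)
    have adj : ∀ k, k ∈ openNbhd G (compOf G Z x) →
        SetAdj (addEdge (addEdge (addEdge G a b) a c) b c) {k} (compOf G Z x) := by
      rintro k ⟨-, z, hz, hzk⟩
      exact ⟨k, rfl, z, hz, hle hzk.symm⟩
    exact t3.no_K4' (B₁ := {a}) (B₂ := {b}) (B₃ := {c}) (B₄ := compOf G Z x)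
      (Set.singleton_subset_iff.2 (hKQ ha)) (Set.singleton_subset_iff.2 (hKQ hb))
      (Set.singleton_subset_iff.2 (hKQ hc)) (hfree x hx.1.1 hx.1.2.1 hx.2)
      (connSet_singleton _ _) (connSet_singleton _ _) (connSet_singleton _ _)
      (connSet_compOf.mono hle) (by simpa using hab) (by simpa using hac) (hxZ a ha)
      (by simpa using hbc) (hxZ b hb) (hxZ c hc)
      ⟨a, rfl, b, rfl, le_addEdge _ _ _ (le_addEdge _ _ _ (addEdge_adj.2 (Or.inr ⟨hab, Or.inl ⟨rfl, rfl⟩⟩)))⟩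
      ⟨a, rfl, c, rfl, le_addEdge _ _ _ (addEdge_adj.2 (Or.inr ⟨hac, Or.inl ⟨rfl, rfl⟩⟩))⟩
      (adj a hx.1.2.2.1)
      ⟨b, rfl, c, rfl, addEdge_adj.2 (Or.inr ⟨hbc, Or.inl ⟨rfl, rfl⟩⟩)⟩
      (adj b hx.1.2.2.2.1) (adj c hx.1.2.2.2.2)
  have hnoG : ∀ p ∈ C, ∀ q ∈ Q, G.Adj p q → q ∈ K := fun p hp q hq hpq =>
    ⟨⟨hq.1, p, hp, hpq⟩, hq.2⟩
  suffices h : ∃ H, G ≤ H ∧ TW H (C ∪ Q) by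
    obtain ⟨H, hGH, hH⟩ := h
    refine hH.mono hGH fun w hw => ?_
    by_cases h : w ∈ C
    exacts [Or.inl h, Or.inr ⟨h, hw⟩]
  by_cases hK2 : K.ncard = 2
  · obtain ⟨a, b, hab, hKab⟩ := Set.ncard_eq_two.1 hK2
    have ha : a ∈ K := hKab ▸ Or.inl rfl
    have hb : b ∈ K := hKab ▸ Or.inr rfl
    obtain ⟨t1, t2⟩ := hedge G le_rfl hTQ a ha b hb hab
    -- Otherwise `C` is obstructive, and so is some untouched component. But that one lies in `Q`,
    -- where the edge `ab` has already been added without raising the treewidth.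
    have hCK : TW (addEdge G a b) (C ∪ K) := by
      by_contra hcon
      have hobs : Obstructs G a b C := by
        unfold Obstructs
        rwa [addClique_pair, ← hKab]
      obtain ⟨u, hu, hu'⟩ := t2 hobs
      unfold Obstructs at hu'
      rw [addClique_pair, ← hKab] at hu'
      exact hu' (t1.mono_set (Set.union_subset hu hKQ))
    refine ⟨_, le_addEdge G a b, hCK.glue t1 hKQ hCQ hKcard ?_ ?_⟩
    · intro x hx y hy hxy
      rw [hKab] at hx hy
      rcases hx with rfl | rfl <;> rcases hy with rfl | rfl
      · exact absurd rfl hxy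
      · exact addEdge_adj.2 (Or.inr ⟨hxy, Or.inl ⟨rfl, rfl⟩⟩)
      · exact addEdge_adj.2 (Or.inr ⟨hxy, Or.inr ⟨rfl, rfl⟩⟩)
      · exact absurd rfl hxy
    · intro p hp q hq hpq
      rcases addEdge_adj.1 hpq with h | ⟨-, ⟨rfl, rfl⟩ | ⟨rfl, rfl⟩⟩
      · exact hnoG p hp q hq h
      · exact absurd hp ha.1.1
      · exact absurd hp hb.1.1
  · have hK1 : K.ncard ≤ 1 := by omega
    refine ⟨G, le_rfl, TW.glue ?_ hTQ hKQ hCQ hKcard ?_ hnoG⟩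
    -- With at most one attachment vertex `a`, the graph `G[C ∪ K]` meets `X` in at most `a`;
    -- tidiness of `X` covers the case `a ∈ X`.
    · rcases Set.ncard_le_one_iff_eq (Set.toFinite K) |>.1 hK1 with h | ⟨a, h⟩
      · rw [h, Set.union_empty]
        exact hX.mono_set fun c hc hcX => hCZ hc (hXZ hcX)
      · rw [h]
        by_cases ha : a ∈ X
        · refine (hX' a ha).mono_set ?_
          rintro c (hc | hc) hcX
          · exact hCZ hc (hXZ hcX.1)
          · exact hcX.2 hc
        · refine hX.mono_set ?_
          rintro c (hc | rfl) hcX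
          · exact hCZ hc (hXZ hcX)
          · exact ha hcX
    · intro x hx y hy hxy
      exact absurd ((Set.ncard_le_one (Set.toFinite K)).1 hK1 x hx y hy) hxy

theorem components_eq_image : components G Z = compOf G Z '' {u | IsRep G Z u} := by
  ext C
  rw [mem_components_iff]
  constructor
  · rintro ⟨v, hv, rfl⟩
    obtain ⟨u, hu, h⟩ := exists_isRep (G := G) hv
    exact ⟨u, hu, h⟩
  · rintro ⟨u, hu, rfl⟩
    exact ⟨u, hu.1, rfl⟩

theorem notMem_compOf_iff (hu : IsRep G Z u) (hv : IsRep G Z v) : u ∉ compOf G Z v ↔ u ≠ v := by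
  constructor
  · rintro h rfl
    exact h (mem_compOf_self _ _ _)
  · intro h h'
    exact Set.disjoint_left.1 (hu.disjoint hv h) (mem_compOf_self _ _ _) h'

/-- If no component is replaceable, there are few components. -/
theorem ncard_components_le (h : ∀ v, ¬ Reducible G t Z v) :
    (components G Z).ncard ≤ boundC t Z.ncard := by
  classical
  rw [components_eq_image]
  refine (Set.ncard_image_le (Set.toFinite _)).trans ?_
  let Zf : Finset (Fin n) := Z.toFinite.toFinset
  have hZf : Zf.card = Z.ncard := (Set.ncard_eq_toFinset_card _ _).symm
  let R : Finset (Fin n) := Finset.univ.filter (IsRep G Z)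
  let A : Finset (Fin n) → Finset (Fin n) := fun τ => R.filter fun u => ∀ a ∈ τ, a ∈ openNbhd G (compOf G Z u)
  let obs : Finset (Fin n) → Fin n → Prop := fun τ u => ¬ TW (addClique G τ) (compOf G Z u ∪ τ)
  -- `F τ` and `F' τ` contain the components that fail the condition on triples or on pairs because
  -- of `τ`.
  let F : Finset (Fin n) → Finset (Fin n) := fun τ => (A τ).filter fun u => ((A τ).erase u).card < t + 1
  let F' : Finset (Fin n) → Finset (Fin n) := fun τ => (A τ).filter fun u =>
    (((A τ).erase u).filter fun w => obs τ u → obs τ w).card < t + 3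
  have hR : ({u | IsRep G Z u} : Set (Fin n)) = (R : Set (Fin n)) := by ext; simp [R]
  rw [hR, Set.ncard_coe_finset]
  have hF : ∀ τ, (F τ).card ≤ t + 1 := by
    intro τ
    by_contra hcon
    obtain ⟨u, hu⟩ : (F τ).Nonempty := Finset.card_pos.1 (by omega)
    obtain ⟨huA, hlt⟩ := Finset.mem_filter.1 hu
    have h1 : (F τ).card ≤ (A τ).card := Finset.card_filter_le _ _
    rw [Finset.card_erase_of_mem huA] at hlt
    omega
  have hF' : ∀ τ, (F' τ).card ≤ t + 3 := by
    intro τ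
    by_contra hcon
    -- A least obstructive member of `F' τ`: all others are at least as obstructive, hence are
    -- counted against it, and there are fewer than `t + 3` of them.
    have hsome : ∃ u ∈ F' τ, obs τ u → ∀ w ∈ F' τ, obs τ w := by
      by_cases hb : ∃ u ∈ F' τ, ¬ obs τ u
      · obtain ⟨u, hu, hu'⟩ := hb
        exact ⟨u, hu, fun h => absurd h hu'⟩
      · push Not at hb
        obtain ⟨u, hu⟩ : (F' τ).Nonempty := Finset.card_pos.1 (by omega)
        exact ⟨u, hu, fun _ => hb⟩
    obtain ⟨u, hu, hall⟩ := hsome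
    have hlt := (Finset.mem_filter.1 hu).2
    have hsub : (F' τ).erase u ⊆ ((A τ).erase u).filter fun w => obs τ u → obs τ w := by
      intro w hw
      obtain ⟨hne, hw⟩ := Finset.mem_erase.1 hw
      exact Finset.mem_filter.2 ⟨Finset.mem_erase.2 ⟨hne, (Finset.mem_filter.1 hw).1⟩,
        fun h => hall h w hw⟩
    have := Finset.card_le_card hsub
    rw [Finset.card_erase_of_mem hu] at this
    omega
  have hcover : R ⊆ (Zf.powersetCard 3).biUnion F ∪ (Zf.powersetCard 2).biUnion F' := by
    intro u hu
    have hrep : IsRep G Z u := (Finset.mem_filter.1 hu).2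
    have hNZ : openNbhd G (compOf G Z u) ⊆ Z := openNbhd_reach_subset
    by_contra hcon
    rw [Finset.mem_union, not_or] at hcon
    refine h u ⟨hrep.1, ?_, ?_⟩
    · intro a ha b hb c hc hab hac hbc
      by_contra hlt
      refine hcon.1 (Finset.mem_biUnion.2 ⟨{a, b, c}, Finset.mem_powersetCard.2 ⟨?_, ?_⟩, ?_⟩)
      · intro x hx
        simp only [Finset.mem_insert, Finset.mem_singleton] at hx
        rcases hx with rfl | rfl | rfl <;> simp [Zf, hNZ ha, hNZ hb, hNZ hc]
      · exact Finset.card_eq_three.2 ⟨a, b, c, hab, hac, hbc, rfl⟩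
      · refine Finset.mem_filter.2 ⟨Finset.mem_filter.2 ⟨hu, by simp [ha, hb, hc]⟩, ?_⟩
        rw [not_le] at hlt
        refine lt_of_eq_of_lt ?_ hlt
        rw [← Set.ncard_coe_finset]
        congr 1
        ext w
        simp only [A, R, Finset.coe_erase, Finset.coe_filter, Finset.mem_filter, Finset.mem_univ,
          true_and, Finset.mem_insert, Finset.mem_singleton, forall_eq_or_imp, forall_eq,
          Set.mem_sdiff, Set.mem_ofPred_eq, Set.mem_singleton_iff]
        constructor
        · rintro ⟨⟨h1, h2⟩, h3⟩
          exact ⟨h1, (notMem_compOf_iff h1 hrep).2 h3, h2⟩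
        · rintro ⟨h1, h3, h2⟩
          exact ⟨⟨h1, h2⟩, (notMem_compOf_iff h1 hrep).1 h3⟩
    · intro a ha b hb hab
      by_contra hlt
      refine hcon.2 (Finset.mem_biUnion.2 ⟨{a, b}, Finset.mem_powersetCard.2 ⟨?_, ?_⟩, ?_⟩)
      · intro x hx
        simp only [Finset.mem_insert, Finset.mem_singleton] at hx
        rcases hx with rfl | rfl <;> simp [Zf, hNZ ha, hNZ hb]
      · exact Finset.card_eq_two.2 ⟨a, b, hab, rfl⟩
      · refine Finset.mem_filter.2 ⟨Finset.mem_filter.2 ⟨hu, by simp [ha, hb]⟩, ?_⟩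
        rw [not_le] at hlt
        refine lt_of_eq_of_lt ?_ hlt
        rw [← Set.ncard_coe_finset]
        congr 1
        ext w
        have hobs : ∀ x, obs {a, b} x ↔ Obstructs G a b (compOf G Z x) := by
          intro x
          simp only [obs, Obstructs, Finset.coe_insert, Finset.coe_singleton]
        simp only [A, R, Finset.coe_filter, Finset.mem_erase, Finset.mem_filter, Finset.mem_univ,
          true_and, Finset.mem_insert, Finset.mem_singleton, forall_eq_or_imp, forall_eq,
          Set.mem_ofPred_eq, hobs]
        constructor
        · rintro ⟨⟨h3, h1, h2⟩, h4⟩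
          exact ⟨h1, (notMem_compOf_iff h1 hrep).2 h3, h2.1, h2.2, h4⟩
        · rintro ⟨h1, h3, h2, h2', h4⟩
          exact ⟨⟨(notMem_compOf_iff h1 hrep).1 h3, h1, h2, h2'⟩, h4⟩
  calc R.card ≤ _ := Finset.card_le_card hcover
    _ ≤ _ := Finset.card_union_le _ _
    _ ≤ (Zf.powersetCard 3).card * (t + 1) + (Zf.powersetCard 2).card * (t + 3) :=
      Nat.add_le_add (Finset.card_biUnion_le_card_mul _ _ _ fun τ _ => hF τ)
        (Finset.card_biUnion_le_card_mul _ _ _ fun τ _ => hF' τ)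
    _ ≤ boundC t Z.ncard := by
      rw [Finset.card_powersetCard, Finset.card_powersetCard, hZf, boundC]
      -- The count gives `t + 3` per pair, which is within the `2 * t + 3` of `boundC`.
      exact Nat.add_le_add_left (Nat.mul_le_mul_left _ (by omega)) _

theorem boundC_mono {x y : ℕ} (h : x ≤ y) : boundC t x ≤ boundC t y :=
  Nat.add_le_add (Nat.mul_le_mul_right _ (Nat.choose_le_choose 3 h))
    (Nat.mul_le_mul_right _ (Nat.choose_le_choose 2 h))

end Reduction

/-! ## Marked nodes and the component separator -/

section Bags

variable {V : Type*} {G : SimpleGraph V} {r : V → ℕ} {A B C M : Set V} {u v w m : V}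

/-- The bag of the node `v` of the elimination tree. -/
def bag (G : SimpleGraph V) (r : V → ℕ) (A : Set V) (v : V) : Set V :=
  {u | u = v ∨ (u ∈ openNbhd G (Tr G r A v) ∧ u ∈ A)}

/-- The union of the bags of the nodes in `M`. -/
def bags (G : SimpleGraph V) (r : V → ℕ) (A M : Set V) : Set V :=
  {u | ∃ m ∈ M, u ∈ bag G r A m}

/-- The part of the subtree of `v` that is connected to `v` when the bags of `M` are deleted. -/
def sub (G : SimpleGraph V) (r : V → ℕ) (A M : Set V) (v : V) : Set V :=
  {w | Reach G (Dn r A v \ bags G r A M) v w}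

/-- `M` together with the branching nodes of the subtree that it spans. -/
def branchClosure (G : SimpleGraph V) (r : V → ℕ) (A M : Set V) : Set V :=
  {v | v ∈ M ∨ (v ∈ A ∧ ∃ m₁ ∈ M, ∃ m₂ ∈ M, m₁ ∈ Tr G r A v ∧ m₂ ∈ Tr G r A v ∧ m₁ ≠ v ∧ m₂ ≠ v ∧
    ¬ Reach G (Tr G r A v \ {v}) m₁ m₂)}

theorem self_mem_bag : v ∈ bag G r A v := Or.inl rfl

theorem subset_bags : M ⊆ bags G r A M := fun m hm => ⟨m, hm, self_mem_bag⟩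

theorem bag_subset_bags (hm : m ∈ M) : bag G r A m ⊆ bags G r A M := fun _ hu => ⟨m, hm, hu⟩

theorem bags_mono {M' : Set V} (h : M ⊆ M') : bags G r A M ⊆ bags G r A M' :=
  fun _ ⟨m, hm, hu⟩ => ⟨m, h hm, hu⟩

theorem bags_subset (hM : M ⊆ A) : bags G r A M ⊆ A := by
  rintro u ⟨m, hm, rfl | hu⟩
  exacts [hM hm, hu.2]

theorem ncard_bag_le [Finite V] (hr : GoodOrder G A r) (hv : v ∈ A) : (bag G r A v).ncard ≤ 3 := by
  have : bag G r A v = insert v (openNbhd G (Tr G r A v) ∩ A) := rfl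
  rw [this]
  have h1 := Set.ncard_insert_le v (openNbhd G (Tr G r A v) ∩ A)
  have h2 := hr.2 v hv
  omega

theorem ncard_bags_le [Finite V] (hr : GoodOrder G A r) (hM : M ⊆ A) :
    (bags G r A M).ncard ≤ 3 * M.ncard := by
  classical
  have hfin : ∀ s : Set V, s.Finite := fun s => Set.toFinite s
  have h : bags G r A M ⊆ ((hfin M).toFinset.biUnion fun m => (hfin (bag G r A m)).toFinset : Finset V) := by
    rintro u ⟨m, hm, hu⟩
    simp only [Finset.coe_biUnion, Set.mem_iUnion, Finset.mem_coe, Set.Finite.mem_toFinset]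
    exact ⟨m, hm, hu⟩
  refine (Set.ncard_le_ncard h (hfin _)).trans ?_
  rw [Set.ncard_coe_finset, mul_comm, Set.ncard_eq_toFinset_card M (hfin M)]
  refine Finset.card_biUnion_le_card_mul _ _ _ fun m hm => ?_
  rw [← Set.ncard_eq_toFinset_card]
  exact ncard_bag_le hr (hM ((Set.Finite.mem_toFinset _).1 hm))

/-- A connected set that avoids the bag of `m` lies below `m` or beside it. -/
theorem ConnSet.below_or_disjoint (hB : ConnSet G B) (hBA : B ⊆ A)
    (hd : Disjoint B (bag G r A m)) : B ⊆ Tr G r A m ∨ Disjoint B (Tr G r A m) := by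
  by_cases h : Disjoint B (Tr G r A m)
  · exact Or.inr h
  · obtain ⟨u, hu, huT⟩ := Set.not_disjoint_iff.1 h
    refine Or.inl (hB.subset_of_disjoint_openNbhd ?_ hu huT)
    rw [Set.disjoint_left]
    exact fun w hw hw' => Set.disjoint_left.1 hd hw (Or.inr ⟨hw', hBA hw⟩)

theorem self_mem_sub : v ∈ sub G r A M v := Reach.refl _ _ _

theorem connSet_sub : ConnSet G (sub G r A M v) := connSet_reach _ _ _

theorem sub_subset (hv : v ∈ A) (hvM : v ∉ bags G r A M) :
    sub G r A M v ⊆ Dn r A v \ bags G r A M :=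
  Reach.subset ⟨self_mem_Dn hv, hvM⟩

theorem sub_subset_Tr : sub G r A M v ⊆ Tr G r A v :=
  fun _ h => Reach.mono_set Set.sdiff_subset h

theorem sub_anti {M' : Set V} (h : M ⊆ M') : sub G r A M' v ⊆ sub G r A M v :=
  fun _ hw => Reach.mono_set (Set.sdiff_subset_sdiff_right (bags_mono h)) hw

theorem ConnSet.subset_sub (hB : ConnSet G B) (hBA : B ⊆ A) (hBM : Disjoint B (bags G r A M))
    (hv : v ∈ B) (hmax : ∀ w ∈ B, r w ≤ r v) : B ⊆ sub G r A M v :=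
  hB.subset_reach (fun _ hw => ⟨⟨hBA hw, hmax _ hw⟩, Set.disjoint_left.1 hBM hw⟩) hv

theorem branchClosure_subset (hM : M ⊆ A) : branchClosure G r A M ⊆ A := by
  rintro v (hv | hv)
  exacts [hM hv, hv.1]

theorem subset_branchClosure : M ⊆ branchClosure G r A M := fun _ h => Or.inl h

theorem exists_mark_below (hv : v ∈ branchClosure G r A M) : ∃ m ∈ M, m ∈ Tr G r A v := by
  rcases hv with hv | ⟨-, m, hm, -, -, h, -⟩
  · exact ⟨v, hv, mem_Tr_self _ _ _ _⟩
  · exact ⟨m, hm, h⟩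

/-- Each new branching node `v` is charged to a mark `f v`. Among the parts of `Tr v` without `v`,
take one that contains marks but not the least mark `l` below `v`; `f v` is the least mark of that
part. "Least" refers to the linear order of the vertices, not to `r`. -/
theorem ncard_branchClosure_le [Finite V] [LinearOrder V] (hr : GoodOrder G A r) :
    (branchClosure G r A M).ncard ≤ 2 * M.ncard := by
  have key : ∀ v, ∃ f, v ∈ branchClosure G r A M \ M → f ∈ M ∧ f ∈ Tr G r A v ∧
      (∀ m ∈ M, Reach G (Tr G r A v \ {v}) f m → f ≤ m) ∧
      ∃ l ∈ M, l ∈ Tr G r A v ∧ l < f := by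
    intro v
    by_cases hv : v ∈ branchClosure G r A M \ M
    swap
    · exact ⟨v, fun h => absurd h hv⟩
    obtain ⟨hv, hvM⟩ := hv
    obtain ⟨-, m₁, hm₁, m₂, hm₂, h₁, h₂, hne₁, hne₂, hsep⟩ := hv.resolve_left hvM
    obtain ⟨l, ⟨hlM, hlT⟩, hlmin⟩ := Set.exists_min_image (M ∩ Tr G r A v) id (Set.toFinite _)
      ⟨m₁, hm₁, h₁⟩
    have hm : ∃ m ∈ M, m ∈ Tr G r A v ∧ m ≠ v ∧ ¬ Reach G (Tr G r A v \ {v}) m l := by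
      by_cases h : Reach G (Tr G r A v \ {v}) m₁ l
      · exact ⟨m₂, hm₂, h₂, hne₂, fun h' => hsep (h.trans (h'.symm ⟨h₂, hne₂⟩))⟩
      · exact ⟨m₁, hm₁, h₁, hne₁, h⟩
    obtain ⟨m, hm, hmT, hmv, hml⟩ := hm
    obtain ⟨f, ⟨hfM, hfK⟩, hfmin⟩ := Set.exists_min_image
      (M ∩ {w | Reach G (Tr G r A v \ {v}) m w}) id (Set.toFinite _) ⟨m, hm, Reach.refl _ _ _⟩
    have hfT : f ∈ Tr G r A v := (Reach.mem hfK ⟨hmT, hmv⟩).1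
    refine ⟨f, fun _ => ⟨hfM, hfT, fun m' hm' h => hfmin m' ⟨hm', hfK.trans h⟩, l, hlM, hlT, ?_⟩⟩
    refine lt_of_le_of_ne (hlmin f ⟨hfM, hfT⟩) ?_
    rintro rfl
    exact hml hfK
  choose f hf using key
  have hinj : Set.InjOn f (branchClosure G r A M \ M) := by
    -- If `a` and `b` had the same charge and `a` were earlier, all of `Tr a` would lie in one part
    -- of `Tr b \ {b}`. That part contains the mark `l < f a` of `a`, so `f a` is not its least
    -- mark.
    have aux : ∀ a ∈ branchClosure G r A M \ M, ∀ b ∈ branchClosure G r A M \ M, f a = f b →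
        ¬ r a < r b := by
      intro a ha b hb hab hlt
      have haA : a ∈ A := (ha.1.resolve_left ha.2).1
      have hbA : b ∈ A := (hb.1.resolve_left hb.2).1
      obtain ⟨-, hfa, -, l, hl, hla, hlf⟩ := hf a ha
      obtain ⟨-, hfb, hmin, -⟩ := hf b hb
      rw [← hab] at hfb hmin
      have hab' := Tr_subset_Tr hbA (mem_Tr_of_inter haA hfb hfa hlt.le)
      have hsub : Tr G r A a ⊆ Tr G r A b \ {b} := fun x hx => ⟨hab' hx, fun h => by
        rw [Set.mem_singleton_iff.1 h] at hx
        exact absurd (Tr_subset_Dn haA hx).2 (not_le.2 hlt)⟩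
      exact absurd (hmin l hl ((connSet_Tr _ hfa _ hla).mono_set hsub)) (not_le.2 hlf)
    intro a ha b hb hab
    refine hr.1 (ha.1.resolve_left ha.2).1 (hb.1.resolve_left hb.2).1 (le_antisymm ?_ ?_)
    · exact not_lt.1 (aux b hb a ha hab.symm)
    · exact not_lt.1 (aux a ha b hb hab)
  have h1 := Set.ncard_le_ncard_of_injOn f (fun v hv => (hf v hv).1) hinj (Set.toFinite M)
  have h2 := Set.ncard_le_ncard_sdiff_add_ncard (branchClosure G r A M) M (Set.toFinite _)
  omega

/-- Closure under branching gives the nodes of the closure below `c` a common top `m₀`: the lowest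
common ancestor of `m₀` and a node not below it would be a branching node above `m₀`. -/
theorem mem_Tr_of_max [Finite V] (hr : GoodOrder G A r) (hMA : M ⊆ A) {c m₀ m : V} (hc : c ∈ A)
    (hm₀ : m₀ ∈ branchClosure G r A M) (hm₀c : m₀ ∈ Tr G r A c)
    (hmax : ∀ w ∈ branchClosure G r A M, w ∈ Tr G r A c → r w ≤ r m₀)
    (hm : m ∈ branchClosure G r A M) (hmc : m ∈ Tr G r A c) : m ∈ Tr G r A m₀ := by
  by_contra hnot
  have hcl := branchClosure_subset (G := G) (r := r) hMA
  have hne : m ≠ m₀ := fun h => hnot (h ▸ mem_Tr_self _ _ _ _)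
  have hlt : r m < r m₀ := lt_of_le_of_ne (hmax m hm hmc) fun h => hne (hr.1 (hcl hm) (hcl hm₀) h)
  obtain ⟨v, ⟨hvA, hmv, hm₀v⟩, hmin⟩ := Set.exists_min_image
    {v | v ∈ A ∧ m ∈ Tr G r A v ∧ m₀ ∈ Tr G r A v} r (Set.toFinite _) ⟨c, hc, hmc, hm₀c⟩
  have hvc : v ∈ Tr G r A c := mem_Tr_of_inter hvA hm₀c hm₀v (hmin c ⟨hc, hmc, hm₀c⟩)
  have hm₀v' := (Tr_subset_Dn hvA hm₀v).2
  have hvm₀ : v ≠ m₀ := by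
    rintro rfl
    exact hnot hmv
  have hmlt : r m < r v := by omega
  have hm₀lt : r m₀ < r v := lt_of_le_of_ne hm₀v' fun h => hvm₀ (hr.1 hvA (hcl hm₀) h.symm)
  have hsub : ∀ x ∈ A, x ∈ Tr G r A v → r x < r v → Tr G r A x ⊆ Tr G r A v \ {v} := by
    intro x hxA hx hlt y hy
    refine ⟨Tr_subset_Tr hvA hx hy, fun h => ?_⟩
    rw [Set.mem_singleton_iff.1 h] at hy
    exact absurd (Tr_subset_Dn hxA hy).2 (not_le.2 hlt)
  -- If `m` and `m₀` lay in one part of `Tr v \ {v}`, the last vertex of this part would be a lower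
  -- common ancestor.
  have hsep : ¬ Reach G (Tr G r A v \ {v}) m m₀ := by
    intro h
    have hmv' : m ∈ Tr G r A v \ {v} := ⟨hmv, fun h => by
      rw [Set.mem_singleton_iff.1 h] at hmlt; omega⟩
    have hKsub : {w | Reach G (Tr G r A v \ {v}) m w} ⊆ Tr G r A v \ {v} := Reach.subset hmv'
    obtain ⟨w, hw, hwmax⟩ := Set.exists_max_rank (B := {w | Reach G (Tr G r A v \ {v}) m w}) r
      ⟨m, Reach.refl _ _ _⟩
    have hKA : {w | Reach G (Tr G r A v \ {v}) m w} ⊆ A := fun x hx =>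
      (Tr_subset_Dn hvA (hKsub hx).1).1
    have hK := (connSet_reach G (Tr G r A v \ {v}) m).subset_Tr hKA hw hwmax
    have h1 := hmin w ⟨hKA hw, hK (Reach.refl _ _ _), hK h⟩
    have h2 := (Tr_subset_Dn hvA (hKsub hw).1).2
    exact (hKsub hw).2 (hr.1 (hKA hw) hvA (le_antisymm h2 h1))
  have hv : v ∈ branchClosure G r A M := by
    obtain ⟨m₁, hm₁, h₁⟩ := exists_mark_below hm
    obtain ⟨m₂, hm₂, h₂⟩ := exists_mark_below hm₀
    have s₁ := hsub m (hcl hm) hmv hmlt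
    have s₂ := hsub m₀ (hcl hm₀) hm₀v hm₀lt
    refine Or.inr ⟨hvA, m₁, hm₁, m₂, hm₂, (s₁ h₁).1, (s₂ h₂).1, (s₁ h₁).2, (s₂ h₂).2, fun h => ?_⟩
    exact hsep ((((connSet_Tr _ (mem_Tr_self _ _ _ _) _ h₁).mono_set s₁).trans h).trans
      ((connSet_Tr _ h₂ _ (mem_Tr_self _ _ _ _)).mono_set s₂))
  have := hmax v hv hvc
  omega

/-- A component outside the bags of a branch-closed set has at most four neighbours in them. -/
theorem ncard_openNbhd_inter_le [Finite V] (hr : GoodOrder G A r) (hMA : M ⊆ A)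
    (hC : ConnSet G C) (hCA : C ⊆ A) (hne : C.Nonempty)
    (hd : Disjoint C (bags G r A (branchClosure G r A M))) :
    (openNbhd G C ∩ bags G r A (branchClosure G r A M)).ncard ≤ 4 := by
  have hcl := branchClosure_subset (G := G) (r := r) hMA
  obtain ⟨c, hc, hcmax⟩ := Set.exists_max_rank r hne
  have hcA := hCA hc
  have hCT : C ⊆ Tr G r A c := hC.subset_Tr hCA hc hcmax
  have hlow : ∀ u ∈ openNbhd G C ∩ bags G r A (branchClosure G r A M), u ∉ Tr G r A c →
      u ∈ openNbhd G (Tr G r A c) ∩ A := by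
    rintro u ⟨⟨-, z, hz, hzu⟩, huY⟩ hu
    exact ⟨⟨hu, z, hCT hz, hzu⟩, bags_subset hcl huY⟩
  -- A node whose bag contains `u` is `u` itself or a descendant of `u`.
  have hmark : ∀ u ∈ A, u ∈ Tr G r A c → ∀ m ∈ branchClosure G r A M, u ∈ bag G r A m →
      m ∈ Tr G r A c := by
    rintro u huA hu m hm (rfl | ⟨hu', -⟩)
    · exact hu
    · have hlt := lt_of_mem_openNbhd_Tr hu' huA
      obtain ⟨-, z, hz, hzu⟩ := hu'
      have hzA := Tr_subset_Dn (hcl hm) hz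
      have hzT : z ∈ Tr G r A u :=
        Reach.step (Reach.refl _ _ _) hzu.symm ⟨hzA.1, hzA.2.trans hlt.le⟩
      exact Tr_subset_Tr hcA hu (mem_Tr_of_inter (hcl hm) hzT hz hlt.le)
  by_cases hex : (branchClosure G r A M ∩ Tr G r A c).Nonempty
  · obtain ⟨m₀, ⟨hm₀, hm₀c⟩, hmax⟩ := Set.exists_max_rank r hex
    have hdm : Disjoint C (bag G r A m₀) := hd.mono_right (bag_subset_bags hm₀)
    have hCm : Disjoint C (Tr G r A m₀) := by
      refine (hC.below_or_disjoint hCA hdm).resolve_left fun h => ?_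
      have h1 := (Tr_subset_Dn (hcl hm₀) (h hc)).2
      have h2 := (Tr_subset_Dn hcA hm₀c).2
      have := hr.1 (hcl hm₀) hcA (le_antisymm h2 h1)
      exact Set.disjoint_left.1 hdm hc (Or.inl this.symm)
    -- `C` lies below its last vertex `c` and beside the top mark `m₀`. Its neighbours in `Y`
    -- outside `Tr c` are neighbours of `Tr c`. Those inside belong to bags of marks below `m₀`;
    -- they are not in `Tr m₀`, as otherwise `C` would meet the bag of `m₀`, so they are neighbours
    -- of `Tr m₀`.
    have hsub : openNbhd G C ∩ bags G r A (branchClosure G r A M) ⊆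
        (openNbhd G (Tr G r A c) ∩ A) ∪ (openNbhd G (Tr G r A m₀) ∩ A) := by
      intro u hu
      by_cases huc : u ∈ Tr G r A c
      swap
      · exact Or.inl (hlow u hu huc)
      obtain ⟨⟨huC, a, ha, hau⟩, m, hm, hum⟩ := hu
      have huA : u ∈ A := (Tr_subset_Dn hcA huc).1
      have hmm₀ := Tr_subset_Tr (hcl hm₀) (mem_Tr_of_max hr hMA hcA hm₀ hm₀c
        (fun w hw hw' => hmax w (Set.mem_inter hw hw')) hm (hmark u huA huc m hm hum))
      have huT : u ∉ Tr G r A m₀ := fun h => Set.disjoint_left.1 hdm ha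
        (Or.inr ⟨⟨Set.disjoint_left.1 hCm ha, u, h, hau.symm⟩, hCA ha⟩)
      rcases hum with rfl | ⟨⟨-, z, hz, hzu⟩, -⟩
      · exact absurd (hmm₀ (mem_Tr_self _ _ _ _)) huT
      · exact Or.inr ⟨⟨huT, z, hmm₀ hz, hzu⟩, huA⟩
    have h1 := Set.ncard_le_ncard hsub (Set.toFinite _)
    have h2 := Set.ncard_union_le (openNbhd G (Tr G r A c) ∩ A) (openNbhd G (Tr G r A m₀) ∩ A)
    have h3 := hr.2 c hcA
    have h4 := hr.2 m₀ (hcl hm₀)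
    omega
  · have hsub : openNbhd G C ∩ bags G r A (branchClosure G r A M) ⊆
        openNbhd G (Tr G r A c) ∩ A := by
      intro u hu
      refine hlow u hu fun huc => hex ?_
      obtain ⟨-, m, hm, hum⟩ := hu
      exact ⟨m, hm, hmark u (Tr_subset_Dn hcA huc).1 huc m hm hum⟩
    have h1 := Set.ncard_le_ncard hsub (Set.toFinite _)
    have h3 := hr.2 c hcA
    omega

end Bags

/-! ### Marks for the pairs of modulator vertices -/

section Marking

variable {n : ℕ} {G : SimpleGraph (Fin n)} {t : ℕ} {r : Fin n → ℕ} {A C K K' M S X Y : Set (Fin n)}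
  {u v w x y : Fin n}

/-- `K` has neighbours of both `x` and `y`. -/
def Joins (G : SimpleGraph (Fin n)) (x y : Fin n) (K : Set (Fin n)) : Prop :=
  Sees G K x ∧ Sees G K y

/-- `K` joins `x` and `y` and, if these are adjacent, forms with them a graph of treewidth
more than two. -/
def Bad (G : SimpleGraph (Fin n)) (x y : Fin n) (K : Set (Fin n)) : Prop :=
  Joins G x y K ∧ (G.Adj x y → ¬ TW G (K ∪ {x, y}))

theorem Joins.mono (h : Joins G x y K) (hK : K ⊆ K') : Joins G x y K' :=
  ⟨h.1.mono hK, h.2.mono hK⟩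

theorem Bad.mono (h : Bad G x y K) (hK : K ⊆ K') : Bad G x y K' :=
  ⟨h.1.mono hK, fun hxy hT => h.2 hxy (hT.mono_set (Set.union_subset_union_left _ hK))⟩

/-- Mark the lowest node whose remaining subtree contains a bad set, unless enough nodes are
marked already. -/
def markStep (G : SimpleGraph (Fin n)) (t : ℕ) (r : Fin n → ℕ) (A : Set (Fin n)) (x y : Fin n)
    (M : Set (Fin n)) : Set (Fin n) :=
  {v | v ∈ M ∨ (v ∈ A ∧ v ∉ bags G r A M ∧ ¬ (G.Adj x y ∧ t + 2 ≤ M.ncard) ∧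
    Bad G x y (sub G r A M v) ∧
    ∀ u, u ∈ A → u ∉ bags G r A M → r u < r v → ¬ Bad G x y (sub G r A M u))}

/-- The nodes marked to separate the bad sets of the pair `x`, `y`. -/
def firstMarks (G : SimpleGraph (Fin n)) (t : ℕ) (r : Fin n → ℕ) (A : Set (Fin n))
    (x y : Fin n) : Set (Fin n) :=
  stage (markStep G t r A x y) n

/-- One node for every component left by `firstMarks` that joins the adjacent vertices
`x` and `y`. -/
def secondMarks (G : SimpleGraph (Fin n)) (t : ℕ) (r : Fin n → ℕ) (A : Set (Fin n))
    (x y : Fin n) : Set (Fin n) :=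
  {v | G.Adj x y ∧ ¬ t + 2 ≤ (firstMarks G t r A x y).ncard ∧ v ∈ A ∧
    v ∉ bags G r A (firstMarks G t r A x y) ∧
    Joins G x y (sub G r A (firstMarks G t r A x y) v) ∧
    ∀ u, Reach G (A \ bags G r A (firstMarks G t r A x y)) v u → r u < r v →
      ¬ Joins G x y (sub G r A (firstMarks G t r A x y) u)}

/-- The nodes marked for some pair of vertices of `X`. -/
def marks (G : SimpleGraph (Fin n)) (t : ℕ) (r : Fin n → ℕ) (A X : Set (Fin n)) : Set (Fin n) :=
  {v | ∃ x y, x ∈ X ∧ y ∈ X ∧ x < y ∧ (v ∈ firstMarks G t r A x y ∨ v ∈ secondMarks G t r A x y)}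

theorem subset_markStep (W : Set (Fin n)) : W ⊆ markStep G t r A x y W := fun _ h => Or.inl h

/-- The lowest eligible node is unique because `r` is injective on `A`. -/
theorem markStep_eq (hr : GoodOrder G A r) (M : Set (Fin n)) : markStep G t r A x y M = M ∨
    ∃ v, (v ∈ A ∧ v ∉ bags G r A M ∧ ¬ (G.Adj x y ∧ t + 2 ≤ M.ncard) ∧ Bad G x y (sub G r A M v) ∧
      ∀ u, u ∈ A → u ∉ bags G r A M → r u < r v → ¬ Bad G x y (sub G r A M u)) ∧
      markStep G t r A x y M = insert v M := by
  by_cases h : ∃ v, v ∉ M ∧ v ∈ markStep G t r A x y M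
  · obtain ⟨v, hvM, hv⟩ := h
    have hv := hv.resolve_left hvM
    refine Or.inr ⟨v, hv, ?_⟩
    ext u
    constructor
    · rintro (hu | hu)
      · exact Or.inr hu
      · refine Or.inl (hr.1 hu.1 hv.1 (le_antisymm ?_ ?_))
        · exact not_lt.1 fun h => hu.2.2.2.2 v hv.1 hv.2.1 h hv.2.2.2.1
        · exact not_lt.1 fun h => hv.2.2.2.2 u hu.1 hu.2.1 h hu.2.2.2.1
    · rintro (rfl | hu)
      · exact Or.inr hv
      · exact Or.inl hu
  · refine Or.inl (Set.Subset.antisymm (fun u hu => ?_) (subset_markStep M))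
    by_contra hu'
    exact h ⟨u, hu', hu⟩

theorem firstMarks_subset : firstMarks G t r A x y ⊆ A := by
  have : ∀ k, stage (markStep G t r A x y) k ⊆ A := by
    intro k
    induction k with
    | zero => exact Set.empty_subset _
    | succ k ih =>
      rw [stage_succ]
      rintro v (hv | hv)
      exacts [ih hv, hv.1]
  exact this n

theorem secondMarks_subset : secondMarks G t r A x y ⊆ A := fun _ h => h.2.2.1

theorem marks_subset : marks G t r A X ⊆ A := by
  rintro v ⟨x, y, -, -, -, hv | hv⟩
  exacts [firstMarks_subset hv, secondMarks_subset hv]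

/-- The marked nodes carry disjoint bad sets, in the order of the elimination tree. -/
theorem stage_markStep_inv (hr : GoodOrder G A r) (k : ℕ) :
    (∃ H : Fin n → Set (Fin n), ∀ m ∈ stage (markStep G t r A x y) k,
      ConnSet G (H m) ∧ Bad G x y (H m) ∧ H m ⊆ Tr G r A m ∧
      ∀ m' ∈ stage (markStep G t r A x y) k, r m < r m' → Disjoint (H m') (Tr G r A m)) ∧
    (∀ m ∈ stage (markStep G t r A x y) k, ∀ v ∈ A, v ∉ bags G r A (stage (markStep G t r A x y) k) →
      r v < r m → ¬ Bad G x y (sub G r A (stage (markStep G t r A x y) k) v)) ∧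
    (G.Adj x y → (stage (markStep G t r A x y) k).ncard ≤ t + 2) := by
  classical
  induction k with
  | zero =>
    exact ⟨⟨fun _ => ∅, fun m hm => absurd hm (Set.notMem_empty m)⟩,
      fun m hm => absurd hm (Set.notMem_empty m), fun _ => by simp [stage]⟩
  | succ k ih =>
    rw [stage_succ]
    rcases markStep_eq (t := t) (x := x) (y := y) hr (stage (markStep G t r A x y) k) with
      h | ⟨v, ⟨hvA, hvM, hlim, hbad, hfirst⟩, h⟩
    · rw [h]; exact ih
    rw [h]
    obtain ⟨⟨H, hH⟩, hfront, hcard⟩ := ih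
    set M := stage (markStep G t r A x y) k with hM
    have hMA : M ⊆ A := by
      refine (stage_mono subset_markStep (Nat.le_succ k)).trans ?_
      rw [Nat.succ_eq_add_one, stage_succ, h]
      refine Set.insert_subset hvA ?_
      intro m hm
      have : ∀ k, stage (markStep G t r A x y) k ⊆ A := by
        intro k
        induction k with
        | zero => exact Set.empty_subset _
        | succ k ih =>
          rw [stage_succ]
          rintro v (hv | hv)
          exacts [ih hv, hv.1]
      exact this k hm
    have hvnot : v ∉ M := fun h => hvM (subset_bags h)
    -- Nothing bad is left strictly below an old mark, and remaining subtrees only shrink; so marks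
    -- are found in increasing order.
    have hlt : ∀ m ∈ M, r m < r v := by
      intro m hm
      refine lt_of_le_of_ne (not_lt.1 fun h => hfront m hm v hvA hvM h hbad) fun h => ?_
      exact hvnot (hr.1 (hMA hm) hvA h ▸ hm)
    have hsubM : M ⊆ insert v M := Set.subset_insert _ _
    refine ⟨⟨Function.update H v (sub G r A M v), ?_⟩, ?_, ?_⟩
    · have hne : ∀ m ∈ M, Function.update H v (sub G r A M v) m = H m := fun m hm =>
        Function.update_of_ne (fun h => hvnot (by rw [← h]; exact hm)) _ _
      have heq : Function.update H v (sub G r A M v) v = sub G r A M v := Function.update_self _ _ _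
      rintro m (rfl | hm)
      · rw [heq]
        refine ⟨connSet_sub, hbad, sub_subset_Tr, ?_⟩
        rintro m' (rfl | hm') hmm'
        · exact absurd hmm' (lt_irrefl _)
        · exact absurd hmm' (not_lt.2 (hlt m' hm').le)
      · rw [hne m hm]
        obtain ⟨h1, h2, h3, h4⟩ := hH m hm
        refine ⟨h1, h2, h3, ?_⟩
        rintro m' (rfl | hm') hmm'
        · rw [heq]
          have hs := sub_subset hvA hvM
          -- The new bad set avoids the bag of `m` and contains `v`, which is later than `m`; so it
          -- lies beside `Tr m`.
          refine (connSet_sub.below_or_disjoint (fun z hz => (hs hz).1.1) ?_).resolve_left ?_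
          · rw [Set.disjoint_left]
            exact fun z hz hz' => (hs hz).2 ⟨m, hm, hz'⟩
          · intro hsub
            exact absurd (Tr_subset_Dn (hMA hm) (hsub self_mem_sub)).2 (not_le.2 hmm')
        · rw [hne m' hm']
          exact h4 m' hm' hmm'
    · intro m hm u huA huM hum hbadu
      have huM' : u ∉ bags G r A M := fun h => huM (bags_mono hsubM h)
      have hbadu' := hbadu.mono (sub_anti hsubM)
      rcases hm with rfl | hm
      · exact hfirst u huA huM' hum hbadu'
      · exact hfront m hm u huA huM' hum hbadu'
    · intro hxy
      rw [Set.ncard_insert_of_notMem hvnot (Set.toFinite _)]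
      have : ¬ t + 2 ≤ M.ncard := fun h => hlim ⟨hxy, h⟩
      omega

/-- If the limit was not reached, marking stopped because nothing was left to mark: a lowest bad
node would be added by one more step, but the process is stationary. -/
theorem not_bad_of_firstMarks (hlim : ¬ (G.Adj x y ∧ t + 2 ≤ (firstMarks G t r A x y).ncard))
    (hv : v ∈ A) (hvM : v ∉ bags G r A (firstMarks G t r A x y)) :
    ¬ Bad G x y (sub G r A (firstMarks G t r A x y) v) := by
  intro hbad
  obtain ⟨u, ⟨huA, huM, hu⟩, hmin⟩ := Set.exists_min_image
    {v | v ∈ A ∧ v ∉ bags G r A (firstMarks G t r A x y) ∧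
      Bad G x y (sub G r A (firstMarks G t r A x y) v)} r (Set.toFinite _) ⟨v, hv, hvM, hbad⟩
  have hstep : u ∈ markStep G t r A x y (firstMarks G t r A x y) :=
    Or.inr ⟨huA, huM, hlim, hu, fun w hw hw' hlt hbad =>
      absurd (hmin w ⟨hw, hw', hbad⟩) (not_le.2 hlt)⟩
  rw [firstMarks, stage_fixed subset_markStep] at hstep
  exact huM (subset_bags hstep)

/-- A connected set that joins two vertices carries a path between them. -/
theorem exists_path_through (hK : ConnSet G K) (h : Joins G x y K) (hx : x ∉ K) (hy : y ∉ K)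
    (hxy : x ≠ y) (hadj : ¬ G.Adj x y) :
    ∃ p : G.Path x y, (∀ v ∈ p.1.support, v = x ∨ v = y ∨ v ∈ K) ∧ ∃ v ∈ p.1.support, v ∈ K := by
  classical
  obtain ⟨⟨a, ha, hax⟩, b, hb, hby⟩ := h
  have walk : ∀ b, Reach G K a b → ∃ p : G.Walk x b, ∀ v ∈ p.support, v = x ∨ v ∈ K := by
    intro b hab
    induction hab with
    | refl =>
      refine ⟨SimpleGraph.Walk.cons hax.symm SimpleGraph.Walk.nil, fun v hv => ?_⟩
      simp only [SimpleGraph.Walk.support_cons, SimpleGraph.Walk.support_nil, List.mem_cons,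
        List.not_mem_nil, or_false] at hv
      rcases hv with rfl | rfl
      exacts [Or.inl rfl, Or.inr ha]
    | tail _ hbc ih =>
      obtain ⟨p, hp⟩ := ih
      refine ⟨p.concat hbc.1, fun v hv => ?_⟩
      rw [SimpleGraph.Walk.support_concat, List.mem_append, List.mem_singleton] at hv
      rcases hv with hv | rfl
      exacts [hp v hv, Or.inr hbc.2]
  obtain ⟨p, hp⟩ := walk b (hK a ha b hb)
  have hp' : ∀ v ∈ (p.concat hby).support, v = x ∨ v = y ∨ v ∈ K := by
    intro v hv
    rw [SimpleGraph.Walk.support_concat, List.mem_append, List.mem_singleton] at hv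
    rcases hv with hv | rfl
    · rcases hp v hv with h | h
      exacts [Or.inl h, Or.inr (Or.inr h)]
    · exact Or.inr (Or.inl rfl)
  refine ⟨(p.concat hby).toPath, fun v hv => hp' v (SimpleGraph.Walk.support_bypass_subset_support _ hv), ?_⟩
  by_contra hcon
  push Not at hcon
  have hq : ∀ v ∈ ((p.concat hby).toPath : G.Walk x y).support, v = x ∨ v = y := by
    intro v hv
    rcases hp' v (SimpleGraph.Walk.support_bypass_subset_support _ hv) with h | h | h
    exacts [Or.inl h, Or.inr h, absurd h (hcon v hv)]
  -- Shortening the walk to a path cannot bypass `K` altogether, since this would leave the edge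
  -- `xy`. The vertex in `K` later distinguishes the paths of different marks.
  have aux : ∀ q : G.Walk x y, (∀ v ∈ q.support, v = x ∨ v = y) → False := by
    intro q hq
    cases q with
    | nil => exact hxy rfl
    | @cons _ c _ hxc q =>
      rcases hq c (by simp) with rfl | rfl
      · exact hxc.ne rfl
      · exact hadj hxc
  exact aux _ hq

/-- For adjacent vertices the limit is built into the marking. For non-adjacent ones the disjoint
bad sets carry internally disjoint paths, and `X` is linked. -/
theorem ncard_firstMarks_le (hr : GoodOrder G Xᶜ r) (hlink : IsLinked G t X) (hx : x ∈ X)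
    (hy : y ∈ X) (hxy : x ≠ y) : (firstMarks G t r Xᶜ x y).ncard ≤ t + 2 := by
  classical
  obtain ⟨⟨H, hH⟩, -, hcard⟩ := stage_markStep_inv (t := t) (x := x) (y := y) hr n
  change ∀ m ∈ firstMarks G t r Xᶜ x y, _ at hH
  by_cases hadj : G.Adj x y
  · exact hcard hadj
  have hHX : ∀ m ∈ firstMarks G t r Xᶜ x y, H m ⊆ Xᶜ := fun m hm z hz =>
    (Tr_subset_Dn (firstMarks_subset hm) ((hH m hm).2.2.1 hz)).1
  have hdisj : ∀ m ∈ firstMarks G t r Xᶜ x y, ∀ m' ∈ firstMarks G t r Xᶜ x y, m ≠ m' →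
      Disjoint (H m) (H m') := by
    intro m hm m' hm' hne
    have hrne : r m ≠ r m' := fun h => hne (hr.1 (firstMarks_subset hm) (firstMarks_subset hm') h)
    rcases lt_or_gt_of_ne hrne with h | h
    · exact (((hH m hm).2.2.2 m' hm' h).mono_right (hH m hm).2.2.1).symm
    · exact ((hH m' hm').2.2.2 m hm h).mono_right (hH m' hm').2.2.1
  have hpath : ∀ m : ↥(firstMarks G t r Xᶜ x y), ∃ p : G.Path x y,
      (∀ v ∈ p.1.support, v = x ∨ v = y ∨ v ∈ H m) ∧ ∃ v ∈ p.1.support, v ∈ H m := fun m =>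
    exists_path_through (hH m m.2).1 (hH m m.2).2.1.1 (fun h => hHX m m.2 h hx)
      (fun h => hHX m m.2 h hy) hxy hadj
  choose p hp hp' using hpath
  have hinj : Function.Injective p := by
    intro m m' hmm
    by_contra hne
    obtain ⟨v, hv, hvH⟩ := hp' m
    rw [hmm] at hv
    rcases hp m' v hv with rfl | rfl | h
    · exact hHX m m.2 hvH hx
    · exact hHX m m.2 hvH hy
    · exact Set.disjoint_left.1 (hdisj m m.2 m' m'.2 fun h => hne (Subtype.ext h)) hvH h
  have h1 := hlink x hx y hy hxy hadj (Finset.univ.image p) (by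
    intro a ha b hb hab v hva hvb
    obtain ⟨m, -, rfl⟩ := Finset.mem_image.1 (Finset.mem_coe.1 ha)
    obtain ⟨m', -, rfl⟩ := Finset.mem_image.1 (Finset.mem_coe.1 hb)
    rcases hp m v hva with h | h | h
    · exact Or.inl h
    · exact Or.inr h
    rcases hp m' v hvb with h' | h' | h'
    · exact Or.inl h'
    · exact Or.inr h'
    exact absurd h' (Set.disjoint_left.1 (hdisj m m.2 m' m'.2 fun h => hab (by
      rw [Subtype.ext h])) h))
  rwa [Finset.card_image_of_injective _ hinj, Finset.card_univ, ← Nat.card_eq_fintype_card,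
    Nat.card_coe_set_eq] at h1

/-- Each component contains at most one such node, namely its lowest one that joins `x` and `y`. -/
theorem ncard_secondMarks_le (hr : GoodOrder G Xᶜ r) : (secondMarks G t r Xᶜ x y).ncard ≤
    (components G (X ∪ bags G r Xᶜ (firstMarks G t r Xᶜ x y))).ncard := by
  have hcompl : (X ∪ bags G r Xᶜ (firstMarks G t r Xᶜ x y))ᶜ =
      Xᶜ \ bags G r Xᶜ (firstMarks G t r Xᶜ x y) := by
    ext; simp
  refine Set.ncard_le_ncard_of_injOn
    (compOf G (X ∪ bags G r Xᶜ (firstMarks G t r Xᶜ x y))) ?_ ?_ (Set.toFinite _)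
  · intro v hv
    refine mem_components_iff.2 ⟨v, ?_, rfl⟩
    rintro (h | h)
    exacts [hv.2.2.1 h, hv.2.2.2.1 h]
  · intro u hu v hv huv
    have h1 : v ∈ compOf G (X ∪ bags G r Xᶜ (firstMarks G t r Xᶜ x y)) u :=
      huv ▸ mem_compOf_self _ _ _
    have h2 : u ∈ compOf G (X ∪ bags G r Xᶜ (firstMarks G t r Xᶜ x y)) v :=
      huv ▸ mem_compOf_self _ _ _
    simp only [compOf, hcompl, Set.mem_ofPred_eq] at h1 h2
    refine hr.1 hu.2.2.1 hv.2.2.1 (le_antisymm ?_ ?_)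
    · exact not_lt.1 fun h => hu.2.2.2.2.2 v h1 h hv.2.2.2.2.1
    · exact not_lt.1 fun h => hv.2.2.2.2.2 u h2 h hu.2.2.2.2.1

theorem ncard_pair_marks_le (hr : GoodOrder G Xᶜ r) (hlink : IsLinked G t X) (hx : x ∈ X)
    (hy : y ∈ X) (hxy : x ≠ y)
    (hred : ∀ v, ¬ Reducible G t (X ∪ bags G r Xᶜ (firstMarks G t r Xᶜ x y)) v) :
    (firstMarks G t r Xᶜ x y ∪ secondMarks G t r Xᶜ x y).ncard ≤
      3 * t + 3 + boundC t (X.ncard + 3 * t + 3) := by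
  have h0 := Set.ncard_union_le (firstMarks G t r Xᶜ x y) (secondMarks G t r Xᶜ x y)
  have h1 := ncard_firstMarks_le hr hlink hx hy hxy
  by_cases hlim : t + 2 ≤ (firstMarks G t r Xᶜ x y).ncard
  · have h2 : secondMarks G t r Xᶜ x y = ∅ := by
      rw [Set.eq_empty_iff_forall_notMem]
      exact fun v hv => hv.2.1 hlim
    rw [h2, Set.ncard_empty] at h0
    rw [h2]
    omega
  -- Below the limit there are at most `t + 1` first marks, whose bags have at most `3 * t + 3`
  -- vertices; this is the argument of `boundC`.
  · have h2 := ncard_secondMarks_le (t := t) (x := x) (y := y) hr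
    have h3 := ncard_components_le hred
    have h4 := ncard_bags_le hr (firstMarks_subset (G := G) (t := t) (r := r) (x := x) (y := y))
    have h5 := Set.ncard_union_le X (bags G r Xᶜ (firstMarks G t r Xᶜ x y))
    have h6 : boundC t (X ∪ bags G r Xᶜ (firstMarks G t r Xᶜ x y)).ncard ≤
        boundC t (X.ncard + 3 * t + 3) := boundC_mono (by omega)
    omega

theorem ncard_marks_le (hr : GoodOrder G Xᶜ r) (hlink : IsLinked G t X)
    (hred : ∀ x y v, ¬ Reducible G t (X ∪ bags G r Xᶜ (firstMarks G t r Xᶜ x y)) v) :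
    (marks G t r Xᶜ X).ncard ≤
      X.ncard.choose 2 * (3 * t + 3 + boundC t (X.ncard + 3 * t + 3)) := by
  classical
  let F : Finset (Fin n) → Finset (Fin n) := fun τ => Finset.univ.filter fun v =>
    ∃ x y, x < y ∧ τ = {x, y} ∧ v ∈ firstMarks G t r Xᶜ x y ∪ secondMarks G t r Xᶜ x y
  have hsub : marks G t r Xᶜ X ⊆ ((X.toFinite.toFinset.powersetCard 2).biUnion F : Finset (Fin n)) := by
    rintro v ⟨x, y, hx, hy, hxy, hv⟩
    refine Finset.mem_coe.2 (Finset.mem_biUnion.2 ⟨{x, y}, Finset.mem_powersetCard.2 ⟨?_, ?_⟩, ?_⟩)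
    · intro z hz
      simp only [Finset.mem_insert, Finset.mem_singleton] at hz
      rcases hz with rfl | rfl <;> simp [hx, hy]
    · exact Finset.card_pair hxy.ne
    · exact Finset.mem_filter.2 ⟨Finset.mem_univ _, x, y, hxy, rfl, hv⟩
  refine (Set.ncard_le_ncard hsub (Set.toFinite _)).trans ?_
  rw [Set.ncard_coe_finset]
  have hcard : (X.toFinite.toFinset.powersetCard 2).card = X.ncard.choose 2 := by
    rw [Finset.card_powersetCard, ← Set.ncard_eq_toFinset_card]
  rw [← hcard]
  refine Finset.card_biUnion_le_card_mul _ _ _ fun τ hτ => ?_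
  obtain ⟨hτX, hτ2⟩ := Finset.mem_powersetCard.1 hτ
  obtain ⟨x, y, hxy, hτxy⟩ : ∃ x y, x < y ∧ τ = {x, y} := by
    obtain ⟨a, b, hab, h⟩ := Finset.card_eq_two.1 hτ2
    rcases lt_or_gt_of_ne hab with h' | h'
    · exact ⟨a, b, h', h⟩
    · exact ⟨b, a, h', by rw [h, Finset.pair_comm]⟩
  have hxX : x ∈ X := by simpa using hτX (hτxy ▸ Finset.mem_insert_self x {y})
  have hyX : y ∈ X := by
    simpa using hτX (hτxy ▸ Finset.mem_insert_of_mem (Finset.mem_singleton_self y))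
  refine le_trans ?_ (ncard_pair_marks_le hr hlink hxX hyX hxy.ne (hred x y))
  rw [← Set.ncard_coe_finset]
  refine Set.ncard_le_ncard ?_ (Set.toFinite _)
  intro v hv
  obtain ⟨-, a, b, hab, hτab, hv⟩ := Finset.mem_filter.1 (Finset.mem_coe.1 hv)
  have h : ({x, y} : Finset (Fin n)) = {a, b} := hτxy.symm.trans hτab
  have ha : a ∈ ({x, y} : Finset (Fin n)) := h ▸ Finset.mem_insert_self a {b}
  have hb : b ∈ ({x, y} : Finset (Fin n)) :=
    h ▸ Finset.mem_insert_of_mem (Finset.mem_singleton_self b)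
  simp only [Finset.mem_insert, Finset.mem_singleton] at ha hb
  rcases ha with rfl | rfl <;> rcases hb with rfl | rfl
  · exact absurd hab (lt_irrefl _)
  · exact hv
  · exact absurd (hab.trans hxy) (lt_irrefl _)
  · exact absurd hab (lt_irrefl _)

/-- Outside the bags of the marks of `x`, `y`, a component that sees both is hit by
every solution in `x` or `y`. -/
theorem no_solution_avoids_pair (hX : GoodOrder G Xᶜ r) (hC : ConnSet G C) (hCX : C ⊆ Xᶜ)
    (hCY : Disjoint C (bags G r Xᶜ (firstMarks G t r Xᶜ x y ∪ secondMarks G t r Xᶜ x y)))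
    (hx : x ∈ X) (hy : y ∈ X) (hxy : x ≠ y) (hxC : Sees G C x) (hyC : Sees G C y)
    (hS : TW G (Cᶜ \ S)) (hSt : S.ncard ≤ t) (hxS : x ∉ S) (hyS : y ∉ S) : False := by
  have hM1 : Disjoint C (bags G r Xᶜ (firstMarks G t r Xᶜ x y)) :=
    hCY.mono_right (bags_mono Set.subset_union_left)
  have hMA : firstMarks G t r Xᶜ x y ⊆ Xᶜ := firstMarks_subset
  by_cases hlim : G.Adj x y ∧ t + 2 ≤ (firstMarks G t r Xᶜ x y).ncard
  · obtain ⟨⟨H, hH⟩, -, -⟩ := stage_markStep_inv (t := t) (x := x) (y := y) hX n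
    change ∀ m ∈ firstMarks G t r Xᶜ x y, _ at hH
    have hrne : ∀ m ∈ firstMarks G t r Xᶜ x y, ∀ m' ∈ firstMarks G t r Xᶜ x y, m ≠ m' →
        r m < r m' ∨ r m' < r m := fun m hm m' hm' hne =>
      lt_or_gt_of_ne fun h => hne (hX.1 (hMA hm) (hMA hm') h)
    have hdisj : ∀ m ∈ firstMarks G t r Xᶜ x y, ∀ m' ∈ firstMarks G t r Xᶜ x y, m ≠ m' →
        Disjoint (H m) (H m') := by
      intro m hm m' hm' hne
      rcases hrne m hm m' hm' hne with h | h
      · exact (((hH m hm).2.2.2 m' hm' h).mono_right (hH m hm).2.2.1).symm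
      · exact ((hH m' hm').2.2.2 m hm h).mono_right (hH m' hm').2.2.1
    -- For marks `m` before `m'`, `C` avoids the bag of `m`. If it lies below `m`, it misses the
    -- later set `H m'`; if beside, it misses `H m`.
    have hCone : {m | m ∈ firstMarks G t r Xᶜ x y ∧ ¬ Disjoint (H m) C}.ncard ≤ 1 := by
      rw [Set.ncard_le_one (Set.toFinite _)]
      have aux : ∀ m ∈ firstMarks G t r Xᶜ x y, ∀ m' ∈ firstMarks G t r Xᶜ x y,
          ¬ Disjoint (H m) C → ¬ Disjoint (H m') C → ¬ r m < r m' := by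
        intro m hm m' hm' hmC hmC' hlt
        have hCm : Disjoint C (bag G r Xᶜ m) := hM1.mono_right (bag_subset_bags hm)
        rcases hC.below_or_disjoint hCX hCm with h | h
        · exact hmC' (((hH m hm).2.2.2 m' hm' hlt).mono_right h)
        · exact hmC (h.symm.mono_left (hH m hm).2.2.1)
      intro m hm m' hm'
      by_contra hne
      rcases hrne m hm.1 m' hm'.1 hne with h | h
      · exact aux m hm.1 m' hm'.1 hm.2 hm'.2 h
      · exact aux m' hm'.1 m hm.1 hm'.2 hm.2 h
    have hSle : {m | m ∈ firstMarks G t r Xᶜ x y ∧ ¬ Disjoint (H m) S}.ncard ≤ S.ncard := by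
      have hch : ∀ m, ∃ s, ¬ Disjoint (H m) S → s ∈ H m ∧ s ∈ S := by
        intro m
        by_cases h : Disjoint (H m) S
        · exact ⟨m, fun h' => absurd h h'⟩
        · obtain ⟨s, hs⟩ := Set.not_disjoint_iff.1 h
          exact ⟨s, fun _ => hs⟩
      choose s hs using hch
      refine Set.ncard_le_ncard_of_injOn s (fun m hm => (hs m hm.2).2) ?_ (Set.toFinite _)
      intro a ha b hb hab
      by_contra hne
      refine Set.disjoint_left.1 (hdisj a ha.1 b hb.1 hne) (hs a ha.2).1 ?_
      rw [hab]
      exact (hs b hb.2).1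
    -- At least `t + 2` bad sets, of which at most one meets `C` and at most `t` meet `S`. A bad set
    -- that remains contradicts the treewidth of `G - C - S`, which contains `x` and `y`.
    obtain ⟨m, hm, hmC, hmS⟩ : ∃ m ∈ firstMarks G t r Xᶜ x y, Disjoint (H m) C ∧ Disjoint (H m) S := by
      by_contra hcon
      push Not at hcon
      have hsub : firstMarks G t r Xᶜ x y ⊆
          {m | m ∈ firstMarks G t r Xᶜ x y ∧ ¬ Disjoint (H m) C} ∪
          {m | m ∈ firstMarks G t r Xᶜ x y ∧ ¬ Disjoint (H m) S} := by
        intro m hm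
        by_cases h : Disjoint (H m) C
        · exact Or.inr ⟨hm, hcon m hm h⟩
        · exact Or.inl ⟨hm, h⟩
      have h1 := Set.ncard_le_ncard hsub (Set.toFinite _)
      have h2 := Set.ncard_union_le {m | m ∈ firstMarks G t r Xᶜ x y ∧ ¬ Disjoint (H m) C}
          {m | m ∈ firstMarks G t r Xᶜ x y ∧ ¬ Disjoint (H m) S}
      omega
    refine (hH m hm).2.1.2 hlim.1 (hS.mono_set ?_)
    rintro z (hz | rfl | rfl)
    · exact ⟨Set.disjoint_left.1 hmC hz, Set.disjoint_left.1 hmS hz⟩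
    · exact ⟨fun h => hCX h hx, hxS⟩
    · exact ⟨fun h => hCX h hy, hyS⟩
  -- Now no bad set is left, and a component `C` that sees both vertices cannot exist at all: it
  -- would give a `K₄` minor in a part of treewidth two.
  · have hnb := fun v hv hvM => not_bad_of_firstMarks (v := v) hlim hv hvM
    obtain ⟨c, hc, hcmax⟩ := Set.exists_max_rank r (B := C) (let ⟨z, hz, _⟩ := hxC; ⟨z, hz⟩)
    have hcM := Set.disjoint_left.1 hM1 hc
    have hCsub := hC.subset_sub hCX hM1 hc hcmax
    have hjc : Joins G x y (sub G r Xᶜ (firstMarks G t r Xᶜ x y) c) :=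
      Joins.mono ⟨hxC, hyC⟩ hCsub
    have hadj : G.Adj x y := by
      by_contra hadj
      exact hnb c (hCX hc) hcM ⟨hjc, fun h => absurd h hadj⟩
    have hcard : ¬ t + 2 ≤ (firstMarks G t r Xᶜ x y).ncard := fun h => hlim ⟨hadj, h⟩
    set E := Xᶜ \ bags G r Xᶜ (firstMarks G t r Xᶜ x y) with hE
    set D : Set (Fin n) := {w | Reach G E c w} with hD
    have hcE : c ∈ E := ⟨hCX hc, hcM⟩
    have hDE : D ⊆ E := Reach.subset hcE
    have hDconn : ConnSet G D := connSet_reach _ _ _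
    have hCD : C ⊆ D := hC.subset_reach (fun z hz => ⟨hCX hz, Set.disjoint_left.1 hM1 hz⟩) hc
    obtain ⟨d, hd, hdmax⟩ := Set.exists_max_rank r (B := D) ⟨c, Reach.refl _ _ _⟩
    have hDsub : D ⊆ sub G r Xᶜ (firstMarks G t r Xᶜ x y) d :=
      hDconn.subset_sub (fun z hz => (hDE hz).1)
        (Set.disjoint_left.2 fun z hz hz' => (hDE hz).2 hz') hd hdmax
    -- `D` is the component around `C` after the first marks. It joins `x` and `y` and lies in the
    -- remaining subtree of its last vertex `d`, so otherwise that subtree would be bad.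
    have hTW : TW G (D ∪ {x, y}) := by
      by_contra hcon
      refine hnb d (hDE hd).1 (hDE hd).2 (Bad.mono ⟨?_, fun _ => hcon⟩ hDsub)
      exact Joins.mono ⟨hxC, hyC⟩ hCD
    obtain ⟨u, ⟨huD, huj⟩, humin⟩ := Set.exists_min_image
      {u | u ∈ D ∧ Joins G x y (sub G r Xᶜ (firstMarks G t r Xᶜ x y) u)} r (Set.toFinite _)
      ⟨c, Reach.refl _ _ _, hjc⟩
    have huE := hDE huD
    have hu2 : u ∈ secondMarks G t r Xᶜ x y :=
      ⟨hadj, hcard, huE.1, huE.2, huj, fun w hw hlt hj =>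
        absurd (humin w ⟨Reach.trans huD hw, hj⟩) (not_le.2 hlt)⟩
    have hCu : Disjoint C (bag G r Xᶜ u) := hCY.mono_right (bag_subset_bags (Or.inr hu2))
    -- `C` avoids the bag of the second mark `u`. It is not below `u`, because the subtree of its
    -- last vertex `c` also joins `x` and `y` while `u` is the lowest such node.
    have hCT : Disjoint C (Tr G r Xᶜ u) := by
      refine (hC.below_or_disjoint hCX hCu).resolve_left fun h => ?_
      have h1 := (Tr_subset_Dn huE.1 (h hc)).2
      have h2 := humin c ⟨Reach.refl _ _ _, hjc⟩
      have := hX.1 (hCX hc) huE.1 (le_antisymm h1 h2)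
      exact Set.disjoint_left.1 hCu hc (Or.inl this)
    set H := sub G r Xᶜ (firstMarks G t r Xᶜ x y) u with hH
    have hHC : Disjoint H C := (hCT.mono_right sub_subset_Tr).symm
    have hHE : H ⊆ E := fun z hz => ⟨(sub_subset huE.1 huE.2 hz).1.1, (sub_subset huE.1 huE.2 hz).2⟩
    have hHD : H ⊆ D := fun z hz => Reach.trans huD (connSet_sub.subset_reach hHE self_mem_sub hz)
    -- The subtree `H` of `u` need not touch `C`, so it is enlarged to a component of `D \ C`, which
    -- does since `D` is connected. The minor consists of `{x}`, `{y}`, `B` and `C`.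
    set B : Set (Fin n) := {w | Reach G (D \ C) u w} with hB
    have huDC : u ∈ D \ C := ⟨huD, Set.disjoint_left.1 hHC self_mem_sub⟩
    have hBDC : B ⊆ D \ C := Reach.subset huDC
    have hHB : H ⊆ B := connSet_sub.subset_reach
      (fun z hz => ⟨hHD hz, Set.disjoint_left.1 hHC hz⟩) self_mem_sub
    have hBC : SetAdj G B C := by
      obtain ⟨w, hw, hwB, z, hz, hzw⟩ := hDconn.meets_openNbhd (T := B) huD (Reach.refl _ _ _)
        (hCD hc) (fun h => (hBDC h).2 hc)
      refine ⟨z, hz, w, ?_, hzw⟩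
      by_contra hwC
      exact hwB (Reach.step hz hzw ⟨hw, hwC⟩)
    have hDX : ∀ z ∈ X, z ∉ D := fun z hz hzD => (hDE hzD).1 hz
    obtain ⟨⟨a, ha, hax⟩, b, hb, hby⟩ := huj
    obtain ⟨a', ha', hax'⟩ := hxC
    obtain ⟨b', hb', hby'⟩ := hyC
    exact hTW.no_K4' (B₁ := {x}) (B₂ := {y}) (B₃ := B) (B₄ := C)
      (by simp) (by simp) (fun z hz => Or.inl (hBDC hz).1) (fun z hz => Or.inl (hCD hz))
      (connSet_singleton _ _) (connSet_singleton _ _) (connSet_reach _ _ _) hC (by simpa using hxy)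
      (Set.disjoint_singleton_left.2 fun h => hDX x hx (hBDC h).1)
      (Set.disjoint_singleton_left.2 fun h => hDX x hx (hCD h))
      (Set.disjoint_singleton_left.2 fun h => hDX y hy (hBDC h).1)
      (Set.disjoint_singleton_left.2 fun h => hDX y hy (hCD h))
      (Set.disjoint_left.2 fun z hz hz' => (hBDC hz).2 hz')
      ⟨x, rfl, y, rfl, hadj⟩ ⟨x, rfl, a, hHB ha, hax.symm⟩ ⟨x, rfl, a', ha', hax'.symm⟩
      ⟨y, rfl, b, hHB hb, hby.symm⟩ ⟨y, rfl, b', hb', hby'.symm⟩ hBC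

end Marking

/-! ## Definability on the random access machine -/

namespace RAM

@[simp] theorem State.setVar_var (s : State) (x c y : ℕ) :
    (s.setVar x c).var y = if y = x then c else s.var y := by
  simp [State.setVar, Function.update_apply]

@[simp] theorem State.setVar_arr (s : State) (x c : ℕ) : (s.setVar x c).arr = s.arr := rfl

@[simp] theorem State.setArr_var (s : State) (a i c : ℕ) : (s.setArr a i c).var = s.var := rfl

theorem State.setArr_arr_of_ne (s : State) {a a' : ℕ} (i c : ℕ) (h : a' ≠ a) :
    (s.setArr a i c).arr a' = s.arr a' := by
  simp [State.setArr, h]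

@[simp] theorem State.setArr_arr_self (s : State) (a i c j : ℕ) :
    (s.setArr a i c).arr a j = if j = i then c else s.arr a j := by
  simp [State.setArr, Function.update_apply]

/-- Started in `s`, the program halts within `K` steps in a state that satisfies `P`. -/
def Exec (p : Prog) (K : ℕ) (s : State) (P : State → Prop) : Prop :=
  ∃ k s', Run p s k s' ∧ k ≤ K ∧ P s'

variable {p q : Prog} {K L N : ℕ} {s : State} {P Q : State → Prop}

theorem Exec.mono (h : Exec p K s P) (hK : K ≤ L) (hP : ∀ s', P s' → Q s') : Exec p L s Q :=
  let ⟨k, s', hr, hk, hs⟩ := h; ⟨k, s', hr, hk.trans hK, hP _ hs⟩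

theorem Exec.imp (h : Exec p K s P) (hP : ∀ s', P s' → Q s') : Exec p K s Q := h.mono le_rfl hP

theorem Exec.seq (h : Exec p K s P) (h' : ∀ s', P s' → Exec q L s' Q) :
    Exec (.seq p q) (K + L) s Q := by
  obtain ⟨k, s', hr, hk, hs⟩ := h
  obtain ⟨l, s'', hr', hl, hs'⟩ := h' s' hs
  exact ⟨k + l, s'', hr.seq hr', Nat.add_le_add hk hl, hs'⟩

theorem Exec.nop (h : P s) : Exec .nop 1 s P := ⟨1, s, .nop s, le_rfl, h⟩

theorem Exec.assign {x : ℕ} {e : Term} (h : P (s.setVar x (e.eval s))) :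
    Exec (.assign x e) (e.cost + 1) s P := ⟨_, _, .assign x e s, le_rfl, h⟩

theorem Exec.put {a : ℕ} {e₁ e₂ : Term} (h : P (s.setArr a (e₁.eval s) (e₂.eval s))) :
    Exec (.put a e₁ e₂) (e₁.cost + e₂.cost + 1) s P := ⟨_, _, .put a e₁ e₂ s, le_rfl, h⟩

theorem Exec.branch {e : Term} (h₁ : e.eval s ≠ 0 → Exec p K s P)
    (h₂ : e.eval s = 0 → Exec q K s P) : Exec (.branch e p q) (e.cost + 1 + K) s P := by
  by_cases h : e.eval s = 0
  · obtain ⟨k, s', hr, hk, hs⟩ := h₂ h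
    exact ⟨_, s', .branch_false h hr, Nat.add_le_add_left hk _, hs⟩
  · obtain ⟨k, s', hr, hk, hs⟩ := h₁ h
    exact ⟨_, s', .branch_true h hr, Nat.add_le_add_left hk _, hs⟩

/-- Run `p` with the variable `c` counting down to `0`. -/
def forDown (c : ℕ) (p : Prog) : Prog :=
  .loop (.var c) (.seq (.assign c (.sub (.var c) (.const 1))) p)

/-- The counter is decremented before the body runs, so the body sees `N - 1, …, 0`. A round costs
two steps for the test and four for the decrement besides the body; the last test costs two. -/
theorem Exec.forDown {c : ℕ} {Inv : ℕ → State → Prop} {s : State} (h0 : Inv N s)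
    (hc : s.var c = N)
    (hbody : ∀ i s, i < N → Inv (i + 1) s → s.var c = i + 1 →
      Exec p K (s.setVar c i) fun s' => Inv i s' ∧ s'.var c = i) :
    Exec (forDown c p) (N * (K + 6) + 2) s fun s' => Inv 0 s' ∧ s'.var c = 0 := by
  induction N generalizing s with
  | zero => exact ⟨_, s, .loop_false hc, by simp [Term.cost], h0, hc⟩
  | succ N ih =>
    obtain ⟨k, s₁, hr, hk, hs₁, hc₁⟩ := hbody N s (Nat.lt_succ_self N) h0 hc
    obtain ⟨l, s₂, hr', hl, hs₂⟩ := ih hs₁ hc₁ fun i s hi => hbody i s (Nat.lt_succ_of_lt hi)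
    have h1 : Run (.assign c (.sub (.var c) (.const 1))) s 4 (s.setVar c N) := by
      have := Run.assign c (.sub (.var c) (.const 1)) s
      simpa [Term.cost, Term.eval, hc] using this
    have hne : (Term.var c).eval s ≠ 0 := by simp [Term.eval, hc]
    refine ⟨_, s₂, .loop_true hne (h1.seq hr) hr', ?_, hs₂⟩
    simp only [Term.cost]
    rw [Nat.add_mul]
    omega

end RAM

open RAM

/-- An input `(G, t, X)` with vertex set `Fin n`. -/
structure Inst (n : ℕ) where
  G : SimpleGraph (Fin n)
  t : ℕ
  X : Set (Fin n)

open Classical in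
/-- The truth value of a proposition as a number. -/
noncomputable def ind (p : Prop) : ℕ := if p then 1 else 0

theorem ind_true {p : Prop} (h : p) : ind p = 1 := if_pos h

theorem ind_false {p : Prop} (h : ¬ p) : ind p = 0 := if_neg h

/-- The memory holds the input. -/
def HoldsInput {n : ℕ} (I : Inst n) (s : State) : Prop :=
  s.var 0 = n ∧ s.var 1 = I.t ∧ (∀ i j : Fin n, s.arr 0 (i * n + j) = ind (I.G.Adj i j)) ∧
    ∀ i : Fin n, s.arr 1 i = ind (i ∈ I.X)

/-- The states agree on the variables and arrays below `b`. -/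
def Agree (b : ℕ) (s s' : State) : Prop :=
  (∀ x < b, s'.var x = s.var x) ∧ ∀ a < b, s'.arr a = s.arr a

theorem Agree.refl (b : ℕ) (s : State) : Agree b s s := ⟨fun _ _ => rfl, fun _ _ => rfl⟩

theorem Agree.trans {b : ℕ} {s s' s'' : State} (h : Agree b s s') (h' : Agree b s' s'') :
    Agree b s s'' :=
  ⟨fun x hx => (h'.1 x hx).trans (h.1 x hx), fun a ha => (h'.2 a ha).trans (h.2 a ha)⟩

theorem Agree.mono {b c : ℕ} {s s' : State} (h : Agree c s s') (hbc : b ≤ c) : Agree b s s' :=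
  ⟨fun x hx => h.1 x (hx.trans_le hbc), fun a ha => h.2 a (ha.trans_le hbc)⟩

theorem Agree.setVar {b : ℕ} {s s' : State} (h : Agree b s s') {x : ℕ} (hx : b ≤ x) (c : ℕ) :
    Agree b s (s'.setVar x c) := by
  refine ⟨fun y hy => ?_, h.2⟩
  rw [State.setVar_var, if_neg (by omega)]
  exact h.1 y hy

theorem Agree.setArr {b : ℕ} {s s' : State} (h : Agree b s s') {a : ℕ} (ha : b ≤ a) (i c : ℕ) :
    Agree b s (s'.setArr a i c) := by
  refine ⟨h.1, fun a' ha' => ?_⟩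
  rw [State.setArr_arr_of_ne _ _ _ (by omega)]
  exact h.2 a' ha'

/-- The memory holds the input, the values of the vertex variables and those of the set
variables. -/
def Layout (ρ σ : ℕ → ℕ) {n : ℕ} (I : Inst n) (e : ℕ → Fin n) (S : ℕ → Set (Fin n))
    (s : State) : Prop :=
  HoldsInput I s ∧ (∀ i, s.var (ρ i) = e i) ∧ ∀ j (x : Fin n), s.arr (σ j) x = ind (x ∈ S j)

theorem Layout.agree {ρ σ : ℕ → ℕ} {n b : ℕ} {I : Inst n} {e : ℕ → Fin n} {S : ℕ → Set (Fin n)}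
    {s s' : State} (h : Layout ρ σ I e S s) (hb : 4 ≤ b) (hρ : ∀ i, ρ i < b) (hσ : ∀ j, σ j < b)
    (hs : Agree b s s') : Layout ρ σ I e S s' := by
  obtain ⟨⟨h1, h2, h3, h4⟩, h5, h6⟩ := h
  refine ⟨⟨?_, ?_, fun i j => ?_, fun i => ?_⟩, fun i => ?_, fun j x => ?_⟩
  · rw [hs.1 0 (by omega), h1]
  · rw [hs.1 1 (by omega), h2]
  · rw [hs.2 0 (by omega), h3]
  · rw [hs.2 1 (by omega), h4]
  · rw [hs.1 _ (hρ i), h5]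
  · rw [hs.2 _ (hσ j), h6]

/-- Prepend a value to a sequence. -/
def scons {α : Type*} (a : α) (f : ℕ → α) : ℕ → α
  | 0 => a
  | i + 1 => f i

theorem scons_lt {a b : ℕ} {f : ℕ → ℕ} (ha : a < b) (hf : ∀ i, f i < b) : ∀ i, scons a f i < b
  | 0 => ha
  | i + 1 => hf i

/-- A family of numbers that depend on an input, on vertices and on vertex sets. -/
abbrev Family := ∀ n : ℕ, Inst n → (ℕ → Fin n) → (ℕ → Set (Fin n)) → ℕ

/-- The numbers `f` can be computed in polynomial time. -/
def Comp (f : Family) : Prop :=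
  ∀ (ρ σ : ℕ → ℕ) (b : ℕ), (∀ i, ρ i < b) → (∀ j, σ j < b) → 4 ≤ b →
    ∃ (p : Prog) (q : Polynomial ℕ), ∀ (n : ℕ) (I : Inst n) (e : ℕ → Fin n) (S : ℕ → Set (Fin n))
      (s : State), Layout ρ σ I e S s →
        Exec p (q.eval n) s fun s' => s'.var b = f n I e S ∧ Agree b s s'

/-- The property `P` can be decided in polynomial time. -/
def Def (P : ∀ n : ℕ, Inst n → (ℕ → Fin n) → (ℕ → Set (Fin n)) → Prop) : Prop :=
  Comp fun n I e S => ind (P n I e S)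

namespace Comp

variable {f g : Family}

theorem congr (hf : Comp f) (h : ∀ n I e S, f n I e S = g n I e S) : Comp g := by
  have : f = g := by
    funext n I e S
    exact h n I e S
  exact this ▸ hf

/-- `Comp` quantifies over the addresses `ρ`, `σ` of the variables, so renaming variables amounts to
composing addresses and costs nothing. -/
theorem subst (hf : Comp f) (φ ψ : ℕ → ℕ) :
    Comp fun n I e S => f n I (fun i => e (φ i)) (fun j => S (ψ j)) := by
  intro ρ σ b hρ hσ hb
  obtain ⟨p, q, h⟩ := hf (fun i => ρ (φ i)) (fun j => σ (ψ j)) b (fun i => hρ _) (fun j => hσ _) hb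
  exact ⟨p, q, fun n I e S s hs => h n I _ _ s ⟨hs.1, fun i => hs.2.1 _, fun j => hs.2.2 _⟩⟩

theorem of_term (T : (ℕ → ℕ) → (ℕ → ℕ) → Term)
    (h : ∀ ρ σ n (I : Inst n) e S s, Layout ρ σ I e S s → (T ρ σ).eval s = f n I e S) : Comp f := by
  intro ρ σ b hρ hσ hb
  refine ⟨.assign b (T ρ σ), Polynomial.C ((T ρ σ).cost + 1), fun n I e S s hs => ?_⟩
  rw [Polynomial.eval_C]
  refine Exec.assign ⟨?_, (Agree.refl b s).setVar le_rfl _⟩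
  rw [State.setVar_var, if_pos rfl, h ρ σ n I e S s hs]

theorem const (c : ℕ) : Comp fun _ _ _ _ => c :=
  of_term (fun _ _ => .const c) fun _ _ _ _ _ _ _ _ => rfl

theorem size : Comp fun n _ _ _ => n :=
  of_term (fun _ _ => .var 0) fun _ _ _ _ _ _ _ hs => hs.1.1

theorem budget : Comp fun _ I _ _ => I.t :=
  of_term (fun _ _ => .var 1) fun _ _ _ _ _ _ _ hs => hs.1.2.1

theorem idx (i : ℕ) : Comp fun _ _ e _ => (e i : ℕ) :=
  of_term (fun ρ _ => .var (ρ i)) fun _ _ _ _ _ _ _ hs => hs.2.1 i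

/-- The second value is computed with scratch memory from `b + 1` on, which protects the first one
in cell `b`. -/
theorem op (hf : Comp f) (hg : Comp g) (T : Term → Term → Term) (F : ℕ → ℕ → ℕ)
    (hT : ∀ a b s, (T (.var a) (.var b)).eval s = F (s.var a) (s.var b)) :
    Comp fun n I e S => F (f n I e S) (g n I e S) := by
  intro ρ σ b hρ hσ hb
  obtain ⟨p, q, h⟩ := hf ρ σ b hρ hσ hb
  obtain ⟨p', q', h'⟩ := hg ρ σ (b + 1) (fun i => (hρ i).trans (Nat.lt_succ_self b))
    (fun j => (hσ j).trans (Nat.lt_succ_self b)) (by omega)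
  refine ⟨.seq p (.seq p' (.assign b (T (.var b) (.var (b + 1))))),
    q + (q' + Polynomial.C ((T (.var b) (.var (b + 1))).cost + 1)), fun n I e S s hs => ?_⟩
  simp only [Polynomial.eval_add, Polynomial.eval_C]
  refine (h n I e S s hs).seq fun s₁ hs₁ => ?_
  refine (h' n I e S s₁ (hs.agree hb hρ hσ hs₁.2)).seq fun s₂ hs₂ => ?_
  refine Exec.assign ⟨?_, (hs₁.2.trans (hs₂.2.mono (Nat.le_succ b))).setVar le_rfl _⟩
  rw [State.setVar_var, if_pos rfl, hT, hs₂.1, hs₂.2.1 b (Nat.lt_succ_self b), hs₁.1]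

theorem add (hf : Comp f) (hg : Comp g) : Comp fun n I e S => f n I e S + g n I e S :=
  hf.op hg .add (· + ·) fun _ _ _ => rfl

theorem sub (hf : Comp f) (hg : Comp g) : Comp fun n I e S => f n I e S - g n I e S :=
  hf.op hg .sub (· - ·) fun _ _ _ => rfl

/-- Sums over all vertices. -/
theorem sum {f : ∀ n : ℕ, Inst n → (ℕ → Fin n) → (ℕ → Set (Fin n)) → Fin n → ℕ}
    (hf : Comp fun n I e S => f n I (fun i => e (i + 1)) S (e 0)) :
    Comp fun n I e S => ∑ x, f n I e S x := by
  intro ρ σ b hρ hσ hb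
  have hρ' : ∀ i, scons (b + 1) ρ i < b + 2 :=
    scons_lt (by omega) fun i => (hρ i).trans (by omega)
  obtain ⟨p, q, h⟩ := hf (scons (b + 1) ρ) σ (b + 2) hρ'
    (fun j => (hσ j).trans (by omega)) (by omega)
  refine ⟨.seq (.assign b (.const 0)) (.seq (.assign (b + 1) (.var 0))
    (forDown (b + 1) (.seq p (.assign b (.add (.var b) (.var (b + 2))))))),
    Polynomial.C 2 + (Polynomial.C 2 + (Polynomial.X * (q + Polynomial.C 4 + Polynomial.C 6) + Polynomial.C 2)),
    fun n I e S s hs => ?_⟩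
  simp only [Polynomial.eval_add, Polynomial.eval_C, Polynomial.eval_mul, Polynomial.eval_X]
  set F : ℕ → ℕ := fun i => if hi : i < n then f n I e S ⟨i, hi⟩ else 0 with hF
  refine (Exec.assign (P := fun s' => s'.var b = 0 ∧ Agree b s s')
    ⟨by simp [Term.eval], (Agree.refl b s).setVar le_rfl _⟩).seq fun s₁ hs₁ => ?_
  refine (Exec.assign (P := fun s' => (s'.var b = 0 ∧ Agree b s s') ∧ s'.var (b + 1) = n)
    ⟨⟨by simp [hs₁.1], hs₁.2.setVar (Nat.le_succ b) _⟩, ?_⟩).seq fun s₂ hs₂ => ?_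
  · simp [Term.eval, hs₁.2.1 0 (by omega), hs.1.1]
  refine (Exec.forDown (Inv := fun i s' => s'.var b = ∑ j ∈ Finset.Ico i n, F j ∧ Agree b s s')
    (s := s₂) (N := n) (by simpa using hs₂.1) hs₂.2 fun i s₃ hi hs₃ hc => ?_).imp fun s' hs' => ?_
  · have hag : Agree b s (s₃.setVar (b + 1) i) := hs₃.2.setVar (Nat.le_succ b) _
    have hlay : Layout (scons (b + 1) ρ) σ I (scons (⟨i, hi⟩ : Fin n) e) S (s₃.setVar (b + 1) i) := by
      have hl := hs.agree hb hρ hσ hag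
      refine ⟨hl.1, ?_, hl.2.2⟩
      rintro (_ | k)
      · simp [scons]
      · exact hl.2.1 k
    refine ((h n I _ S _ hlay).seq fun s₄ hs₄ => ?_)
    refine Exec.assign ⟨⟨?_, ?_⟩, ?_⟩
    · rw [State.setVar_var, if_pos rfl]
      simp only [Term.eval]
      rw [hs₄.1, hs₄.2.1 b (by omega), State.setVar_var, if_neg (by omega), hs₃.1,
        Finset.sum_eq_sum_Ico_succ_bot hi, add_comm]
      simp [hF, hi, scons]
    · exact (hag.trans (hs₄.2.mono (by omega))).setVar le_rfl _
    · rw [State.setVar_var, if_neg (by omega), hs₄.2.1 (b + 1) (by omega), State.setVar_var,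
        if_pos rfl]
  · refine ⟨?_, hs'.1.2⟩
    rw [hs'.1.1, ← Finset.range_eq_Ico, Finset.sum_range]
    simp [hF]

end Comp

namespace Def

variable {P Q : ∀ n : ℕ, Inst n → (ℕ → Fin n) → (ℕ → Set (Fin n)) → Prop}
  {R : ∀ n : ℕ, Inst n → (ℕ → Fin n) → (ℕ → Set (Fin n)) → Fin n → Prop} {f g : Family}

theorem congr (hP : Def P) (h : ∀ n I e S, P n I e S ↔ Q n I e S) : Def Q :=
  Comp.congr hP fun n I e S => by rw [h]

theorem subst (hP : Def P) (φ ψ : ℕ → ℕ) :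
    Def fun n I e S => P n I (fun i => e (φ i)) (fun j => S (ψ j)) :=
  Comp.subst hP φ ψ

theorem mem (i j : ℕ) : Def fun _ _ e S => e i ∈ S j :=
  Comp.of_term (fun ρ σ => .get (σ j) (.var (ρ i))) fun ρ σ n I e S s hs => by
    simp only [Term.eval]
    rw [hs.2.1, hs.2.2]

theorem memX (i : ℕ) : Def fun _ I e _ => e i ∈ I.X :=
  Comp.of_term (fun ρ _ => .get 1 (.var (ρ i))) fun ρ σ n I e S s hs => by
    simp only [Term.eval]
    rw [hs.2.1, hs.1.2.2.2]

theorem adj (i j : ℕ) : Def fun _ I e _ => I.G.Adj (e i) (e j) := by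
  intro ρ σ b hρ hσ hb
  refine ⟨.seq (.assign b (.const 0)) (.seq (.assign (b + 1) (.var 0))
    (.seq (forDown (b + 1) (.assign b (.add (.var b) (.var (ρ i)))))
      (.assign b (.get 0 (.add (.var b) (.var (ρ j))))))),
    Polynomial.C 2 + (Polynomial.C 2 + ((Polynomial.X * Polynomial.C 10 + Polynomial.C 2) + Polynomial.C 5)),
    fun n I e S s hs => ?_⟩
  simp only [Polynomial.eval_add, Polynomial.eval_C, Polynomial.eval_mul, Polynomial.eval_X]
  refine (Exec.assign (P := fun s' => s'.var b = 0 ∧ Agree b s s')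
    ⟨by simp [Term.eval], (Agree.refl b s).setVar le_rfl _⟩).seq fun s₁ hs₁ => ?_
  refine (Exec.assign (P := fun s' => (s'.var b = 0 ∧ Agree b s s') ∧ s'.var (b + 1) = n)
    ⟨⟨by simp [hs₁.1], hs₁.2.setVar (Nat.le_succ b) _⟩, ?_⟩).seq fun s₂ hs₂ => ?_
  · simp [Term.eval, hs₁.2.1 0 (by omega), hs.1.1]
  -- The machine does not multiply; the row offset is obtained by adding the row number `n` times.
  refine ((Exec.forDown (K := 4) (Inv := fun k s' => s'.var b = (n - k) * e i ∧ Agree b s s')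
    (s := s₂) (N := n) (by simpa using hs₂.1) hs₂.2 fun k s₃ hk hs₃ hc => ?_)).seq fun s₄ hs₄ => ?_
  · have hag : Agree b s (s₃.setVar (b + 1) k) := hs₃.2.setVar (Nat.le_succ b) _
    refine Exec.assign (e := .add (.var b) (.var (ρ i))) ⟨⟨?_, hag.setVar le_rfl _⟩, ?_⟩
    · rw [State.setVar_var, if_pos rfl]
      simp only [Term.eval]
      rw [hag.1 _ (hρ i), hs.2.1, State.setVar_var, if_neg (by omega), hs₃.1,
        show n - k = n - (k + 1) + 1 by omega, Nat.add_mul, one_mul]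
    · simp
  · refine Exec.assign (e := .get 0 (.add (.var b) (.var (ρ j)))) ⟨?_, hs₄.1.2.setVar le_rfl _⟩
    rw [State.setVar_var, if_pos rfl]
    simp only [Term.eval]
    rw [hs₄.1.1, hs₄.1.2.1 _ (hρ j), hs.2.1, hs₄.1.2.2 0 (by omega), Nat.sub_zero, mul_comm,
      hs.1.2.2.1]

theorem not (hP : Def P) : Def fun n I e S => ¬ P n I e S :=
  Comp.congr ((Comp.const 1).sub hP) fun n I e S => by
    by_cases h : P n I e S
    · rw [ind_true h, ind_false (not_not.2 h)]
    · rw [ind_false h, ind_true h]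

theorem and (hP : Def P) (hQ : Def Q) : Def fun n I e S => P n I e S ∧ Q n I e S :=
  Comp.congr ((Comp.add hP hQ).sub (Comp.const 1)) fun n I e S => by
    by_cases h : P n I e S <;> by_cases h' : Q n I e S <;> simp [ind, h, h']

theorem or (hP : Def P) (hQ : Def Q) : Def fun n I e S => P n I e S ∨ Q n I e S :=
  (hP.not.and hQ.not).not.congr fun n I e S => by tauto

theorem imp (hP : Def P) (hQ : Def Q) : Def fun n I e S => P n I e S → Q n I e S :=
  (hP.and hQ.not).not.congr fun n I e S => by tauto

theorem le (hf : Comp f) (hg : Comp g) : Def fun n I e S => f n I e S ≤ g n I e S :=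
  Comp.congr ((Comp.const 1).sub (hf.sub hg)) fun n I e S => by
    by_cases h : f n I e S ≤ g n I e S
    · rw [ind_true h, Nat.sub_eq_zero_of_le h]
    · rw [ind_false h]; omega

theorem lt (hf : Comp f) (hg : Comp g) : Def fun n I e S => f n I e S < g n I e S :=
  (le hg hf).not.congr fun _ _ _ _ => not_le

theorem eq (i j : ℕ) : Def fun _ _ e _ => e i = e j :=
  ((le (Comp.idx i) (Comp.idx j)).and (le (Comp.idx j) (Comp.idx i))).congr fun n I e S => by
    rw [Fin.ext_iff]; omega

/-- A cardinality is a sum of indicators. Quantifiers over vertices then reduce to counting; the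
bound vertex is variable `0` and the others are shifted. -/
theorem _root_.TW2D.Comp.ncard (hR : Def fun n I e S => R n I (fun i => e (i + 1)) S (e 0)) :
    Comp fun n I e S => {x | R n I e S x}.ncard :=
  Comp.congr (Comp.sum (f := fun n I e S x => ind (R n I e S x)) hR) fun n I e S => by
    classical
    rw [Set.ncard_eq_toFinset_card']
    simp [ind]

theorem ex (hR : Def fun n I e S => R n I (fun i => e (i + 1)) S (e 0)) :
    Def fun n I e S => ∃ x, R n I e S x :=
  (le (Comp.const 1) (Comp.ncard hR)).congr fun n I e S => by
    rw [Nat.one_le_iff_ne_zero, Ne, Set.ncard_eq_zero (Set.toFinite _), ← Ne, ← Set.nonempty_iff_ne_empty]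
    rfl

theorem all (hR : Def fun n I e S => R n I (fun i => e (i + 1)) S (e 0)) :
    Def fun n I e S => ∀ x, R n I e S x :=
  (ex (R := fun n I e S x => ¬ R n I e S x) hR.not).not.congr fun n I e S => by
    push Not; rfl

/-- Stages of an iteration. -/
theorem stage {Φ : ∀ n : ℕ, Inst n → (ℕ → Fin n) → (ℕ → Set (Fin n)) → Set (Fin n) → Set (Fin n)}
    (hΦ : Def fun n I e S => e 0 ∈ Φ n I (fun i => e (i + 1)) (fun j => S (j + 1)) (S 0))
    (i k : ℕ) : Def fun n I e S => e i ∈ TW2D.stage (Φ n I e S) (e k + 1) := by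
  intro ρ σ b hρ hσ hb
  have hρ' : ∀ i, scons (b + 1) ρ i < b + 2 :=
    scons_lt (by omega) fun i => (hρ i).trans (by omega)
  have hσ' : ∀ i, scons b σ i < b + 2 :=
    scons_lt (by omega) fun i => (hσ i).trans (by omega)
  obtain ⟨p, q, h⟩ := hΦ (scons (b + 1) ρ) (scons b σ) (b + 2) hρ' hσ' (by omega)
  -- Array `b` holds the current stage and array `b + 1` receives the next one; copying waits for
  -- the end of the pass, since all memberships refer to the old stage.
  let clear : Prog := forDown (b + 1) (.put b (.var (b + 1)) (.const 0))
  let eval : Prog := forDown (b + 1) (.seq p (.put (b + 1) (.var (b + 1)) (.var (b + 2))))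
  let copy : Prog := forDown (b + 1) (.put b (.var (b + 1)) (.get (b + 1) (.var (b + 1))))
  let qstep : Polynomial ℕ := (Polynomial.C 2 + (Polynomial.X * (q + Polynomial.C 3 + Polynomial.C 6) + Polynomial.C 2)) +
    (Polynomial.C 2 + (Polynomial.X * Polynomial.C 10 + Polynomial.C 2))
  refine ⟨.seq (.seq (.assign (b + 1) (.var 0)) clear)
    (.seq (.seq (.assign b (.add (.var (ρ k)) (.const 1)))
      (forDown b (.seq (.seq (.assign (b + 1) (.var 0)) eval)
        (.seq (.assign (b + 1) (.var 0)) copy))))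
      (.assign b (.get b (.var (ρ i))))),
    (Polynomial.C 2 + (Polynomial.X * Polynomial.C 9 + Polynomial.C 2)) +
      ((Polynomial.C 4 + (Polynomial.X * (qstep + Polynomial.C 6) + Polynomial.C 2)) +
      Polynomial.C 3), fun n I e S s hs => ?_⟩
  simp only [qstep, Polynomial.eval_add, Polynomial.eval_C, Polynomial.eval_mul, Polynomial.eval_X]
  have hn : s.var 0 = n := hs.1.1
  have hagn : ∀ {s'}, Agree b s s' → s'.var 0 = n := fun h => (h.1 0 (by omega)).trans hn
  have hclear : Exec (.seq (.assign (b + 1) (.var 0)) clear) (2 + (n * 9 + 2)) s fun s' =>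
      Agree b s s' ∧ ∀ x : Fin n, s'.arr b x = ind (x ∈ TW2D.stage (Φ n I e S) 0) := by
    refine (Exec.assign (P := fun s' => Agree b s s' ∧ s'.var (b + 1) = n)
      ⟨(Agree.refl b s).setVar (Nat.le_succ b) _, by simp [Term.eval, hn]⟩).seq fun s₁ hs₁ => ?_
    refine (Exec.forDown (K := 3) (Inv := fun j s' => Agree b s s' ∧ ∀ x : Fin n, j ≤ x → s'.arr b x = 0)
      (s := s₁) (N := n) ⟨hs₁.1, fun x hx => absurd x.2 (by omega)⟩ hs₁.2
      fun j s₂ hj hs₂ hc => ?_).imp fun s' hs' => ?_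
    · refine Exec.put ⟨⟨(hs₂.1.setVar (Nat.le_succ b) _).setArr le_rfl _ _, fun x hx => ?_⟩, by simp⟩
      rw [State.setArr_arr_self]
      simp only [Term.eval, State.setVar_var, if_true, State.setVar_arr]
      split_ifs with hx'
      · rfl
      · exact hs₂.2 x (by omega)
    · refine ⟨hs'.1.1, fun x => ?_⟩
      rw [hs'.1.2 x (Nat.zero_le _), ind_false]
      exact Set.notMem_empty x
  refine hclear.seq fun s₁ hs₁ => ?_
  -- The number of rounds comes from a vertex, so it is at most `n` and the running time is
  -- polynomial in `n`.
  have hcount : (e k : ℕ) + 1 ≤ n := (e k).2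
  refine Exec.seq (P := fun s' => Agree b s s' ∧
      ∀ x : Fin n, s'.arr b x = ind (x ∈ TW2D.stage (Φ n I e S) (e k + 1))) ?_ fun s₂ hs₂ => ?_
  · refine (Exec.assign (e := .add (.var (ρ k)) (.const 1)) (P := fun s' => (Agree b s s' ∧
        ∀ x : Fin n, s'.arr b x = ind (x ∈ TW2D.stage (Φ n I e S) 0)) ∧ s'.var b = e k + 1)
      ⟨⟨hs₁.1.setVar le_rfl _, hs₁.2⟩, ?_⟩).seq fun s₂ hs₂ => ?_
    · simp [Term.eval, hs₁.1.1 _ (hρ k), hs.2.1]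
    refine (Exec.forDown (K := 2 + (n * (q.eval n + 3 + 6) + 2) + (2 + (n * 10 + 2)))
      (s := s₂) (N := e k + 1) (Inv := fun j s' => Agree b s s' ∧
        ∀ x : Fin n, s'.arr b x = ind (x ∈ TW2D.stage (Φ n I e S) (e k + 1 - j)))
      (by simpa using hs₂.1) hs₂.2 fun j s₃ hj hs₃ hc => ?_).mono ?_ fun s' hs' => hs'.1
    rotate_left
    · exact Nat.add_le_add_right (Nat.mul_le_mul_right _ hcount) _
    have hag₃ : Agree b s (s₃.setVar b j) := hs₃.1.setVar le_rfl _
    set W := TW2D.stage (Φ n I e S) (e k + 1 - (j + 1)) with hW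
    have hWs : TW2D.stage (Φ n I e S) (e k + 1 - j) = Φ n I e S W := by
      rw [show (e k : ℕ) + 1 - j = (e k + 1 - (j + 1)) + 1 by omega, stage_succ]
    have heval : Exec (.seq (.assign (b + 1) (.var 0)) eval)
        (2 + (n * (q.eval n + 3 + 6) + 2)) (s₃.setVar b j) fun s' =>
        Agree b s s' ∧ s'.var b = j ∧ ∀ x : Fin n, s'.arr (b + 1) x = ind (x ∈ Φ n I e S W) := by
      refine (Exec.assign (P := fun s' => (Agree b s s' ∧ s'.var b = j ∧ s'.arr b = s₃.arr b) ∧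
          s'.var (b + 1) = n)
        ⟨⟨hag₃.setVar (Nat.le_succ b) _, by simp, rfl⟩, by rw [State.setVar_var, if_pos rfl]; exact hagn hag₃⟩).seq
        fun s₄ hs₄ => ?_
      refine (Exec.forDown (s := s₄) (N := n) (K := q.eval n + 3) (Inv := fun l s' => (Agree b s s' ∧
          s'.var b = j ∧ s'.arr b = s₃.arr b) ∧
          ∀ x : Fin n, l ≤ x → s'.arr (b + 1) x = ind (x ∈ Φ n I e S W))
        ⟨hs₄.1, fun x hx => absurd x.2 (by omega)⟩ hs₄.2 fun l s₅ hl hs₅ hc => ?_).imp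
        fun s' hs' => ⟨hs'.1.1.1, hs'.1.1.2.1, fun x => hs'.1.2 x (Nat.zero_le _)⟩
      have hag₅ : Agree b s (s₅.setVar (b + 1) l) := hs₅.1.1.setVar (Nat.le_succ b) _
      have hlay : Layout (scons (b + 1) ρ) (scons b σ) I (scons (⟨l, hl⟩ : Fin n) e) (scons W S)
          (s₅.setVar (b + 1) l) := by
        have hlo := hs.agree hb hρ hσ hag₅
        refine ⟨hlo.1, ?_, ?_⟩
        · rintro (_ | m)
          · simp [scons]
          · exact hlo.2.1 m
        · rintro (_ | m)
          · intro x
            simp only [scons, State.setVar_arr]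
            rw [hs₅.1.2.2]
            exact hs₃.2 x
          · exact hlo.2.2 m
      refine (h n I _ _ _ hlay).seq fun s₆ hs₆ => ?_
      have hb1 : s₆.var (b + 1) = l := by
        rw [hs₆.2.1 (b + 1) (by omega), State.setVar_var, if_pos rfl]
      refine Exec.put ⟨⟨⟨(hag₅.trans (hs₆.2.mono (by omega))).setArr (Nat.le_succ b) _ _, ?_, ?_⟩, ?_⟩, ?_⟩
      · rw [State.setArr_var, hs₆.2.1 b (by omega), State.setVar_var, if_neg (by omega)]
        exact hs₅.1.2.1
      · rw [State.setArr_arr_of_ne _ _ _ (by omega), hs₆.2.2 b (by omega)]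
        exact hs₅.1.2.2
      · intro x hx
        rw [State.setArr_arr_self]
        split_ifs with hx'
        · have : x = ⟨l, hl⟩ := Fin.ext (hx'.trans hb1)
          rw [this]
          exact hs₆.1
        · have hxl : (x : ℕ) ≠ l := fun h => hx' (h.trans hb1.symm)
          rw [hs₆.2.2 (b + 1) (by omega)]
          exact hs₅.2 x (by omega)
      · exact hb1
    refine (heval.seq fun s₄ hs₄ => ?_)
    refine (Exec.assign (P := fun s' => (Agree b s s' ∧ s'.var b = j ∧
        ∀ x : Fin n, s'.arr (b + 1) x = ind (x ∈ Φ n I e S W)) ∧ s'.var (b + 1) = n)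
      ⟨⟨hs₄.1.setVar (Nat.le_succ b) _, by simp [hs₄.2.1], hs₄.2.2⟩,
        by simp [Term.eval, hagn hs₄.1]⟩).seq fun s₅ hs₅ => ?_
    refine (Exec.forDown (s := s₅) (N := n) (K := 4) (Inv := fun l s' => (Agree b s s' ∧ s'.var b = j ∧
        ∀ x : Fin n, s'.arr (b + 1) x = ind (x ∈ Φ n I e S W)) ∧
        ∀ x : Fin n, l ≤ x → s'.arr b x = ind (x ∈ Φ n I e S W))
      ⟨hs₅.1, fun x hx => absurd x.2 (by omega)⟩ hs₅.2 fun l s₆ hl hs₆ hc => ?_).imp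
      fun s' hs' => ⟨⟨hs'.1.1.1, fun x => by rw [hWs]; exact hs'.1.2 x (Nat.zero_le _)⟩, hs'.1.1.2.1⟩
    refine Exec.put ⟨⟨⟨(hs₆.1.1.setVar (Nat.le_succ b) _).setArr le_rfl _ _, ?_, fun x => ?_⟩,
      fun x hx => ?_⟩, by simp⟩
    · simp [hs₆.1.2.1]
    · rw [State.setArr_arr_of_ne _ _ _ (by omega)]
      exact hs₆.1.2.2 x
    · rw [State.setArr_arr_self]
      simp only [Term.eval, State.setVar_var, if_true, State.setVar_arr]
      split_ifs with hx'
      · rw [← hx']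
        exact hs₆.1.2.2 x
      · exact hs₆.2 x (by omega)
  · refine Exec.assign (e := .get b (.var (ρ i))) ⟨?_, hs₂.1.setVar le_rfl _⟩
    rw [State.setVar_var, if_pos rfl]
    simp only [Term.eval]
    rw [hs₂.1.1 _ (hρ i), hs.2.1, hs₂.2]

end Def

/-! ## Decidable families of vertex sets and graphs -/

/-- A family of vertex sets that depend on an input, on vertices and on vertex sets. -/
abbrev SetFamily := ∀ n : ℕ, Inst n → (ℕ → Fin n) → (ℕ → Set (Fin n)) → Set (Fin n)

/-- A family of graphs that depend on an input, on vertices and on vertex sets. -/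
abbrev GraphFamily := ∀ n : ℕ, Inst n → (ℕ → Fin n) → (ℕ → Set (Fin n)) → SimpleGraph (Fin n)

/-- Membership in the sets `A` can be decided in polynomial time. -/
def DefSet (A : SetFamily) : Prop :=
  Def fun n I e S => e 0 ∈ A n I (fun i => e (i + 1)) S

/-- Adjacency in the graphs `H` can be decided in polynomial time. -/
def DefGraph (H : GraphFamily) : Prop :=
  Def fun n I e S => (H n I (fun i => e (i + 2)) S).Adj (e 0) (e 1)

section Families

variable {A B U W : SetFamily} {H : GraphFamily}

/-- With `φ k = k + d` this carries a family under `d` further bound vertices. -/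
theorem DefSet.mem (hA : DefSet A) (i : ℕ) (φ ψ : ℕ → ℕ) :
    Def fun n I e S => e i ∈ A n I (fun k => e (φ k)) (fun j => S (ψ j)) :=
  Def.subst hA (scons i φ) ψ

theorem DefSet.subst (hA : DefSet A) (φ ψ : ℕ → ℕ) :
    DefSet fun n I e S => A n I (fun k => e (φ k)) (fun j => S (ψ j)) :=
  hA.mem 0 (fun k => φ k + 1) ψ

theorem DefGraph.adj (hH : DefGraph H) (i j : ℕ) (φ ψ : ℕ → ℕ) :
    Def fun n I e S => (H n I (fun k => e (φ k)) (fun j => S (ψ j))).Adj (e i) (e j) :=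
  Def.subst hH (scons i (scons j φ)) ψ

theorem DefGraph.subst (hH : DefGraph H) (φ ψ : ℕ → ℕ) :
    DefGraph fun n I e S => H n I (fun k => e (φ k)) (fun j => S (ψ j)) :=
  hH.adj 0 1 (fun k => φ k + 2) ψ

theorem defGraph_input : DefGraph fun _ I _ _ => I.G := Def.adj 0 1

theorem defSet_var (j : ℕ) : DefSet fun _ _ _ S => S j := Def.mem 0 j

theorem defSet_X : DefSet fun _ I _ _ => I.X := Def.memX 0

theorem DefSet.compl (hA : DefSet A) : DefSet fun n I e S => (A n I e S)ᶜ := hA.not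

theorem DefSet.union (hA : DefSet A) (hB : DefSet B) :
    DefSet fun n I e S => A n I e S ∪ B n I e S := hA.or hB

theorem DefSet.inter (hA : DefSet A) (hB : DefSet B) :
    DefSet fun n I e S => A n I e S ∩ B n I e S := hA.and hB

theorem DefSet.sdiff (hA : DefSet A) (hB : DefSet B) :
    DefSet fun n I e S => A n I e S \ B n I e S := hA.and hB.not

theorem defSet_singleton (i : ℕ) : DefSet fun _ _ e _ => {e i} := Def.eq 0 (i + 1)

theorem defSet_pair (i j : ℕ) : DefSet fun _ _ e _ => {e i, e j} :=
  (Def.eq 0 (i + 1)).or (Def.eq 0 (j + 1))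

theorem DefSet.ncard (hA : DefSet A) : Comp fun n I e S => (A n I e S).ncard :=
  Comp.ncard (R := fun n I e S x => x ∈ A n I e S) hA

/-- `mem_stage_iff` turns the final stage into an existential quantifier over `k : Fin n`, which is
within reach of `Def.stage`. -/
theorem DefSet.stage
    {Φ : ∀ n : ℕ, Inst n → (ℕ → Fin n) → (ℕ → Set (Fin n)) → Set (Fin n) → Set (Fin n)}
    (hΦ : DefSet fun n I e S => Φ n I e (fun j => S (j + 1)) (S 0))
    (hsub : ∀ n I e S W, W ⊆ Φ n I e S W) :
    DefSet fun n I e S => TW2D.stage (Φ n I e S) n := by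
  have h : Def fun n I e S => ∃ k : Fin n,
      e 0 ∈ TW2D.stage (Φ n I (fun i => e (i + 1)) S) (k + 1) :=
    Def.ex (Def.stage (Φ := fun n I e S W => Φ n I (fun i => e (i + 2)) S W)
      (hΦ.mem 0 (fun k => k + 3) fun j => j) 1 0)
  exact h.congr fun n I e S => (mem_stage_iff (hsub n I _ S)).symm

theorem DefSet.openNbhd (hH : DefGraph H) (hU : DefSet U) :
    DefSet fun n I e S => openNbhd (H n I e S) (U n I e S) :=
  (DefSet.compl hU).and (Def.ex (R := fun n I e S u => u ∈ U n I (fun i => e (i + 1)) S ∧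
      (H n I (fun i => e (i + 1)) S).Adj u (e 0))
    ((hU.mem 0 (fun k => k + 2) fun j => j).and (hH.adj 0 1 (fun k => k + 2) fun j => j)))

/-- Extend `R` by `u` and by the vertices of `A` with neighbours in `R`. -/
def reachStep {V : Type*} (G : SimpleGraph V) (A : Set V) (u : V) (R : Set V) : Set V :=
  {z | z ∈ R ∨ z = u ∨ (z ∈ A ∧ ∃ y, y ∈ R ∧ G.Adj y z)}

theorem stage_reachStep {n : ℕ} (G : SimpleGraph (Fin n)) (A : Set (Fin n)) (u : Fin n) :
    stage (reachStep G A u) n = {w | Reach G A u w} := by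
  have hsub : ∀ R, R ⊆ reachStep G A u R := fun R z hz => Or.inl hz
  apply Set.Subset.antisymm
  · have h : ∀ k, stage (reachStep G A u) k ⊆ {w | Reach G A u w} := by
      intro k
      induction k with
      | zero => exact Set.empty_subset _
      | succ k ih =>
        rw [stage_succ]
        rintro z (hz | rfl | ⟨hzA, y, hy, hyz⟩)
        · exact ih hz
        · exact Reach.refl _ _ _
        · exact Relation.ReflTransGen.tail (ih hy) ⟨hyz, hzA⟩
    exact h n
  · intro w hw
    -- The final stage is closed under `reachStep`, so it contains `u` and follows every step of a
    -- walk.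
    have hfix := stage_fixed hsub
    change Relation.ReflTransGen (fun a b => G.Adj a b ∧ b ∈ A) u w at hw
    induction hw with
    | refl => rw [← hfix]; exact Or.inr (Or.inl rfl)
    | tail _ hyz ih => rw [← hfix]; exact Or.inr (Or.inr ⟨hyz.2, _, ih, hyz.1⟩)

theorem DefSet.reach (hH : DefGraph H) (hA : DefSet A) (i : ℕ) :
    DefSet fun n I e S => {w | Reach (H n I e S) (A n I e S) (e i) w} := by
  have h : DefSet fun n I e S => TW2D.stage (reachStep (H n I e S) (A n I e S) (e i)) n := by
    refine DefSet.stage (Φ := fun n I e S W => reachStep (H n I e S) (A n I e S) (e i) W) ?_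
      fun n I e S W z hz => Or.inl hz
    exact (Def.mem 0 0).or ((Def.eq 0 (i + 1)).or ((hA.mem 0 (fun k => k + 1) fun j => j + 1).and
      (Def.ex (R := fun n I e S y => y ∈ S 0 ∧
          (H n I (fun i => e (i + 1)) (fun j => S (j + 1))).Adj y (e 0))
        ((Def.mem 0 0).and (hH.adj 0 1 (fun k => k + 2) fun j => j + 1)))))
  simpa only [stage_reachStep] using h

theorem DefSet.canEliminate (hH : DefGraph H) (hA : DefSet A) (hW : DefSet W) :
    DefSet fun n I e S => {v | CanEliminate (H n I e S) (A n I e S) (W n I e S) v} := by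
  have hH' := hH.subst (fun k => k + 1) fun j => j
  have hA' := hA.subst (fun k => k + 1) fun j => j
  have hW' := hW.subst (fun k => k + 1) fun j => j
  exact hA.and (Def.and hW.not
    (Def.le (((DefSet.reach hH' hW' 0).openNbhd hH').inter hA').ncard (Comp.const 2)))

theorem DefSet.greedyStep (hH : DefGraph H) (hA : DefSet A) (hW : DefSet W) :
    DefSet fun n I e S => greedyStep (H n I e S) (A n I e S) (W n I e S) := by
  have h := DefSet.canEliminate hH hA hW
  exact hW.or (h.and (Def.all (R := fun n I e S u =>
      u ∈ {v | CanEliminate (H n I (fun i => e (i + 1)) S) (A n I (fun i => e (i + 1)) S)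
        (W n I (fun i => e (i + 1)) S) v} → e 0 ≤ u)
    ((h.mem 0 (fun k => k + 2) fun j => j).imp (Def.le (Comp.idx 1) (Comp.idx 0)))))

theorem Comp.rk (hH : DefGraph H) (hA : DefSet A) (i : ℕ) :
    Comp fun n I e S => rk (H n I e S) (A n I e S) (e i) := by
  refine Comp.ncard (R := fun n I e S k =>
    e i ∉ TW2D.stage (TW2D.greedyStep (H n I e S) (A n I e S)) (k + 1)) (Def.not ?_)
  exact Def.stage (Φ := fun n I e S W => TW2D.greedyStep (H n I (fun k => e (k + 1)) S)
      (A n I (fun k => e (k + 1)) S) W)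
    (DefSet.greedyStep (hH.subst (fun k => k + 1) fun j => j + 1)
      (hA.subst (fun k => k + 1) fun j => j + 1) (defSet_var 0)) (i + 1) 0

/-- The test is that greedy elimination reaches every vertex of `A`; the rank is a cardinality of
stages, hence computable. -/
theorem Def.tw (hH : DefGraph H) (hA : DefSet A) :
    Def fun n I e S => TW (H n I e S) (A n I e S) := by
  refine Def.congr ?_ fun n I e S => tw_iff_rk_lt.symm
  exact Def.all (R := fun n I e S a => a ∈ A n I e S → TW2D.rk (H n I e S) (A n I e S) a < n)
    (Def.imp hA (Def.lt (Comp.rk (hH.subst (fun k => k + 1) fun j => j)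
      (hA.subst (fun k => k + 1) fun j => j) 0) Comp.size))

end Families

/-! ## The algorithm as decidable sets -/

/-- The elimination order of `G - X`. -/
noncomputable def Inst.order {n : ℕ} (I : Inst n) : Fin n → ℕ := rk I.G I.Xᶜ

section Marks

variable {K M : SetFamily} {H : GraphFamily}

theorem Comp.order (i : ℕ) : Comp fun _ I e _ => I.order (e i) :=
  Comp.rk defGraph_input defSet_X.compl i

theorem defSet_Dn (i : ℕ) : DefSet fun _ I e _ => Dn I.order I.Xᶜ (e i) :=
  (Def.memX 0).not.and (Def.le (Comp.order 0) (Comp.order (i + 1)))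

theorem defSet_Tr (i : ℕ) : DefSet fun _ I e _ => Tr I.G I.order I.Xᶜ (e i) :=
  DefSet.reach defGraph_input (defSet_Dn i) i

theorem defSet_bag (i : ℕ) : DefSet fun _ I e _ => bag I.G I.order I.Xᶜ (e i) :=
  (Def.eq 0 (i + 1)).or (((defSet_Tr i).openNbhd defGraph_input).inter defSet_X.compl)

theorem DefSet.bags (hM : DefSet M) : DefSet fun n I e S => bags I.G I.order I.Xᶜ (M n I e S) :=
  Def.ex (R := fun n I e S m =>
      m ∈ M n I (fun i => e (i + 1)) S ∧ e 0 ∈ bag I.G I.order I.Xᶜ m)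
    ((hM.mem 0 (fun k => k + 2) fun j => j).and ((defSet_bag 0).mem 1 (fun k => k) fun j => j))

theorem DefSet.sub (hM : DefSet M) (i : ℕ) :
    DefSet fun n I e S => sub I.G I.order I.Xᶜ (M n I e S) (e i) :=
  DefSet.reach defGraph_input ((defSet_Dn i).sdiff hM.bags) i

theorem Def.sees (hH : DefGraph H) (hK : DefSet K) (i : ℕ) :
    Def fun n I e S => Sees (H n I e S) (K n I e S) (e i) :=
  Def.ex (R := fun n I e S z => z ∈ K n I e S ∧ (H n I e S).Adj z (e i))
    (Def.and hK (hH.adj 0 (i + 1) (fun k => k + 1) fun j => j))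

theorem Def.joins (hK : DefSet K) (i j : ℕ) :
    Def fun n I e S => Joins I.G (e i) (e j) (K n I e S) :=
  (Def.sees defGraph_input hK i).and (Def.sees defGraph_input hK j)

theorem Def.bad (hK : DefSet K) (i j : ℕ) :
    Def fun n I e S => Bad I.G (e i) (e j) (K n I e S) :=
  (Def.joins hK i j).and
    ((Def.adj i j).imp (Def.tw defGraph_input (hK.union (defSet_pair i j))).not)

theorem DefSet.markStep (hM : DefSet M) (i j : ℕ) :
    DefSet fun n I e S => markStep I.G I.t I.order I.Xᶜ (e i) (e j) (M n I e S) := by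
  have hM' := hM.subst (fun k => k + 1) fun j => j
  have hM'' := hM.subst (fun k => k + 2) fun j => j
  refine Def.or hM ((Def.memX 0).not.and ((DefSet.bags hM).compl.and (Def.and (Def.not
    ((Def.adj (i + 1) (j + 1)).and (Def.le (Comp.budget.add (Comp.const 2)) hM'.ncard)))
    (Def.and (Def.bad (DefSet.sub hM' 0) (i + 1) (j + 1)) ?_))))
  exact Def.all (R := fun n I e S u => u ∈ I.Xᶜ →
      u ∉ TW2D.bags I.G I.order I.Xᶜ (M n I (fun i => e (i + 1)) S) → I.order u < I.order (e 0) →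
      ¬ Bad I.G (e (i + 1)) (e (j + 1))
        (TW2D.sub I.G I.order I.Xᶜ (M n I (fun i => e (i + 1)) S) u))
    ((Def.memX 0).not.imp ((hM.bags.mem 0 (fun k => k + 2) fun j => j).not.imp
      ((Def.lt (Comp.order 0) (Comp.order 1)).imp
        (Def.bad (DefSet.sub hM'' 0) (i + 2) (j + 2)).not)))

theorem defSet_firstMarks (i j : ℕ) :
    DefSet fun _ I e _ => firstMarks I.G I.t I.order I.Xᶜ (e i) (e j) :=
  DefSet.stage (Φ := fun _ I e _ W => markStep I.G I.t I.order I.Xᶜ (e i) (e j) W)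
    (DefSet.markStep (defSet_var 0) i j) fun _ _ _ _ W => subset_markStep W

theorem defSet_secondMarks (i j : ℕ) :
    DefSet fun _ I e _ => secondMarks I.G I.t I.order I.Xᶜ (e i) (e j) := by
  have hF := defSet_firstMarks i j
  have hF' := defSet_firstMarks (i + 1) (j + 1)
  have hF'' := defSet_firstMarks (i + 2) (j + 2)
  refine (Def.adj (i + 1) (j + 1)).and (Def.and
    (Def.le (Comp.budget.add (Comp.const 2)) hF'.ncard).not ((Def.memX 0).not.and
    (hF.bags.compl.and (Def.and (Def.joins (hF'.sub 0) (i + 1) (j + 1)) ?_))))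
  exact Def.all (R := fun n I e S u =>
      u ∈ {w | Reach I.G (I.Xᶜ \ bags I.G I.order I.Xᶜ
        (firstMarks I.G I.t I.order I.Xᶜ (e (i + 1)) (e (j + 1)))) (e 0) w} →
      I.order u < I.order (e 0) → ¬ Joins I.G (e (i + 1)) (e (j + 1))
        (sub I.G I.order I.Xᶜ (firstMarks I.G I.t I.order I.Xᶜ (e (i + 1)) (e (j + 1))) u))
    (((DefSet.reach defGraph_input (defSet_X.compl.sdiff hF'.bags) 0).mem 0 (fun k => k + 1)
      fun j => j).imp ((Def.lt (Comp.order 0) (Comp.order 1)).imp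
        (Def.joins (hF''.sub 0) (i + 2) (j + 2)).not))

theorem defSet_marks : DefSet fun _ I _ _ => marks I.G I.t I.order I.Xᶜ I.X :=
  Def.ex (R := fun _ I e _ x => ∃ y, x ∈ I.X ∧ y ∈ I.X ∧ x < y ∧
      (e 0 ∈ firstMarks I.G I.t I.order I.Xᶜ x y ∨ e 0 ∈ secondMarks I.G I.t I.order I.Xᶜ x y))
    (Def.ex (R := fun _ I e _ y => e 0 ∈ I.X ∧ y ∈ I.X ∧ e 0 < y ∧
      (e 1 ∈ firstMarks I.G I.t I.order I.Xᶜ (e 0) y ∨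
        e 1 ∈ secondMarks I.G I.t I.order I.Xᶜ (e 0) y))
    ((Def.memX 1).and ((Def.memX 0).and (Def.and (Def.lt (Comp.idx 1) (Comp.idx 0))
      (((defSet_firstMarks 1 0).mem 2 (fun k => k) fun j => j).or
        ((defSet_secondMarks 1 0).mem 2 (fun k => k) fun j => j))))))

theorem DefSet.branchClosure (hM : DefSet M) :
    DefSet fun n I e S => branchClosure I.G I.order I.Xᶜ (M n I e S) := by
  refine Def.or hM ((Def.memX 0).not.and ?_)
  refine Def.ex (R := fun n I e S m₁ => m₁ ∈ M n I (fun i => e (i + 1)) S ∧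
      ∃ m₂ ∈ M n I (fun i => e (i + 1)) S,
        m₁ ∈ Tr I.G I.order I.Xᶜ (e 0) ∧ m₂ ∈ Tr I.G I.order I.Xᶜ (e 0) ∧ m₁ ≠ e 0 ∧ m₂ ≠ e 0 ∧
          ¬ Reach I.G (Tr I.G I.order I.Xᶜ (e 0) \ {e 0}) m₁ m₂)
    ((hM.mem 0 (fun k => k + 2) fun j => j).and ?_)
  refine Def.ex (R := fun n I e S m₂ => m₂ ∈ M n I (fun i => e (i + 2)) S ∧
        e 0 ∈ Tr I.G I.order I.Xᶜ (e 1) ∧ m₂ ∈ Tr I.G I.order I.Xᶜ (e 1) ∧ e 0 ≠ e 1 ∧ m₂ ≠ e 1 ∧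
          ¬ Reach I.G (Tr I.G I.order I.Xᶜ (e 1) \ {e 1}) (e 0) m₂)
    ((hM.mem 0 (fun k => k + 3) fun j => j).and ?_)
  exact ((defSet_Tr 2).mem 1 (fun k => k) fun j => j).and
    (((defSet_Tr 2).mem 0 (fun k => k) fun j => j).and ((Def.eq 1 2).not.and ((Def.eq 0 2).not.and
      ((DefSet.reach defGraph_input ((defSet_Tr 2).sdiff (defSet_singleton 2)) 1).mem 0
        (fun k => k) fun j => j).not)))

/-- The component separator that the algorithm returns. -/
def Inst.separator {n : ℕ} (I : Inst n) : Set (Fin n) :=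
  bags I.G I.order I.Xᶜ (TW2D.branchClosure I.G I.order I.Xᶜ (marks I.G I.t I.order I.Xᶜ I.X))

theorem defSet_separator : DefSet fun _ I _ _ => I.separator := defSet_marks.branchClosure.bags

end Marks

/-! ### Deciding replaceability -/

section Reducible

variable {C Z : SetFamily}

theorem DefSet.compOf (hZ : DefSet Z) (i : ℕ) :
    DefSet fun n I e S => compOf I.G (Z n I e S) (e i) :=
  DefSet.reach defGraph_input hZ.compl i

theorem Def.isRep (hZ : DefSet Z) (i : ℕ) : Def fun n I e S => IsRep I.G (Z n I e S) (e i) :=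
  (hZ.mem i (fun k => k) fun j => j).not.and
    (Def.all (R := fun n I e S w => w ∈ TW2D.compOf I.G (Z n I e S) (e i) → e i ≤ w)
      (Def.imp (hZ.compOf i) (Def.le (Comp.idx (i + 1)) (Comp.idx 0))))

theorem defGraph_addClique (i j : ℕ) :
    DefGraph fun _ I e _ => addClique I.G {e i, e j} := by
  refine Def.congr ?_ fun n I e S => addClique_adj.symm
  exact (Def.adj 0 1).or ((Def.eq 0 1).not.and
    (((defSet_pair i j).mem 0 (fun k => k + 2) fun j => j).and
      ((defSet_pair i j).mem 1 (fun k => k + 2) fun j => j)))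

theorem Def.obstructs (hC : DefSet C) (i j : ℕ) :
    Def fun n I e S => Obstructs I.G (e i) (e j) (C n I e S) :=
  (Def.tw (defGraph_addClique i j) (hC.union (defSet_pair i j))).not

theorem Def.reducible (hZ : DefSet Z) (i : ℕ) :
    Def fun n I e S => Reducible I.G I.t (Z n I e S) (e i) := by
  have hN := (hZ.compOf i).openNbhd defGraph_input
  have hZ₃ := hZ.subst (fun k => k + 3) fun j => j
  have hZ₄ := hZ.subst (fun k => k + 4) fun j => j
  have hN₃ := (hZ₃.compOf 0).openNbhd defGraph_input
  have hN₄ := (hZ₄.compOf 0).openNbhd defGraph_input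
  unfold Reducible
  refine (hZ.mem i (fun k => k) fun j => j).not.and (Def.and
    (Def.all (Def.imp (hN.mem 0 (fun k => k + 1) fun j => j)
      (Def.all (Def.imp (hN.mem 0 (fun k => k + 2) fun j => j)
        (Def.all (Def.imp (hN.mem 0 (fun k => k + 3) fun j => j)
          ((Def.eq 2 1).not.imp ((Def.eq 2 0).not.imp ((Def.eq 1 0).not.imp
            (Def.le (Comp.budget.add (Comp.const 1)) (Comp.ncard ?_)))))))))))
    (Def.all (Def.imp (hN.mem 0 (fun k => k + 1) fun j => j)
      (Def.all (Def.imp (hN.mem 0 (fun k => k + 2) fun j => j)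
        ((Def.eq 1 0).not.imp (Def.le (Comp.budget.add (Comp.const 3)) (Comp.ncard ?_))))))))
  · exact (Def.isRep hZ₄ 0).and (((hZ.compOf i).mem 0 (fun k => k + 4) fun j => j).not.and
      ((hN₄.mem 3 (fun k => k) fun j => j).and ((hN₄.mem 2 (fun k => k) fun j => j).and
        (hN₄.mem 1 (fun k => k) fun j => j))))
  · exact (Def.isRep hZ₃ 0).and (((hZ.compOf i).mem 0 (fun k => k + 3) fun j => j).not.and
      ((hN₃.mem 2 (fun k => k) fun j => j).and ((hN₃.mem 1 (fun k => k) fun j => j).and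
        ((Def.obstructs (hZ₃.compOf (i + 3)) 2 1).imp (Def.obstructs (hZ₃.compOf 0) 2 1)))))

/-- The vertex `v` can be deleted without changing the answer. -/
def Inst.Redundant {n : ℕ} (I : Inst n) (v : Fin n) : Prop :=
  (∃ x y, Reducible I.G I.t
    (I.X ∪ bags I.G I.order I.Xᶜ (firstMarks I.G I.t I.order I.Xᶜ x y)) v) ∨
  Reducible I.G I.t (I.X ∪ I.separator) v

theorem def_redundant : Def fun _ I e _ => I.Redundant (e 0) := by
  unfold Inst.Redundant
  exact (Def.ex (Def.ex (Def.reducible (defSet_X.union (defSet_firstMarks 1 0).bags) 2))).or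
    (Def.reducible (defSet_X.union defSet_separator) 0)

end Reducible

/-! ## The program -/

open RAM

theorem HoldsInput.agree {n : ℕ} {I : Inst n} {s s' : State} (h : HoldsInput I s)
    (hs : Agree 2 s s') : HoldsInput I s' := by
  obtain ⟨h1, h2, h3, h4⟩ := h
  refine ⟨?_, ?_, fun i j => ?_, fun i => ?_⟩
  · rw [hs.1 0 (by omega), h1]
  · rw [hs.1 1 (by omega), h2]
  · rw [hs.2 0 (by omega), h3]
  · rw [hs.2 1 (by omega), h4]

/-- At top level no set variables are needed; all of them are read from array `1`, which holds `X`.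
-/
theorem Comp.exists_prog {f : Family} (hf : Comp f) (ρ : ℕ → ℕ) (b : ℕ) (hρ : ∀ i, ρ i < b)
    (hb : 4 ≤ b) : ∃ (p : Prog) (q : Polynomial ℕ), ∀ (n : ℕ) (I : Inst n) (e : ℕ → Fin n)
      (s : State), HoldsInput I s → (∀ i, s.var (ρ i) = e i) →
        Exec p (q.eval n) s fun s' => s'.var b = f n I e (fun _ => I.X) ∧ Agree b s s' := by
  obtain ⟨p, q, h⟩ := hf ρ (fun _ => 1) b hρ (fun _ => by omega) hb
  exact ⟨p, q, fun n I e s hI he => h n I e _ s ⟨hI, he, fun _ => hI.2.2.2⟩⟩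

variable {P : ∀ n : ℕ, Inst n → Fin n → Prop}

/-- Search for a vertex with a decidable property. -/
theorem Def.exists_search (hP : Def fun n I e _ => P n I (e 0)) :
    ∃ (p : Prog) (q : Polynomial ℕ), ∀ (n : ℕ) (I : Inst n) (s : State), HoldsInput I s →
      Exec p (q.eval n) s fun s' => HoldsInput I s' ∧
        ((s'.var 4 = 0 ∧ ∀ v, ¬ P n I v) ∨ ∃ v, P n I v ∧ s'.var 4 = v + 1) := by
  obtain ⟨p, q, h⟩ := Comp.exists_prog hP (fun _ => 5) 6 (fun _ => by omega) (by omega)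
  -- Variable `5` is both the counter and the vertex that is tested, variable `6` receives the
  -- verdict. Hits are stored as `v + 1` so that `0` can mean that there is none.
  refine ⟨.seq (.assign 4 (.const 0)) (.seq (.assign 5 (.var 0)) (forDown 5 (.seq p
    (.branch (.var 6) (.assign 4 (.add (.var 5) (.const 1))) .nop)))),
    Polynomial.C 2 + (Polynomial.C 2 + (Polynomial.X * (q + Polynomial.C 6 + Polynomial.C 6) +
      Polynomial.C 2)), fun n I s hI => ?_⟩
  simp only [Polynomial.eval_add, Polynomial.eval_C, Polynomial.eval_mul, Polynomial.eval_X]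
  refine (Exec.assign (P := fun s' => s'.var 4 = 0 ∧ Agree 2 s s')
    ⟨by simp [Term.eval], (Agree.refl 2 s).setVar (by omega) _⟩).seq fun s₁ hs₁ => ?_
  refine (Exec.assign (P := fun s' => (s'.var 4 = 0 ∧ Agree 2 s s') ∧ s'.var 5 = n)
    ⟨⟨by simp [hs₁.1], hs₁.2.setVar (by omega) _⟩, ?_⟩).seq fun s₂ hs₂ => ?_
  · simp [Term.eval, (hI.agree hs₁.2).1]
  refine (Exec.forDown (s := s₂) (N := n) (Inv := fun i s' => Agree 2 s s' ∧
      ((s'.var 4 = 0 ∧ ∀ v : Fin n, i ≤ v → ¬ P n I v) ∨ ∃ v, P n I v ∧ s'.var 4 = v + 1))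
    ⟨hs₂.1.2, Or.inl ⟨hs₂.1.1, fun v hv => absurd v.2 (by omega)⟩⟩ hs₂.2
    fun i s₃ hi hs₃ _ => ?_).imp fun s' hs' => ⟨hI.agree hs'.1.1, ?_⟩
  · have hag : Agree 2 s (s₃.setVar 5 i) := hs₃.1.setVar (by omega) _
    refine (h n I (fun _ => ⟨i, hi⟩) _ (hI.agree hag) fun _ => by simp).seq fun s₄ hs₄ => ?_
    have h4 : s₄.var 4 = s₃.var 4 := by rw [hs₄.2.1 4 (by omega)]; simp
    have h5 : s₄.var 5 = i := by rw [hs₄.2.1 5 (by omega)]; simp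
    have hag₄ : Agree 2 s s₄ := hag.trans (hs₄.2.mono (by omega))
    refine Exec.branch (K := 4) (fun h6 => ?_) fun h6 => ?_
    · have hPi : P n I ⟨i, hi⟩ := by
        by_contra hPi
        exact h6 (hs₄.1.trans (ind_false hPi))
      refine Exec.assign (e := .add (.var 5) (.const 1))
        ⟨⟨hag₄.setVar (by omega) _, Or.inr ⟨⟨i, hi⟩, hPi, ?_⟩⟩, ?_⟩
      · simp [Term.eval, h5]
      · simp [h5]
    · have hPi : ¬ P n I ⟨i, hi⟩ := fun hPi => by
        have h6' : s₄.var 6 = 0 := h6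
        rw [hs₄.1, ind_true hPi] at h6'
        omega
      refine (Exec.nop ⟨⟨hag₄, ?_⟩, h5⟩).mono (by omega) fun _ h => h
      rw [h4]
      refine hs₃.2.imp_left fun h0 => ⟨h0.1, fun v hv => ?_⟩
      rcases hv.eq_or_lt with hv | hv
      · rwa [show v = ⟨i, hi⟩ from Fin.ext hv.symm]
      · exact h0.2 v hv
  · exact hs'.1.2.imp_left fun h0 => ⟨h0.1, fun v => h0.2 v (Nat.zero_le _)⟩

/-- Output the set of the vertices with a decidable property. -/
theorem Def.exists_output (hP : Def fun n I e _ => P n I (e 0)) :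
    ∃ (p : Prog) (q : Polynomial ℕ), ∀ (n : ℕ) (I : Inst n) (s : State), HoldsInput I s →
      Exec p (q.eval n) s fun s' => s'.var 2 = 2 ∧ ∀ v : Fin n, s'.arr 2 v = ind (P n I v) := by
  obtain ⟨p, q, h⟩ := Comp.exists_prog hP (fun _ => 5) 6 (fun _ => by omega) (by omega)
  refine ⟨.seq (.assign 5 (.var 0)) (.seq (forDown 5 (.seq p (.put 2 (.var 5) (.var 6))))
    (.assign 2 (.const 2))),
    Polynomial.C 2 + ((Polynomial.X * (q + Polynomial.C 3 + Polynomial.C 6) +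
      Polynomial.C 2) + Polynomial.C 2), fun n I s hI => ?_⟩
  simp only [Polynomial.eval_add, Polynomial.eval_C, Polynomial.eval_mul, Polynomial.eval_X]
  refine (Exec.assign (P := fun s' => Agree 2 s s' ∧ s'.var 5 = n)
    ⟨(Agree.refl 2 s).setVar (by omega) _, by simp [Term.eval, hI.1]⟩).seq fun s₁ hs₁ => ?_
  refine (Exec.forDown (s := s₁) (N := n) (Inv := fun i s' => Agree 2 s s' ∧
      ∀ v : Fin n, i ≤ v → s'.arr 2 v = ind (P n I v))
    ⟨hs₁.1, fun v hv => absurd v.2 (by omega)⟩ hs₁.2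
    fun i s₂ hi hs₂ _ => ?_).seq fun s₂ hs₂ => ?_
  · have hag : Agree 2 s (s₂.setVar 5 i) := hs₂.1.setVar (by omega) _
    refine (h n I (fun _ => ⟨i, hi⟩) _ (hI.agree hag) fun _ => by simp).seq fun s₃ hs₃ => ?_
    have h5 : s₃.var 5 = i := by rw [hs₃.2.1 5 (by omega)]; simp
    refine Exec.put ⟨⟨(hag.trans (hs₃.2.mono (by omega))).setArr le_rfl _ _, fun v hv => ?_⟩, h5⟩
    rw [State.setArr_arr_self]
    split_ifs with hvi
    · rw [show v = ⟨i, hi⟩ from Fin.ext (hvi.trans h5)]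
      exact hs₃.1
    · have hvi' : (v : ℕ) ≠ i := fun h => hvi (h.trans h5.symm)
      rw [hs₃.2.2 2 (by omega)]
      exact hs₂.2 v (by omega)
  · exact Exec.assign (e := .const 2) ⟨by simp [Term.eval], fun v => hs₂.1.2 v (Nat.zero_le _)⟩

/-- Adjacency after deletion of vertex `e 0`: the new number `e 1` or `e 2` belongs to the old
vertex with the same number, or one more from `e 0` on. -/
theorem def_succAbove : Def fun _ I e _ => ∃ a b, I.G.Adj a b ∧
    (a : ℕ) = e 1 + ind (e 0 ≤ e 1) ∧ (b : ℕ) = e 2 + ind (e 0 ≤ e 2) := by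
  have h : ∀ i j k : ℕ, Def fun _ _ e _ => (e i : ℕ) = e j + ind (e k ≤ e j) := fun i j k => by
    have hc : Comp fun _ _ e _ => (e j : ℕ) + ind (e k ≤ e j) :=
      (Comp.idx j).add (Def.le (Comp.idx k) (Comp.idx j))
    exact ((Def.le (Comp.idx i) hc).and (Def.le hc (Comp.idx i))).congr fun _ _ _ _ =>
      le_antisymm_iff.symm
  exact Def.ex (Def.ex ((Def.adj 1 0).and ((h 1 3 2).and (h 0 4 2))))

/-- The cell of entry `(e 1, e 2)` in a matrix with rows of length `n - 1`; the product arises as a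
sum over all vertices. -/
theorem comp_index : Comp fun n _ e _ => n * e 1 - e 1 + e 2 :=
  Comp.congr (((Comp.sum (f := fun _ _ e _ _ => (e 1 : ℕ)) (Comp.idx 2)).sub (Comp.idx 1)).add
    (Comp.idx 2)) fun n I e S => by simp

theorem comp_area : Comp fun n _ _ _ => n * n :=
  Comp.congr (Comp.sum (f := fun n _ _ _ _ => n) Comp.size) fun n I e S => by simp

theorem eq_and_eq_of_mul_add_eq {m i i' j j' : ℕ} (hj : j < m) (hj' : j' < m)
    (h : i * m + j = i' * m + j') : i = i' ∧ j = j' := by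
  have hi : i = i' := by
    have := congrArg (· / m) h
    simpa [Nat.mul_add_div (by omega : 0 < m), Nat.mul_comm _ m, Nat.div_eq_of_lt hj,
      Nat.div_eq_of_lt hj'] using this
  subst hi
  omega

theorem val_succAbove_eq {m : ℕ} (v : Fin (m + 1)) (i : Fin m) :
    (v.succAbove i : ℕ) = i.castSucc + ind (v ≤ i.castSucc) := by
  by_cases h : v ≤ i.castSucc
  · rw [ind_true h, Fin.succAbove_of_le_castSucc _ _ h]; rfl
  · rw [ind_false h, Fin.succAbove_of_castSucc_lt _ _ (not_le.1 h)]; rfl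

/-- Output the graph without the vertex whose number is held in variable `4`. -/
theorem exists_delete : ∃ (p : Prog) (q : Polynomial ℕ), ∀ (m : ℕ) (I : Inst (m + 1)) (s : State)
    (v : Fin (m + 1)), HoldsInput I s → s.var 4 = v + 1 →
      Exec p (q.eval (m + 1)) s fun s' =>
        s'.var 2 = 1 ∧ HoldsInstance s' (I.G.comap v.succAboveEmb) I.t := by
  have hρ : ∀ i, scons 4 (scons 5 fun _ => 6) i < 7 :=
    scons_lt (by omega) (scons_lt (by omega) fun _ => by omega)
  obtain ⟨p, q, hp⟩ := Comp.exists_prog def_succAbove _ 7 hρ (by omega)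
  obtain ⟨p', q', hp'⟩ := comp_index.exists_prog _ 8 (fun i => (hρ i).trans (by omega)) (by omega)
  obtain ⟨p'', q'', hp''⟩ := comp_area.exists_prog (fun _ => 4) 7 (fun i => by omega) (by omega)
  -- The new matrix is built in array `4`, because the old one in array `0` is still read and the
  -- row length changes. Copying `n * n` cells is more than needed; the surplus lies outside the new
  -- matrix.
  refine ⟨.seq (.assign 4 (.sub (.var 4) (.const 1)))
    (.seq (.seq (.assign 5 (.sub (.var 0) (.const 1)))
      (forDown 5 (.seq (.assign 6 (.sub (.var 0) (.const 1)))
        (forDown 6 (.seq p (.seq p' (.put 4 (.var 8) (.var 7))))))))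
    (.seq (.seq p'' (.seq (.assign 5 (.var 7))
      (forDown 5 (.put 0 (.var 5) (.get 4 (.var 5))))))
    (.seq (.assign 0 (.sub (.var 0) (.const 1))) (.assign 2 (.const 1))))),
    Polynomial.C 4 + ((Polynomial.C 4 + (Polynomial.X * ((Polynomial.C 4 + (Polynomial.X *
      ((q + (q' + Polynomial.C 3)) + Polynomial.C 6) + Polynomial.C 2)) + Polynomial.C 6) +
      Polynomial.C 2)) + ((q'' + (Polynomial.C 2 + (Polynomial.X * Polynomial.X * Polynomial.C 10 +
      Polynomial.C 2))) + (Polynomial.C 4 + Polynomial.C 2))), fun m I s v hI hv => ?_⟩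
  simp only [Polynomial.eval_add, Polynomial.eval_C, Polynomial.eval_mul, Polynomial.eval_X]
  set G' := I.G.comap v.succAboveEmb with hG'
  refine (Exec.assign (P := fun s' => Agree 2 s s' ∧ s'.var 4 = v)
    ⟨(Agree.refl 2 s).setVar (by omega) _, by simp [Term.eval, hv]⟩).seq fun s₁ hs₁ => ?_
  refine Exec.seq (P := fun s' => Agree 2 s s' ∧ s'.var 4 = v ∧
    ∀ i j : Fin m, s'.arr 4 (i * m + j) = ind (G'.Adj i j)) ?_ fun s₂ hs₂ => ?_
  · refine (Exec.assign (P := fun s' => (Agree 2 s s' ∧ s'.var 4 = v) ∧ s'.var 5 = m)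
      ⟨⟨hs₁.1.setVar (by omega) _, by simp [hs₁.2]⟩,
        by simp [Term.eval, (hI.agree hs₁.1).1]⟩).seq fun s₂ hs₂ => ?_
    refine (Exec.forDown (K := 4 + ((m + 1) * (q.eval (m + 1) + (q'.eval (m + 1) + 3) + 6) + 2))
      (s := s₂) (N := m) (Inv := fun i s' => (Agree 2 s s' ∧ s'.var 4 = v) ∧
        ∀ i' j' : Fin m, i ≤ i' → s'.arr 4 (i' * m + j') = ind (G'.Adj i' j'))
      ⟨hs₂.1, fun i' _ hi' => absurd i'.2 (by omega)⟩ hs₂.2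
      fun i s₃ hi hs₃ _ => ?_).mono
      (Nat.add_le_add_right (Nat.mul_le_mul_right _ (Nat.le_succ m)) _)
      fun s' hs' => ⟨hs'.1.1.1, hs'.1.1.2, fun i j => hs'.1.2 i j (Nat.zero_le _)⟩
    have hag : Agree 2 s (s₃.setVar 5 i) := hs₃.1.1.setVar (by omega) _
    refine (Exec.assign (P := fun s' => ((Agree 2 s s' ∧ s'.var 4 = v ∧ s'.var 5 = i) ∧
        s'.arr 4 = s₃.arr 4) ∧ s'.var 6 = m)
      ⟨⟨⟨hag.setVar (by omega) _, by simp [hs₃.1.2], by simp⟩, rfl⟩,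
        by rw [State.setVar_var, if_pos rfl]; simp [Term.eval, (hI.agree hs₃.1.1).1]⟩).seq
        fun s₄ hs₄ => ?_
    refine (Exec.forDown (K := q.eval (m + 1) + (q'.eval (m + 1) + 3))
      (s := s₄) (N := m) (Inv := fun j s' => (Agree 2 s s' ∧ s'.var 4 = v ∧ s'.var 5 = i) ∧
        ∀ i' j' : Fin m, (i < i' ∨ (i = i' ∧ j ≤ j')) →
          s'.arr 4 (i' * m + j') = ind (G'.Adj i' j'))
      ⟨hs₄.1.1, fun i' j' h' => ?_⟩ hs₄.2
      fun j s₅ hj hs₅ _ => ?_).mono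
      (Nat.add_le_add_right (Nat.mul_le_mul_right _ (Nat.le_succ m)) _)
      fun s' hs' => ⟨⟨⟨hs'.1.1.1, hs'.1.1.2.1⟩, fun i' j' hi' => ?_⟩, hs'.1.1.2.2⟩
    · rw [hs₄.1.2]
      rcases h' with h' | h'
      · exact hs₃.2 i' j' h'
      · exact absurd j'.2 (by omega)
    · let e : ℕ → Fin (m + 1) := scons v (scons (Fin.castSucc ⟨i, hi⟩)
        fun _ => Fin.castSucc ⟨j, hj⟩)
      have hag₅ : Agree 2 s (s₅.setVar 6 j) := hs₅.1.1.setVar (by omega) _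
      have he : ∀ k, (s₅.setVar 6 j).var (scons 4 (scons 5 fun _ => 6) k) = e k := by
        rintro (_ | _ | k)
        · simp [scons, e, hs₅.1.2.1]
        · simp [scons, e, hs₅.1.2.2]
        · simp [scons, e]
      refine (hp _ I e _ (hI.agree hag₅) he).seq fun s₆ hs₆ => ?_
      have hag₆ : Agree 2 s s₆ := hag₅.trans (hs₆.2.mono (by omega))
      refine (hp' _ I e _ (hI.agree hag₆)
        fun k => (hs₆.2.1 _ (hρ k)).trans (he k)).seq fun s₇ hs₇ => ?_
      have hag₇ : Agree 2 s s₇ := hag₆.trans (hs₇.2.mono (by omega))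
      have hidx : s₇.var 8 = i * m + j := by
        rw [hs₇.1]
        simp only [e, scons, Fin.val_castSucc]
        rw [Nat.succ_mul, Nat.add_sub_cancel, Nat.mul_comm]
      have hval : s₇.var 7 = ind (G'.Adj ⟨i, hi⟩ ⟨j, hj⟩) := by
        rw [hs₇.2.1 7 (by omega), hs₆.1]
        congr 1
        simp only [e, scons]
        rw [← val_succAbove_eq, ← val_succAbove_eq, eq_iff_iff]
        constructor
        · rintro ⟨a, b, hab, ha, hb⟩
          rw [Fin.ext ha, Fin.ext hb] at hab
          exact hab
        · exact fun hab => ⟨_, _, hab, rfl, rfl⟩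
      refine Exec.put ⟨⟨⟨hag₇.setArr (by omega) _ _, ?_, ?_⟩, fun i' j' h' => ?_⟩, ?_⟩
      · rw [State.setArr_var, hs₇.2.1 4 (by omega), hs₆.2.1 4 (by omega)]
        simp [hs₅.1.2.1]
      · rw [State.setArr_var, hs₇.2.1 5 (by omega), hs₆.2.1 5 (by omega)]
        simp [hs₅.1.2.2]
      · rw [State.setArr_arr_self]
        split_ifs with hc
        · have hc : (i' * m + j' : ℕ) = i * m + j := hc.trans hidx
          obtain ⟨hci, hcj⟩ := eq_and_eq_of_mul_add_eq j'.2 hj hc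
          rw [show i' = ⟨i, hi⟩ from Fin.ext hci, show j' = ⟨j, hj⟩ from Fin.ext hcj]
          exact hval
        · have hc : (i' * m + j' : ℕ) ≠ i * m + j := fun h => hc (h.trans hidx.symm)
          rw [hs₇.2.2 4 (by omega), hs₆.2.2 4 (by omega)]
          refine hs₅.2 i' j' (h'.imp_right fun h' => ⟨h'.1, ?_⟩)
          refine Nat.succ_le_of_lt (lt_of_le_of_ne h'.2 fun h => hc ?_)
          rw [h'.1, h]
      · rw [State.setArr_var, hs₇.2.1 6 (by omega), hs₆.2.1 6 (by omega)]
        simp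
    · refine hs'.1.2 i' j' ?_
      rcases hi'.eq_or_lt with h | h
      · exact Or.inr ⟨h, Nat.zero_le _⟩
      · exact Or.inl h
  refine Exec.seq (P := fun s' => s'.var 0 = m + 1 ∧ s'.var 1 = I.t ∧
    ∀ i j : Fin m, s'.arr 0 (i * m + j) = ind (G'.Adj i j)) ?_ fun s₃ hs₃ => ?_
  · refine (hp'' _ I (fun _ => v) s₂ (hI.agree hs₂.1) fun _ => hs₂.2.1).seq fun s₃ hs₃ => ?_
    have hI₃ := (hI.agree hs₂.1).agree (hs₃.2.mono (by omega : 2 ≤ 7))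
    refine (Exec.assign (P := fun s' => (s'.var 0 = m + 1 ∧ s'.var 1 = I.t ∧ s'.arr 4 = s₂.arr 4) ∧
        s'.var 5 = (m + 1) * (m + 1))
      ⟨⟨by simp [hI₃.1], by simp [hI₃.2.1], hs₃.2.2 4 (by omega)⟩,
        by simp [Term.eval, hs₃.1]⟩).seq fun s₄ hs₄ => ?_
    refine (Exec.forDown (K := 4) (s := s₄) (N := (m + 1) * (m + 1))
      (Inv := fun k s' => (s'.var 0 = m + 1 ∧ s'.var 1 = I.t ∧ s'.arr 4 = s₂.arr 4) ∧
        ∀ l, k ≤ l → l < (m + 1) * (m + 1) → s'.arr 0 l = s₂.arr 4 l)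
      ⟨hs₄.1, fun l hl hl' => absurd hl' (by omega)⟩ hs₄.2 fun k s₅ hk hs₅ _ => ?_).imp
      fun s' hs' => ⟨hs'.1.1.1, hs'.1.1.2.1, fun i j => ?_⟩
    · refine Exec.put ⟨⟨⟨by simp [hs₅.1.1], by simp [hs₅.1.2.1], ?_⟩, fun l hl hl' => ?_⟩, by simp⟩
      · rw [State.setArr_arr_of_ne _ _ _ (by omega)]
        exact hs₅.1.2.2
      · rw [State.setArr_arr_self]
        simp only [Term.eval, State.setVar_var, if_true, State.setVar_arr]
        split_ifs with hlk
        · rw [hlk, hs₅.1.2.2]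
        · exact hs₅.2 l (by omega) hl'
    · rw [hs'.1.2 _ (Nat.zero_le _), hs₂.2.2]
      have := Nat.mul_le_mul_right m (Nat.succ_le_of_lt i.2)
      have := j.2
      nlinarith
  · refine (Exec.assign (P := fun s' => s'.var 0 = m ∧ s'.var 1 = I.t ∧
      ∀ i j : Fin m, s'.arr 0 (i * m + j) = ind (G'.Adj i j))
      ⟨by simp [Term.eval, hs₃.1], by simp [hs₃.2.1], hs₃.2.2⟩).seq fun s₄ hs₄ => ?_
    exact Exec.assign (e := .const 1) ⟨by simp [Term.eval], by simp [hs₄.1], by simp [hs₄.2.1],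
      hs₄.2.2⟩

/-! ## Correctness -/

open RAM

section Correctness

variable {n : ℕ} {G : SimpleGraph (Fin n)} {t : ℕ} {X : Set (Fin n)}

theorem holdsInput_inputState : HoldsInput ⟨G, t, X⟩ (inputState G t X) := by
  refine ⟨by simp [inputState], by simp [inputState], fun i j => ?_, fun i => ?_⟩
  · simp only [inputState, if_true, ind]
    classical
    refine if_congr ⟨?_, fun h => ⟨i, j, rfl, h⟩⟩ rfl rfl
    rintro ⟨i', j', hk, h⟩
    obtain ⟨hi, hj⟩ := eq_and_eq_of_mul_add_eq j.2 j'.2 hk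
    rwa [Fin.ext hi, Fin.ext hj]
  · simp only [inputState, one_ne_zero, if_false, if_true, ind]
    classical
    refine if_congr ⟨?_, fun h => ⟨i, rfl, h⟩⟩ rfl rfl
    rintro ⟨i', hk, h⟩
    rwa [Fin.ext hk]

/-- Restricting a solution to the smaller graph is always possible; conversely `hv` says that a
solution of the smaller graph is one of `G` without taking `v`. -/
theorem isYesInstance_iff_delete {m : ℕ} {G : SimpleGraph (Fin (m + 1))} {v : Fin (m + 1)}
    (hv : ∀ S : Set (Fin (m + 1)), S.ncard ≤ t → TW G ({v}ᶜ \ S) → TW G Sᶜ) :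
    IsYesInstance G t ↔ IsYesInstance (G.comap v.succAboveEmb) t := by
  constructor
  · rintro ⟨S, hS, hSt⟩
    refine ⟨v.succAboveEmb ⁻¹' S, treewidthAtMost_induce_iff.2 (tw_comap_iff.2 ?_), le_trans ?_ hSt⟩
    · refine (treewidthAtMost_induce_iff.1 hS).mono_set ?_
      rintro _ ⟨w, hw, rfl⟩
      exact hw
    · rw [← Set.ncard_image_of_injective _ v.succAboveEmb.injective]
      exact Set.ncard_le_ncard (Set.image_preimage_subset _ _) (Set.toFinite _)
  · rintro ⟨S, hS, hSt⟩
    have hcard : (v.succAboveEmb '' S).ncard ≤ t := by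
      rwa [Set.ncard_image_of_injective _ v.succAboveEmb.injective]
    refine ⟨v.succAboveEmb '' S, treewidthAtMost_induce_iff.2 (hv _ hcard ?_), hcard⟩
    refine (tw_comap_iff.1 (treewidthAtMost_induce_iff.1 hS)).mono_set ?_
    rintro w ⟨hw, hwS⟩
    obtain ⟨u, rfl⟩ := Fin.exists_succAbove_eq hw
    exact ⟨u, fun hu => hwS ⟨u, hu, rfl⟩, rfl⟩

theorem Inst.Redundant.tw (hX : IsTidyModulator G X) {v : Fin n}
    (hv : (⟨G, t, X⟩ : Inst n).Redundant v) {S : Set (Fin n)} (hS : S.ncard ≤ t)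
    (hSv : TW G ({v}ᶜ \ S)) : TW G Sᶜ := by
  have hX₁ : TW G Xᶜ := treewidthAtMost_induce_iff.1 hX.1
  have hX₂ : ∀ x ∈ X, TW G (X \ {x})ᶜ := fun x hx => treewidthAtMost_induce_iff.1 (hX.2 x hx)
  rcases hv with ⟨x, y, hv⟩ | hv
  · exact Reducible.tw hX₁ hX₂ Set.subset_union_left hv hS hSv
  · exact Reducible.tw hX₁ hX₂ Set.subset_union_left hv hS hSv

theorem tw_of_isSolution_del {C : Set (Fin n)} {S : Set ↥Cᶜ} (hS : IsSolution (del G C) t S) :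
    TW G (Cᶜ \ (Subtype.val '' S)) := by
  have h : TW (G.comap (Function.Embedding.subtype (· ∈ Cᶜ))) Sᶜ :=
    treewidthAtMost_induce_iff.1 hS.1
  refine (tw_comap_iff.1 h).mono_set ?_
  rintro w ⟨hw, hwS⟩
  exact ⟨⟨w, hw⟩, fun h => hwS ⟨_, h, rfl⟩, rfl⟩

theorem Inst.separator_subset (I : Inst n) : I.separator ⊆ I.Xᶜ :=
  bags_subset (branchClosure_subset marks_subset)

theorem isComponentSeparator_separator (hX : IsTidyModulator G X) :
    IsComponentSeparator G t X (⟨G, t, X⟩ : Inst n).separator := by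
  set I : Inst n := ⟨G, t, X⟩ with hI
  have hr : GoodOrder G Xᶜ I.order := TW.goodOrder_rk (treewidthAtMost_induce_iff.1 hX.1)
  refine ⟨Set.disjoint_left.2 fun v hv hvX => I.separator_subset hv hvX, fun C hC => ?_⟩
  obtain ⟨v, hv, rfl⟩ := mem_components_iff.1 hC
  set C := {w | Reach G (X ∪ I.separator)ᶜ v w} with hCdef
  intro S hS
  have hCsub : C ⊆ (X ∪ I.separator)ᶜ := Reach.subset hv
  have hpair : ∀ x y : Fin n, x ∈ openNbhd G C → x ∈ X → x ∉ Subtype.val '' S →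
      y ∈ openNbhd G C → y ∈ X → y ∉ Subtype.val '' S → x < y → False := by
    intro x y hxC hx hxS hyC hy hyS hxy
    have hsee : ∀ z ∈ openNbhd G C, Sees G C z := fun z hz => by
      obtain ⟨u, hu, h⟩ := hz.2
      exact ⟨u, hu, h⟩
    refine no_solution_avoids_pair (t := t) hr (connSet_reach _ _ _)
      (fun w hw hwX => hCsub hw (Or.inl hwX)) ?_ hx hy hxy.ne (hsee x hxC) (hsee y hyC)
      (tw_of_isSolution_del hS) ?_ hxS hyS
    · refine Set.disjoint_left.2 fun w hw hwY => hCsub hw (Or.inr (bags_mono ?_ hwY))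
      exact fun m hm => subset_branchClosure ⟨x, y, hx, hy, hxy, hm⟩
    · rw [Set.ncard_image_of_injective _ Subtype.val_injective]
      exact hS.2
  by_contra! hlt
  obtain ⟨x, y, hx, hy, hxy⟩ := (Set.one_lt_ncard_iff (Set.toFinite _)).1 hlt
  have hS' : ∀ z : ↥Cᶜ, z ∉ S → (z : Fin n) ∉ Subtype.val '' S := by
    rintro z hz ⟨w, hw, hwz⟩
    exact hz (Subtype.ext hwz ▸ hw)
  rcases lt_or_gt_of_ne (fun h => hxy (Subtype.ext h) : (x : Fin n) ≠ y) with h | h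
  · exact hpair x y hx.1.1 hx.1.2 (hS' x hx.2) hy.1.1 hy.1.2 (hS' y hy.2) h
  · exact hpair y x hy.1.1 hy.1.2 (hS' y hy.2) hx.1.1 hx.1.2 (hS' x hx.2) h

/-- The factor 6 of `boundY` is 3 for the size of a bag times 2 for the closure under branching. -/
theorem ncard_separator_le (hX : IsLinkedTidyModulator G t X)
    (hred : ∀ v, ¬ (⟨G, t, X⟩ : Inst n).Redundant v) :
    (⟨G, t, X⟩ : Inst n).separator.ncard ≤ boundY t X.ncard := by
  set I : Inst n := ⟨G, t, X⟩ with hI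
  have hr : GoodOrder G Xᶜ I.order := TW.goodOrder_rk (treewidthAtMost_induce_iff.1 hX.2.1)
  have h₁ : I.separator.ncard ≤ 3 * _ := ncard_bags_le hr (branchClosure_subset marks_subset)
  have h₂ := ncard_branchClosure_le (M := marks G t I.order Xᶜ X) hr
  have h₃ := ncard_marks_le hr hX.1 fun x y v h => hred v (Or.inl ⟨x, y, h⟩)
  calc I.separator.ncard ≤ 3 * (2 * _) := h₁.trans (Nat.mul_le_mul_left 3 h₂)
    _ ≤ 3 * (2 * _) := Nat.mul_le_mul_left 3 (Nat.mul_le_mul_left 2 h₃)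
    _ = boundY t X.ncard := by rw [boundY]; ring

/-- The two halves of `Inst.Redundant` serve different bounds: irreducibility after the first marks
of each pair bounds `|Y|`, and irreducibility for `X ∪ Y` bounds the number of components left at
the end. -/
theorem separatorOutcome_of_not_redundant (hX : IsLinkedTidyModulator G t X)
    (hred : ∀ v, ¬ (⟨G, t, X⟩ : Inst n).Redundant v) {s : State} (hs : s.var 2 = 2)
    (hsY : ∀ v : Fin n, s.arr 2 v = ind (v ∈ (⟨G, t, X⟩ : Inst n).separator)) :
    SeparatorOutcome G t X s := by
  have hr : GoodOrder G Xᶜ (⟨G, t, X⟩ : Inst n).order :=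
    TW.goodOrder_rk (treewidthAtMost_induce_iff.1 hX.2.1)
  refine ⟨hs, _, hsY, isComponentSeparator_separator hX.2, ncard_separator_le hX hred,
    (ncard_components_le fun v h => hred v (Or.inr h)).trans
      (boundC_mono (Set.ncard_union_le _ _)), fun C hC => ?_⟩
  obtain ⟨v, hv, rfl⟩ := mem_components_iff.1 hC
  have hCsub := Reach.subset (G := G) (A := (X ∪ (⟨G, t, X⟩ : Inst n).separator)ᶜ) hv
  exact ncard_openNbhd_inter_le hr marks_subset (connSet_reach _ _ _)
    (fun w hw hwX => hCsub hw (Or.inl hwX)) ⟨v, Reach.refl _ _ _⟩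
    (Set.disjoint_left.2 fun w hw hwY => hCsub hw (Or.inr hwY))

end Correctness

theorem exists_polynomial_algorithm :
    ∃ (prog : Prog) (poly : Polynomial ℕ),
      ∀ (n : ℕ) (G : SimpleGraph (Fin n)) (t : ℕ) (X : Set (Fin n)),
        ¬ IsTrivialInstance G t →
        IsLinkedTidyModulator G t X →
        ∃ (k : ℕ) (s : State),
          Run prog (inputState G t X) k s ∧
          k ≤ poly.eval n ∧
          (ReducedOutcome G t s ∨ SeparatorOutcome G t X s) := by
  obtain ⟨p, q, hp⟩ := def_redundant.exists_search
  obtain ⟨p₁, q₁, hp₁⟩ := exists_delete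
  obtain ⟨p₂, q₂, hp₂⟩ := Def.exists_output (P := fun _ I v => v ∈ I.separator)
    (defSet_separator.mem 0 (fun k => k) fun j => j)
  refine ⟨.seq p (.branch (.var 4) p₁ p₂), q + (Polynomial.C 2 + (q₁ + q₂)),
    fun n G t X htriv hX => ?_⟩
  -- The deletion program is specified on `Fin (m + 1)`; a non-trivial instance is not empty.
  obtain ⟨m, rfl⟩ : ∃ m, n = m + 1 := by
    refine Nat.exists_eq_succ_of_ne_zero fun h => htriv (Or.inl ?_)
    simp [h]
  simp only [Polynomial.eval_add, Polynomial.eval_C]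
  obtain ⟨k, s, hrun, hk, hs⟩ : Exec (.seq p (.branch (.var 4) p₁ p₂)) _ (inputState G t X)
      fun s => ReducedOutcome G t s ∨ SeparatorOutcome G t X s := by
    refine (hp _ ⟨G, t, X⟩ _ holdsInput_inputState).seq fun s ⟨hI, hs⟩ =>
      Exec.branch (K := q₁.eval (m + 1) + q₂.eval (m + 1)) (fun h4 => ?_) fun h4 => ?_
    · rcases hs with hs | ⟨v, hv, hvs⟩
      · exact absurd hs.1 h4
      · exact (hp₁ m _ s v hI hvs).mono (Nat.le_add_right _ _) fun s' hs' =>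
          Or.inl ⟨hs'.1, m, _, hs'.2, Nat.lt_succ_self m,
            isYesInstance_iff_delete fun S hS hSv => hv.tw hX.2 hS hSv⟩
    · rcases hs with hs | ⟨v, hv, hvs⟩
      · exact (hp₂ _ _ s hI).mono (Nat.le_add_left _ _) fun s' hs' =>
          Or.inr (separatorOutcome_of_not_redundant hX hs.2 hs'.1 hs'.2)
      · have h4 : s.var 4 = 0 := h4
        omega
  exact ⟨k, s, hrun, hk, hs⟩

end TW2D

theorem mainTheorem5 :
    ∃ (prog : TW2D.RAM.Prog) (poly : Polynomial ℕ),
      ∀ (n : ℕ) (G : SimpleGraph (Fin n)) (t : ℕ) (X : Set (Fin n)),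
        ¬ TW2D.IsTrivialInstance G t →
        TW2D.IsLinkedTidyModulator G t X →
        ∃ (k : ℕ) (s : TW2D.RAM.State),
          TW2D.RAM.Run prog (TW2D.inputState G t X) k s ∧
          k ≤ poly.eval n ∧
          (TW2D.ReducedOutcome G t s ∨ TW2D.SeparatorOutcome G t X s) :=
  TW2D.exists_polynomial_algorithm
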